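/- Let $T^3=\mathbb{R}^3/\mathbb{Z}^3$ be the 3-torus, with its standard real-analytic structure and orientation, and let $g$ be any real-analytic Riemannian metric on $T^3$. Then $(T^3,g)$ can be isometrically embedded as a special Lagrangian submanifold of a Calabi–Yau manifold. Precisely: there exist a (connected, Hausdorff, second countable) complex manifold $\overline{M}$ of complex dimension 3, a nowhere-vanishing holomorphic 3-form $\Omega$ and a Kähler form $\omega$ on $\overline{M}$ with $$\frac{\omega^3}{3!}=-\left(\frac{i}{2}\right)^3\,\Omega\wedge\overline{\Omega},$$ and a real-analytic embedding $\iota:T^3\to\overline{M}$ such that 1. $\iota$ is isometric: $\omega(d\iota(u),J\,d\iota(v))=g(u,v)$ for all $p\in T^3$ and all $u,v\in T_pT^3$, where $J$ is the complex structure of $\overline{M}$; 2. $\iota$ is special Lagrangian: $\iota^*(\operatorname{Re}\Omega)=\operatorname{Vol}_g$, the Riemannian volume form of $(T^3,g)$, and $\iota^*(\operatorname{Im}\Omega)=0$, $\iota^*\omega=0$. -/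

import Mathlib

open scoped Manifold ContDiff

noncomputable section

/-! ### The torus `ℝⁿ / ℤⁿ` as a real-analytic manifold -/

/-- The lattice `ℤⁿ` of integer vectors in `ℝⁿ`. -/
def integerLattice (n : ℕ) : AddSubgroup (EuclideanSpace ℝ (Fin n)) where
  carrier := {x | ∀ i, ∃ k : ℤ, x i = k}
  zero_mem' := fun _ => ⟨0, by simp⟩
  add_mem' := by
    intro a b ha hb i
    obtain ⟨k, hk⟩ := ha i
    obtain ⟨l, hl⟩ := hb i
    exact ⟨k + l, by simp [hk, hl]⟩
  neg_mem' := by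
    intro a ha i
    obtain ⟨k, hk⟩ := ha i
    exact ⟨-k, by simp [hk]⟩

theorem integerLattice_eq_zero {n : ℕ} {x : EuclideanSpace ℝ (Fin n)}
    (hx : x ∈ integerLattice n) (h : ‖x‖ < 1) : x = 0 := by
  ext i
  obtain ⟨k, hk⟩ := hx i
  have h1 : |x i| < 1 := lt_of_le_of_lt (by simpa using PiLp.norm_apply_le x i) h
  rw [hk] at h1 ⊢
  have h2 : |k| < 1 := by
    rw [← Int.cast_abs] at h1
    exact Int.cast_lt.1 (h1.trans_eq Int.cast_one.symm)
  have h3 : k = 0 := Int.abs_lt_one_iff.1 h2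
  simp [h3]

theorem integerLattice_isDiscrete (n : ℕ) :
    IsDiscrete (integerLattice n : Set (EuclideanSpace ℝ (Fin n))) := by
  refine isDiscrete_iff_forall_mem_exists_isOpen.2 fun y hy => ⟨Metric.ball y 1, Metric.isOpen_ball, ?_⟩
  ext z
  constructor
  · rintro ⟨hz1, hz2⟩
    have h := integerLattice_eq_zero ((integerLattice n).sub_mem hz2 hy)
      (by simpa [dist_eq_norm] using hz1)
    exact sub_eq_zero.1 h
  · rintro rfl
    exact ⟨Metric.mem_ball_self one_pos, hy⟩

/-- The standard `n`-torus `ℝⁿ / ℤⁿ`, with the quotient topology. -/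
abbrev Torus (n : ℕ) : Type := EuclideanSpace ℝ (Fin n) ⧸ integerLattice n

/-- The projection `ℝⁿ → ℝⁿ / ℤⁿ`. -/
def torusProj (n : ℕ) : EuclideanSpace ℝ (Fin n) → Torus n :=
  QuotientAddGroup.mk

theorem torusProj_isLocalHomeomorph (n : ℕ) : IsLocalHomeomorph (torusProj n) :=
  ((integerLattice n).isAddQuotientCoveringMap
    (integerLattice_isDiscrete n)).isCoveringMap.isLocalHomeomorph

/-- The charts of the torus are local inverses of the projection `ℝⁿ → ℝⁿ / ℤⁿ`. -/
instance torusChartedSpace (n : ℕ) : ChartedSpace (EuclideanSpace ℝ (Fin n)) (Torus n) :=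
  (torusProj_isLocalHomeomorph n).chartedSpace Quotient.mk_surjective

theorem torus_atlas_symm {n : ℕ} {e : OpenPartialHomeomorph (Torus n) (EuclideanSpace ℝ (Fin n))}
    (he : e ∈ atlas (EuclideanSpace ℝ (Fin n)) (Torus n)) : ⇑e.symm = torusProj n := by
  obtain ⟨q, rfl⟩ := he
  rw [OpenPartialHomeomorph.coe_trans_symm, IsLocalHomeomorph.localInverseAt_symm]
  rw [chartAt_self_eq]
  rfl

theorem torus_translation {n : ℕ} {f : EuclideanSpace ℝ (Fin n) → EuclideanSpace ℝ (Fin n)}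
    {s : Set (EuclideanSpace ℝ (Fin n))} (hs : IsOpen s) (hf : ContinuousOn f s)
    (hfs : ∀ x ∈ s, torusProj n (f x) = torusProj n x)
    {x : EuclideanSpace ℝ (Fin n)} (hx : x ∈ s) :
    f =ᶠ[nhds x] fun y => y + (f x - x) := by
  have hc : ContinuousAt (fun y => f y - y - (f x - x)) x :=
    ((hf.continuousAt (hs.mem_nhds hx)).sub continuousAt_id).sub continuousAt_const
  have h1 : ∀ᶠ y in nhds x, ‖f y - y - (f x - x)‖ < 1 :=
    hc.norm.eventually_lt_const (by simp)
  have hmem : ∀ y ∈ s, f y - y ∈ integerLattice n := fun y hy => by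
    have h := QuotientAddGroup.eq.1 (hfs y hy)
    have h' := (integerLattice n).neg_mem h
    rwa [neg_add_rev, neg_neg, ← sub_eq_neg_add] at h'
  filter_upwards [h1, hs.mem_nhds hx] with y hy hys
  have h := integerLattice_eq_zero ((integerLattice n).sub_mem (hmem y hys) (hmem x hx)) hy
  have h2 := sub_eq_zero.1 h
  rw [← h2]; abel

instance torusIsManifold (n : ℕ) : IsManifold 𝓘(ℝ, EuclideanSpace ℝ (Fin n)) ω (Torus n) := by
  refine isManifold_of_contDiffOn _ _ _ fun e e' he he' => ?_
  simp only [modelWithCornersSelf_coe, modelWithCornersSelf_coe_symm, Function.comp_id,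
    Function.id_comp, Set.range_id, Set.preimage_id, Set.inter_univ]
  intro x hx
  have hs := (e.symm.trans e').open_source
  have h := torus_translation hs (e.symm.trans e').continuousOn (fun y hy => by
    rw [← torus_atlas_symm he']
    rw [OpenPartialHomeomorph.trans_source] at hy
    rw [OpenPartialHomeomorph.coe_trans, Function.comp_apply, e'.left_inv hy.2,
      torus_atlas_symm he, torus_atlas_symm he']) hx
  exact ((contDiff_id.add contDiff_const).contDiffAt.congr_of_eventuallyEq h).contDiffWithinAt

/-- A real-analytic Riemannian metric on the `n`-torus. -/
abbrev AnalyticTorusMetric (n : ℕ) :=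
  Bundle.ContMDiffRiemannianMetric 𝓘(ℝ, EuclideanSpace ℝ (Fin n)) ω (EuclideanSpace ℝ (Fin n))
    (fun p : Torus n => TangentSpace 𝓘(ℝ, EuclideanSpace ℝ (Fin n)) p)

/-- The coordinate vector field `∂/∂xᵢ` of the torus at the point `p`. All charts of the torus
differ by translations, so that it is the `i`-th standard basis vector in each of them, and it is
the image of that vector under the projection `ℝⁿ → ℝⁿ / ℤⁿ` (`mfderiv_torusProj`). -/
def torusFrame {n : ℕ} (i : Fin n) (p : Torus n) :
    TangentSpace 𝓘(ℝ, EuclideanSpace ℝ (Fin n)) p :=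
  EuclideanSpace.single i (1 : ℝ)

theorem mfderiv_torusProj {n : ℕ} (x : EuclideanSpace ℝ (Fin n)) (i : Fin n) :
    mfderiv 𝓘(ℝ, EuclideanSpace ℝ (Fin n)) 𝓘(ℝ, EuclideanSpace ℝ (Fin n)) (torusProj n) x
      (EuclideanSpace.single i (1 : ℝ)) = torusFrame i (torusProj n x) := by
  have hloc := torusProj_isLocalHomeomorph n
  set e := chartAt (EuclideanSpace ℝ (Fin n)) (torusProj n x) with he
  have hcont : Continuous (torusProj n) := hloc.continuous
  have hs : IsOpen (torusProj n ⁻¹' e.source) := e.open_source.preimage hcont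
  have hxs : x ∈ torusProj n ⁻¹' e.source :=
    mem_chart_source (EuclideanSpace ℝ (Fin n)) (torusProj n x)
  have h := torus_translation (f := e ∘ torusProj n) hs
    (e.continuousOn.comp hcont.continuousOn fun y hy => hy)
    (fun y hy => by
      rw [← torus_atlas_symm (chart_mem_atlas _ (torusProj n x))]
      rw [Function.comp_apply, e.left_inv]
      rw [torus_atlas_symm (chart_mem_atlas _ (torusProj n x))]
      exact hy) hxs
  have hd : HasFDerivAt (e ∘ torusProj n)
      (ContinuousLinearMap.id ℝ (EuclideanSpace ℝ (Fin n))) x :=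
    ((hasFDerivAt_id x).add_const _).congr_of_eventuallyEq h
  have hm : HasMFDerivAt 𝓘(ℝ, EuclideanSpace ℝ (Fin n)) 𝓘(ℝ, EuclideanSpace ℝ (Fin n))
      (torusProj n) x (ContinuousLinearMap.id ℝ (EuclideanSpace ℝ (Fin n))) := by
    refine ⟨hcont.continuousAt, ?_⟩
    simp only [mfld_simps]
    exact hd.hasFDerivWithinAt
  rw [hm.mfderiv]
  rfl

/-- The volume form of a Riemannian metric on the torus, for the standard orientation:
`√(det gᵢⱼ) dx₁ ∧ ⋯ ∧ dxₙ`, where `gᵢⱼ = g(∂/∂xᵢ, ∂/∂xⱼ)`. -/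
def AnalyticTorusMetric.volumeForm {n : ℕ} (g : AnalyticTorusMetric n) (p : Torus n)
    (u : Fin n → TangentSpace 𝓘(ℝ, EuclideanSpace ℝ (Fin n)) p) : ℝ :=
  √(Matrix.det (Matrix.of fun i j => g.inner p (torusFrame i p) (torusFrame j p))) *
    Matrix.det (Matrix.of fun i j => (show EuclideanSpace ℝ (Fin n) from u j) i)

/-! ### Differential forms on manifolds -/

section Forms

variable {𝕜 : Type*} [NontriviallyNormedField 𝕜]
  {V : Type*} [NormedAddCommGroup V] [NormedSpace 𝕜 V]
  {F : Type*} [NormedAddCommGroup F] [NormedSpace 𝕜 F]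
  {N : Type*} [TopologicalSpace N] [ChartedSpace V N] {k : ℕ}

variable (𝕜 V F N k) in
/-- A (not necessarily continuous) `F`-valued differential `k`-form on the `𝕜`-manifold `N`. -/
abbrev DiffForm := ∀ p : N, TangentSpace 𝓘(𝕜, V) p [⋀^Fin k]→L[𝕜] F

/-- The expression of a differential form in a chart `φ`: its pullback by `φ⁻¹`. -/
def DiffForm.inChart (α : DiffForm 𝕜 V F N k) (φ : OpenPartialHomeomorph N V) (z : V) :
    V [⋀^Fin k]→L[𝕜] F :=
  (α (φ.symm z)).compContinuousLinearMap (mfderiv 𝓘(𝕜, V) 𝓘(𝕜, V) φ.symm z)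

/-- The form is of class `C^m`, that is, it is so in every chart. -/
def DiffForm.IsOfClass (m : ℕ∞ω) (α : DiffForm 𝕜 V F N k) : Prop :=
  ∀ φ ∈ atlas V N, ContDiffOn 𝕜 m (DiffForm.inChart α φ) φ.target

/-- The form is closed, that is, its exterior derivative vanishes in every chart. -/
def DiffForm.IsClosedForm (α : DiffForm 𝕜 V F N k) : Prop :=
  ∀ φ ∈ atlas V N, ∀ z ∈ φ.target, extDeriv (DiffForm.inChart α φ) z = 0

/-- A form on a complex manifold whose values are complex multilinear forms (so that it is of type
`(k, 0)`) is holomorphic if it is complex differentiable in every holomorphic chart. -/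
def DiffForm.IsHolomorphic {V : Type*} [NormedAddCommGroup V] [NormedSpace ℂ V]
    {N : Type*} [TopologicalSpace N] [ChartedSpace V N] {k : ℕ}
    (α : DiffForm ℂ V ℂ N k) : Prop :=
  ∀ φ ∈ atlas V N, DifferentiableOn ℂ (DiffForm.inChart α φ) φ.target

end Forms

/-! ### Exterior products of complex-valued real forms on a vector space -/

section Wedge

variable {V : Type*} [AddCommGroup V] [Module ℝ V]

/-- The exterior product, with the normalisation
`(α ∧ β)(v₁, …, v_{p+q}) = ∑ sgn(σ) α(v_{σ(1)}, …, v_{σ(p)}) β(v_{σ(p+1)}, …, v_{σ(p+q)})`,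
the sum being over the `(p, q)`-shuffles. -/
def wedge {p q : ℕ} (α : V [⋀^Fin p]→ₗ[ℝ] ℂ) (β : V [⋀^Fin q]→ₗ[ℝ] ℂ) :
    V [⋀^Fin (p + q)]→ₗ[ℝ] ℂ :=
  ((LinearMap.mul' ℝ ℂ).compAlternatingMap (α.domCoprod β)).domDomCongr finSumFinEquiv

/-- The `m`-th exterior power `α ∧ ⋯ ∧ α` of a 2-form. -/
def wedgePow (α : V [⋀^Fin 2]→ₗ[ℝ] ℂ) : (m : ℕ) → V [⋀^Fin (2 * m)]→ₗ[ℝ] ℂ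
  | 0 => AlternatingMap.constOfIsEmpty ℝ V (Fin 0) 1
  | m + 1 => wedge (wedgePow α m) α

/-- The complex conjugate of a complex-valued form. -/
def conjForm {k : ℕ} (α : V [⋀^Fin k]→ₗ[ℝ] ℂ) : V [⋀^Fin k]→ₗ[ℝ] ℂ :=
  Complex.conjLIE.toLinearEquiv.toLinearMap.compAlternatingMap α

/-- A real-valued form, seen as a complex-valued one. -/
def complexifyForm {k : ℕ} (α : V [⋀^Fin k]→ₗ[ℝ] ℝ) : V [⋀^Fin k]→ₗ[ℝ] ℂ :=
  Complex.ofRealCLM.toLinearMap.compAlternatingMap α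

end Wedge

/-! ### Calabi–Yau manifolds -/

section CalabiYau

/-- The complex structure `J` on the (real) tangent spaces of a complex manifold of dimension `n`:
multiplication by `i` in holomorphic coordinates. -/
def cxStructure {n : ℕ} {N : Type*} [TopologicalSpace N]
    [ChartedSpace (EuclideanSpace ℂ (Fin n)) N] (p : N)
    (u : TangentSpace 𝓘(ℝ, EuclideanSpace ℂ (Fin n)) p) :
    TangentSpace 𝓘(ℝ, EuclideanSpace ℂ (Fin n)) p :=
  show EuclideanSpace ℂ (Fin n) from Complex.I • (show EuclideanSpace ℂ (Fin n) from u)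

/-- `κ` is a Kähler form: a smooth closed real 2-form of type `(1, 1)`, such that
`κ(u, J u) > 0` for every `u ≠ 0`. -/
structure IsKahlerForm {n : ℕ} {N : Type*} [TopologicalSpace N]
    [ChartedSpace (EuclideanSpace ℂ (Fin n)) N]
    (κ : DiffForm ℝ (EuclideanSpace ℂ (Fin n)) ℝ N 2) : Prop where
  smooth : DiffForm.IsOfClass ∞ κ
  closed : DiffForm.IsClosedForm κ
  type_one_one : ∀ p u v, κ p ![cxStructure p u, cxStructure p v] = κ p ![u, v]
  positive : ∀ p u, u ≠ 0 → 0 < κ p ![u, cxStructure p u]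

/-- The relation `κⁿ = c Ω ∧ Ω̄` at a point, evaluated on all families of `2n` real vectors. -/
def VolumeRelation {n : ℕ} (c : ℂ) (κ : EuclideanSpace ℂ (Fin n) [⋀^Fin 2]→L[ℝ] ℝ)
    (Ω : EuclideanSpace ℂ (Fin n) [⋀^Fin n]→L[ℂ] ℂ) : Prop :=
  ∀ v : Fin (n + n) → EuclideanSpace ℂ (Fin n),
    wedgePow (complexifyForm κ.toAlternatingMap) n (v ∘ finCongr (two_mul n)) =
      c * wedge (Ω.restrictScalars ℝ).toAlternatingMap
        (conjForm (Ω.restrictScalars ℝ).toAlternatingMap) v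

/-- A Calabi–Yau structure on the complex `n`-manifold `N`: a nowhere vanishing holomorphic `n`-form
`Ω` and a Kähler form `κ` with `κⁿ = c Ω ∧ Ω̄` for some constant `c`. -/
structure CalabiYauStructure (n : ℕ) (N : Type*) [TopologicalSpace N]
    [ChartedSpace (EuclideanSpace ℂ (Fin n)) N]
    [IsManifold 𝓘(ℂ, EuclideanSpace ℂ (Fin n)) ω N] where
  Ω : DiffForm ℂ (EuclideanSpace ℂ (Fin n)) ℂ N n
  κ : DiffForm ℝ (EuclideanSpace ℂ (Fin n)) ℝ N 2
  holomorphic : DiffForm.IsHolomorphic Ω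
  nowhere_zero : ∀ p, Ω p ≠ 0
  kahler : IsKahlerForm κ
  c : ℂ
  volume_eq : ∀ p, VolumeRelation c (κ p) (Ω p)

/-- The Kähler metric `κ(u, J v)` of a Calabi–Yau structure. -/
def CalabiYauStructure.metric {n : ℕ} {N : Type*} [TopologicalSpace N]
    [ChartedSpace (EuclideanSpace ℂ (Fin n)) N]
    [IsManifold 𝓘(ℂ, EuclideanSpace ℂ (Fin n)) ω N] (X : CalabiYauStructure n N) (p : N)
    (u v : TangentSpace 𝓘(ℝ, EuclideanSpace ℂ (Fin n)) p) : ℝ :=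
  X.κ p ![u, cxStructure p v]

/-- The differential of a map from the torus to a complex manifold. -/
abbrev torusDifferential {n : ℕ} {N : Type*} [TopologicalSpace N]
    [ChartedSpace (EuclideanSpace ℂ (Fin n)) N] (ι : Torus n → N) (p : Torus n) :
    TangentSpace 𝓘(ℝ, EuclideanSpace ℝ (Fin n)) p →L[ℝ]
      TangentSpace 𝓘(ℝ, EuclideanSpace ℂ (Fin n)) (ι p) :=
  mfderiv 𝓘(ℝ, EuclideanSpace ℝ (Fin n)) 𝓘(ℝ, EuclideanSpace ℂ (Fin n)) ι p

/-- `ι` is a real-analytic isometric embedding of the Riemannian torus `(ℝⁿ / ℤⁿ, g)` into the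
Calabi–Yau manifold `N`, whose image is a special Lagrangian submanifold. -/
structure IsSpecialLagrangianIsometricEmbedding {n : ℕ} {N : Type*} [TopologicalSpace N]
    [ChartedSpace (EuclideanSpace ℂ (Fin n)) N]
    [IsManifold 𝓘(ℂ, EuclideanSpace ℂ (Fin n)) ω N] (g : AnalyticTorusMetric n)
    (X : CalabiYauStructure n N) (ι : Torus n → N) : Prop where
  embedding : Manifold.IsSmoothEmbedding 𝓘(ℝ, EuclideanSpace ℝ (Fin n))
    𝓘(ℝ, EuclideanSpace ℂ (Fin n)) ω ι
  isometric : ∀ p u v,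
    X.metric (ι p) (torusDifferential ι p u) (torusDifferential ι p v) = g.inner p u v
  re_eq_volume : ∀ p u,
    (X.Ω (ι p) fun i => torusDifferential ι p (u i)).re = g.volumeForm p u
  im_eq_zero : ∀ p (u : Fin n → TangentSpace 𝓘(ℝ, EuclideanSpace ℝ (Fin n)) p),
    (X.Ω (ι p) fun i => torusDifferential ι p (u i)).im = 0
  lagrangian : ∀ p u v, X.κ (ι p) ![torusDifferential ι p u, torusDifferential ι p v] = 0

end CalabiYau

end

/-! The ambient manifold is a neighbourhood of ℝ³/ℤ³ in ℂ³/ℤ³, with z = x + iy. A Kähler potential φ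
= ½ ∑ g_ab(x) y_a y_b + (a correction whose Hessian vanishes at y = 0) makes the real torus
Lagrangian and induces g on it. If H is the holomorphic extension of √det g, then Ω = H dz₁∧dz₂∧dz₃
restricts to the volume form. The volume relation becomes the complex Monge–Ampère equation det(4
∂²φ/∂z_i∂z̄_j) = |H|². The determinant is affine in its last diagonal entry, and the coefficient
there is the upper left 2×2 minor, positive at y = 0. So this is a noncharacteristic Cauchy problem
in the last imaginary variable, with analytic data.

The Cauchy–Kovalevskaya step is a contraction argument. Put y = (εs₀, εs₁, ε²s₂) and let S be
integration from 0 in s₂. The correction is ε⁴ S²W with W unknown. Its second derivative in y₂ is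
exactly W, and every other second derivative carries a positive power of ε (`dirWeight_add_le`).
Solving the equation for the last entry gives W = G(V ε W), with V ε Lipschitz of constant O(ε) in W
and G smooth near the limit data; `eventually_exists_fixedPoint` applies for small ε.

This needs a Banach algebra of Fourier–Taylor series ∑ c exp(2πi k·x) s^α on which each ∂_d S is
bounded. A weighted ℓ¹ algebra does it: the weight is chosen so that one integration in s₂ pays for
one derivative in any direction (`norm_derivIntegral_le`) and so that it is submultiplicative
(`shiftedExp_add_le`). Periodic analytic functions belong to the algebra for small R because their
Fourier coefficients decay exponentially (`exists_coeff_bound`).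

On the torus all correction terms except W itself vanish because of the integration from s₂ = 0, and
W vanishes there because the equation forces it (`potentialHess_real`). Compactness of the torus
gives positivity on a thin strip (`exists_positive`). The rest is exterior algebra
(`volumeRelation_of_det_eq`) and the transfer of periodic forms to the quotient, whose charts differ
by translations. -/

noncomputable section

/-! ### Weighted `ℓ¹` algebras of an additive monoid -/

/-- A submultiplicative weight on an additive monoid. -/
structure AddMonoidWeight (I : Type*) [AddCommMonoid I] where
  /-- The value of the weight. -/
  val : I → ℝ
  pos : ∀ i, 0 < val i
  add_le : ∀ i j, val (i + j) ≤ val i * val j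

/-- The algebra of finite formal sums of elements of a monoid, with the `ℓ¹` norm attached to a
weight. -/
def WeightedAlgebra {I : Type*} [AddCommMonoid I] (_w : AddMonoidWeight I) : Type _ :=
  AddMonoidAlgebra ℂ I

namespace WeightedAlgebra

variable {I : Type*} [AddCommMonoid I] {w : AddMonoidWeight I}

instance : CommRing (WeightedAlgebra w) := inferInstanceAs (CommRing (AddMonoidAlgebra ℂ I))

instance : Algebra ℂ (WeightedAlgebra w) := inferInstanceAs (Algebra ℂ (AddMonoidAlgebra ℂ I))

/-- The monomial `z • i`. -/
def single (i : I) (z : ℂ) : WeightedAlgebra w := AddMonoidAlgebra.single i z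

/-- The coefficients of an element of the algebra. -/
def coeff (a : WeightedAlgebra w) : I →₀ ℂ := AddMonoidAlgebra.coeff a

theorem coeff_add (a b : WeightedAlgebra w) : coeff (a + b) = coeff a + coeff b := rfl

theorem coeff_neg (a : WeightedAlgebra w) : coeff (-a) = -coeff a := rfl

theorem coeff_smul (z : ℂ) (a : WeightedAlgebra w) : coeff (z • a) = z • coeff a := rfl

theorem coeff_single (i : I) (z : ℂ) : coeff (single i z : WeightedAlgebra w) = .single i z := rfl

theorem single_mul_single (i j : I) (y z : ℂ) :
    (single i y * single j z : WeightedAlgebra w) = single (i + j) (y * z) :=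
  AddMonoidAlgebra.single_mul_single i j y z

theorem one_def : (1 : WeightedAlgebra w) = single 0 1 := rfl

theorem smul_single (c : ℂ) (i : I) (z : ℂ) :
    (c • single i z : WeightedAlgebra w) = single i (c * z) :=
  AddMonoidAlgebra.smul_single c i z

theorem single_zero (i : I) : (single i 0 : WeightedAlgebra w) = 0 :=
  AddMonoidAlgebra.single_zero i

theorem sum_single (a : WeightedAlgebra w) : a = a.coeff.sum fun i z => single i z :=
  (AddMonoidAlgebra.sum_coeff_single a).symm

/-- The linear map with given values on monomials. -/
def lift {E : Type*} [AddCommGroup E] [Module ℂ E] (f : I → E) : WeightedAlgebra w →ₗ[ℂ] E where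
  toFun a := a.coeff.sum fun i z => z • f i
  map_add' a b := by
    rw [coeff_add]
    exact Finsupp.sum_add_index' (by simp) (by simp [add_smul])
  map_smul' c a := by
    rw [coeff_smul, Finsupp.sum_smul_index' (by simp), RingHom.id_apply, Finsupp.smul_sum]
    simp [mul_smul]

theorem lift_single {E : Type*} [AddCommGroup E] [Module ℂ E] (f : I → E) (i : I) (z : ℂ) :
    lift f (single i z : WeightedAlgebra w) = z • f i := by
  change ((coeff (single i z : WeightedAlgebra w)).sum fun i z => z • f i) = _
  rw [coeff_single, Finsupp.sum_single_index (by simp)]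

theorem addHom_ext {E : Type*} [AddCommMonoid E] {f g : WeightedAlgebra w →+ E}
    (h : ∀ i z, f (single i z) = g (single i z)) : f = g :=
  AddMonoidAlgebra.addMonoidHom_ext h

instance : Norm (WeightedAlgebra w) := ⟨fun a => a.coeff.sum fun i z => ‖z‖ * w.val i⟩

theorem norm_def (a : WeightedAlgebra w) : ‖a‖ = a.coeff.sum fun i z => ‖z‖ * w.val i := rfl

theorem norm_single (i : I) (z : ℂ) : ‖(single i z : WeightedAlgebra w)‖ = ‖z‖ * w.val i := by
  rw [norm_def, coeff_single, Finsupp.sum_single_index (by simp)]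

instance : NormedAddCommGroup (WeightedAlgebra w) :=
  AddGroupNorm.toNormedAddCommGroup
    { toFun := fun a => ‖a‖
      map_zero' := Finsupp.sum_zero_index
      add_le' := fun a b => by
        classical
        rw [norm_def, norm_def, norm_def, coeff_add,
          Finsupp.sum_of_support_subset _ Finsupp.support_add _ (by simp),
          Finsupp.sum_of_support_subset (s := a.coeff.support ∪ b.coeff.support) _
            Finset.subset_union_left _ (by simp),
          Finsupp.sum_of_support_subset (s := a.coeff.support ∪ b.coeff.support) _
            Finset.subset_union_right _ (by simp), ← Finset.sum_add_distrib]
        refine Finset.sum_le_sum fun i _ => ?_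
        rw [← add_mul]
        exact mul_le_mul_of_nonneg_right (norm_add_le _ _) (w.pos i).le
      neg' := fun a => by
        rw [norm_def, norm_def, coeff_neg]
        simp [Finsupp.sum]
      eq_zero_of_map_eq_zero' := fun a ha => by
        refine AddMonoidAlgebra.ext (Finsupp.ext fun i => ?_)
        by_contra h
        have h1 : i ∈ (coeff a).support := Finsupp.mem_support_iff.2 h
        have h2 := (Finset.sum_eq_zero_iff_of_nonneg fun j _ =>
          mul_nonneg (norm_nonneg (coeff a j)) (w.pos j).le).1 ha i h1
        rcases mul_eq_zero.1 h2 with h3 | h3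
        · exact h (norm_eq_zero.1 h3)
        · exact (w.pos i).ne' h3 }

/-- The triangle inequality over monomials. This is the benefit of an ℓ¹ norm: every operator bound
below reduces to a check on a single monomial. -/
theorem norm_map_le {E : Type*} [SeminormedAddCommGroup E] (T : WeightedAlgebra w →+ E) {C : ℝ}
    (h : ∀ i z, ‖T (single i z)‖ ≤ C * (‖z‖ * w.val i)) (a : WeightedAlgebra w) :
    ‖T a‖ ≤ C * ‖a‖ := by
  conv_lhs => rw [sum_single a]
  rw [Finsupp.sum, map_sum, norm_def, Finsupp.sum, Finset.mul_sum]
  exact (norm_sum_le _ _).trans (Finset.sum_le_sum fun i _ => h i _)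

instance : NormedCommRing (WeightedAlgebra w) :=
  { (inferInstance : NormedAddCommGroup (WeightedAlgebra w)),
    (inferInstance : CommRing (WeightedAlgebra w)) with
    norm_mul_le := fun a b => by
      rw [mul_comm ‖a‖]
      refine norm_map_le (AddMonoidHom.mulRight b) (fun i y => ?_) a
      rw [AddMonoidHom.mulRight_apply, mul_comm ‖b‖]
      refine norm_map_le (AddMonoidHom.mulLeft (single i y)) (fun j z => ?_) b
      rw [AddMonoidHom.coe_mulLeft, single_mul_single, norm_single, norm_mul]
      have := mul_le_mul_of_nonneg_left (w.add_le i j) (mul_nonneg (norm_nonneg y) (norm_nonneg z))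
      linarith }

instance : NormedAlgebra ℂ (WeightedAlgebra w) where
  norm_smul_le c a := by
    refine norm_map_le (DistribSMul.toAddMonoidHom _ c) (fun i z => ?_) a
    rw [DistribSMul.toAddMonoidHom_apply, smul_single, norm_single, norm_mul, mul_assoc]

end WeightedAlgebra

end

noncomputable section

/-! ### Shifted exponential series -/

/-- The series `∑ₐ Kᵃ R^(a+n) / (a+n)!`. -/
def shiftedExp (R K : ℝ) (n : ℕ) : ℝ := ∑' a : ℕ, K ^ a * (R ^ (a + n) / (a + n).factorial)

section ShiftedExp

variable {R K L : ℝ}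

theorem shiftedExp_term_le (hR : 0 ≤ R) (hK : 0 ≤ K) (n a : ℕ) :
    K ^ a * (R ^ (a + n) / (a + n).factorial) ≤ R ^ n / n.factorial * ((R * K) ^ a / a.factorial) := by
  have h : ((a.factorial * n.factorial : ℕ) : ℝ) ≤ (a + n).factorial := by
    exact_mod_cast Nat.le_of_dvd (Nat.factorial_pos _) (Nat.factorial_mul_factorial_dvd_factorial_add a n)
  have h2 : R ^ (a + n) / (a + n).factorial ≤ R ^ (a + n) / ((a.factorial * n.factorial : ℕ) : ℝ) :=
    div_le_div_of_nonneg_left (by positivity) (by positivity) h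
  calc _ ≤ K ^ a * (R ^ (a + n) / ((a.factorial * n.factorial : ℕ) : ℝ)) := by gcongr
    _ = _ := by push_cast; rw [pow_add, mul_pow]; field_simp

theorem summable_shiftedExp (hR : 0 ≤ R) (hK : 0 ≤ K) (n : ℕ) :
    Summable fun a : ℕ => K ^ a * (R ^ (a + n) / (a + n).factorial) :=
  Summable.of_nonneg_of_le (fun a => by positivity) (shiftedExp_term_le hR hK n)
    ((Real.summable_pow_div_factorial _).mul_left _)

theorem le_shiftedExp (hR : 0 ≤ R) (hK : 0 ≤ K) (n : ℕ) :
    R ^ n / n.factorial ≤ shiftedExp R K n := by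
  have := (summable_shiftedExp hR hK n).le_tsum 0 fun a _ => by positivity
  simpa [shiftedExp] using this

theorem shiftedExp_pos (hR : 0 < R) (hK : 0 ≤ K) (n : ℕ) : 0 < shiftedExp R K n :=
  lt_of_lt_of_le (by positivity) (le_shiftedExp hR.le hK n)

theorem shiftedExp_le (hR : 0 ≤ R) (hK : 0 ≤ K) (n : ℕ) :
    shiftedExp R K n ≤ R ^ n / n.factorial * Real.exp (R * K) := by
  rw [Real.exp_eq_exp_ℝ, NormedSpace.exp_eq_tsum_div, ← tsum_mul_left]
  exact (summable_shiftedExp hR hK n).tsum_le_tsum (shiftedExp_term_le hR hK n)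
    ((Real.summable_pow_div_factorial _).mul_left _)

theorem shiftedExp_mono (hR : 0 ≤ R) (hK : 0 ≤ K) (hKL : K ≤ L) (n : ℕ) :
    shiftedExp R K n ≤ shiftedExp R L n :=
  (summable_shiftedExp hR hK n).tsum_le_tsum (fun a => by gcongr)
    (summable_shiftedExp hR (hK.trans hKL) n)

theorem shiftedExp_mono_radius {R' : ℝ} (hR : 0 ≤ R') (hK : 0 ≤ K) (hRR : R' ≤ R) (n : ℕ) :
    shiftedExp R' K n ≤ shiftedExp R K n :=
  (summable_shiftedExp hR hK n).tsum_le_tsum (fun a => by gcongr)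
    (summable_shiftedExp (hR.trans hRR) hK n)

/-- Multiplying by K reindexes the series with shift n + 1 into the series with shift n without its
first term. This is what lets an integration in s₂ absorb a derivative in x. -/
theorem mul_shiftedExp_succ_le (hR : 0 ≤ R) (hK : 0 ≤ K) (n : ℕ) :
    K * shiftedExp R K (n + 1) ≤ shiftedExp R K n := by
  rw [shiftedExp, shiftedExp, (summable_shiftedExp hR hK n).tsum_eq_zero_add, ← tsum_mul_left]
  have : ∀ a : ℕ, K * (K ^ a * (R ^ (a + (n + 1)) / (a + (n + 1)).factorial)) =
      K ^ (a + 1) * (R ^ (a + 1 + n) / (a + 1 + n).factorial) := fun a => by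
    rw [show a + (n + 1) = a + 1 + n by ring]; ring
  simp_rw [this]
  exact le_add_of_nonneg_left (by positivity)

theorem shiftedExp_succ_le (hR : 0 ≤ R) (hK : 0 ≤ K) (n : ℕ) :
    shiftedExp R K (n + 1) ≤ R * shiftedExp R K n := by
  rw [shiftedExp, shiftedExp, ← tsum_mul_left]
  refine (summable_shiftedExp hR hK _).tsum_le_tsum (fun a => ?_)
    ((summable_shiftedExp hR hK n).mul_left _)
  have h : ((a + n).factorial : ℝ) ≤ (a + (n + 1)).factorial := by
    exact_mod_cast Nat.factorial_le (by omega)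
  calc K ^ a * (R ^ (a + (n + 1)) / (a + (n + 1)).factorial)
      ≤ K ^ a * (R ^ (a + (n + 1)) / (a + n).factorial) := by gcongr
    _ = _ := by rw [← add_assoc, pow_succ]; ring

/-- The left side is one term of Vandermonde's identity. -/
theorem choose_mul_choose_le (p q r s : ℕ) :
    (p + q).choose p * (r + s).choose r ≤ (p + q + (r + s)).choose (p + r) := by
  rw [Nat.add_choose_eq (p + q) (r + s) (p + r)]
  have h : (p, r) ∈ Finset.HasAntidiagonal.antidiagonal (p + r) := by simp
  exact Finset.single_le_sum (f := fun ij : ℕ × ℕ => (p + q).choose ij.1 * (r + s).choose ij.2)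
    (fun _ _ => Nat.zero_le _) h

theorem add_choose_mul_factorial (n m : ℕ) :
    (n + m).choose n * n.factorial * m.factorial = (n + m).factorial := by
  simpa using Nat.choose_mul_factorial_mul_factorial (Nat.le_add_right n m)

/-- Both sides carry the same powers. After the factorials are cleared, what remains is the
Vandermonde bound on the product of the two binomial coefficients. -/
theorem shiftedExp_term_mul_le (hR : 0 ≤ R) (hK : 0 ≤ K) (hL : 0 ≤ L) (n m a b : ℕ) :
    ((n + m).choose n : ℝ) * ((a + b).choose a * (K ^ a * L ^ b) *
      (R ^ (a + b + (n + m)) / (a + b + (n + m)).factorial)) ≤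
    K ^ a * (R ^ (a + n) / (a + n).factorial) * (L ^ b * (R ^ (b + m) / (b + m).factorial)) := by
  have h1 := choose_mul_choose_le n m a b
  rw [show n + m + (a + b) = a + n + (b + m) by ring, Nat.add_comm n a] at h1
  have h2 : (((a + n + (b + m)).choose (a + n) : ℕ) : ℝ) * (a + n).factorial * (b + m).factorial
      = (a + n + (b + m)).factorial := by exact_mod_cast add_choose_mul_factorial (a + n) (b + m)
  have h1' : (((n + m).choose n : ℕ) : ℝ) * ((a + b).choose a : ℕ) ≤
      ((a + n + (b + m)).choose (a + n) : ℕ) := by exact_mod_cast h1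
  rw [show a + b + (n + m) = a + n + (b + m) by ring, ← h2]
  have hc : (0 : ℝ) < ((a + n + (b + m)).choose (a + n) : ℕ) := by
    exact_mod_cast Nat.choose_pos (by omega)
  generalize (((a + n + (b + m)).choose (a + n) : ℕ) : ℝ) = c at *
  generalize (((n + m).choose n : ℕ) : ℝ) = c1 at *
  generalize (((a + b).choose a : ℕ) : ℝ) = c2 at *
  have e1 : (0 : ℝ) < (a + n).factorial := by positivity
  have e2 : (0 : ℝ) < (b + m).factorial := by positivity
  rw [pow_add R (a + n)]
  calc _ = c1 * c2 / c * (K ^ a * (R ^ (a + n) / (a + n).factorial) *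
        (L ^ b * (R ^ (b + m) / (b + m).factorial))) := by
          field_simp
    _ ≤ 1 * _ := by
          gcongr
          exact (div_le_one hc).2 h1'
    _ = _ := one_mul _

/-- The binomial expansion of (K + L)^c is compared term by term with the Cauchy product of the two
series. The factor (n+m choose n) is gained here in order to offset the growth of α! in the weight.
-/
theorem shiftedExp_add_le (hR : 0 ≤ R) (hK : 0 ≤ K) (hL : 0 ≤ L) (n m : ℕ) :
    ((n + m).choose n : ℝ) * shiftedExp R (K + L) (n + m) ≤
      shiftedExp R K n * shiftedExp R L m := by
  set f : ℕ → ℝ := fun a => K ^ a * (R ^ (a + n) / (a + n).factorial) with hf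
  set g : ℕ → ℝ := fun a => L ^ a * (R ^ (a + m) / (a + m).factorial) with hg
  have hfs : Summable fun a => ‖f a‖ := (summable_shiftedExp hR hK n).norm
  have hgs : Summable fun a => ‖g a‖ := (summable_shiftedExp hR hL m).norm
  have h1 : shiftedExp R K n * shiftedExp R L m =
      ∑' c, ∑ ij ∈ Finset.HasAntidiagonal.antidiagonal c, f ij.1 * g ij.2 :=
    tsum_mul_tsum_eq_tsum_sum_antidiagonal_of_summable_norm hfs hgs
  have h2 : Summable fun c => ∑ ij ∈ Finset.HasAntidiagonal.antidiagonal c, f ij.1 * g ij.2 :=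
    summable_sum_mul_antidiagonal_of_summable_mul (summable_mul_of_summable_norm hfs hgs)
  rw [h1, shiftedExp, ← tsum_mul_left]
  refine ((summable_shiftedExp hR (add_nonneg hK hL) _).mul_left _).tsum_le_tsum (fun c => ?_) h2
  rw [(Commute.all K L).add_pow', Finset.sum_mul, Finset.mul_sum]
  refine Finset.sum_le_sum fun ij hij => ?_
  obtain ⟨a, b⟩ := ij
  obtain rfl : a + b = c := Finset.HasAntidiagonal.mem_antidiagonal.1 hij
  rw [nsmul_eq_mul]
  exact shiftedExp_term_mul_le hR hK hL n m a b

theorem exists_bound_mul_pow {R R' : ℝ} (hR' : 0 < R') (h : R' < R) :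
    ∃ C : ℝ, 0 ≤ C ∧ ∀ n : ℕ, ((n + 1 : ℕ) : ℝ) * R' ^ n ≤ C * R ^ (n + 1) := by
  have hR : 0 < R := hR'.trans h
  have h1 := (tendsto_self_mul_const_pow_of_lt_one (div_nonneg hR'.le hR.le) ((div_lt_one hR).2 h)).bddAbove_range
  obtain ⟨C, hC⟩ := h1
  refine ⟨C / R', ?_, fun n => ?_⟩
  · have : (0 : ℝ) ≤ C := by simpa using hC ⟨0, rfl⟩
    positivity
  · have := hC ⟨n + 1, rfl⟩
    simp only at this
    rw [div_pow, mul_div_assoc', div_le_iff₀ (by positivity)] at this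
    rw [div_mul_eq_mul_div, le_div_iff₀ hR']
    calc _ = ((n + 1 : ℕ) : ℝ) * R' ^ (n + 1) := by ring
      _ ≤ _ := this

/-- A Cauchy estimate: termwise R'^m/m! ≤ C R^(m+1)/(m+1)!, so a smaller radius gains one shift. The
first bound, used for derivatives in x, follows from the second one and `mul_shiftedExp_succ_le`;
the second is used for derivatives in s. -/
theorem shiftedExp_shrink {R R' : ℝ} (hR' : 0 < R') (h : R' < R) :
    ∃ C : ℝ, 0 ≤ C ∧ (∀ K n, 0 ≤ K → K * shiftedExp R' K n ≤ C * shiftedExp R K n) ∧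
      ∀ K n, 0 ≤ K → shiftedExp R' K n ≤ C * shiftedExp R K (n + 1) := by
  obtain ⟨C, hC0, hC⟩ := exists_bound_mul_pow hR' h
  have hR : 0 < R := hR'.trans h
  have key : ∀ m : ℕ, R' ^ m / m.factorial ≤ C * (R ^ (m + 1) / (m + 1).factorial) := fun m => by
    rw [Nat.factorial_succ, Nat.cast_mul, mul_div_assoc', div_le_div_iff₀ (by positivity) (by positivity)]
    calc R' ^ m * (((m + 1 : ℕ) : ℝ) * m.factorial) = (((m + 1 : ℕ) : ℝ) * R' ^ m) * m.factorial := by ring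
      _ ≤ _ := mul_le_mul_of_nonneg_right (hC m) (by positivity)
      _ = _ := by ring
  have h2 : ∀ K n, 0 ≤ K → shiftedExp R' K n ≤ C * shiftedExp R K (n + 1) := fun K n hK => by
    rw [shiftedExp, shiftedExp, ← tsum_mul_left]
    refine (summable_shiftedExp hR'.le hK _).tsum_le_tsum (fun a => ?_)
      ((summable_shiftedExp hR.le hK _).mul_left _)
    rw [← mul_assoc, mul_comm C, mul_assoc]
    gcongr
    exact key _
  refine ⟨C, hC0, fun K n hK => ?_, h2⟩
  calc K * shiftedExp R' K n ≤ K * (C * shiftedExp R K (n + 1)) := by gcongr; exact h2 K n hK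
    _ = C * (K * shiftedExp R K (n + 1)) := by ring
    _ ≤ _ := by gcongr; exact mul_shiftedExp_succ_le hR.le hK n

end ShiftedExp

/-! ### Multi-indices -/

/-- Exponents of the monomials `exp (2π i k·x) s^α` in three periodic variables `x` and three
further variables `s`. -/
abbrev FourierIndex : Type := (Fin 3 → ℤ) × (Fin 3 → ℕ)

/-- `2π ∑ |kⱼ|`. -/
def frequency (k : Fin 3 → ℤ) : ℝ := 2 * Real.pi * ∑ j, |(k j : ℝ)|

theorem frequency_nonneg (k : Fin 3 → ℤ) : 0 ≤ frequency k := by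
  have := Real.pi_pos
  unfold frequency; positivity

theorem frequency_add_le (k l : Fin 3 → ℤ) : frequency (k + l) ≤ frequency k + frequency l := by
  have := Real.pi_pos
  unfold frequency
  rw [← mul_add, ← Finset.sum_add_distrib]
  gcongr with j
  simpa using abs_add_le (k j : ℝ) (l j)

theorem frequency_neg (k : Fin 3 → ℤ) : frequency (-k) = frequency k := by
  simp [frequency]

theorem frequency_zero : frequency 0 = 0 := by
  simp [frequency]

theorem le_frequency (k : Fin 3 → ℤ) (j : Fin 3) : 2 * Real.pi * |(k j : ℝ)| ≤ frequency k := by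
  have := Real.pi_pos
  unfold frequency
  gcongr
  exact Finset.single_le_sum (f := fun j => |(k j : ℝ)|) (fun _ _ => abs_nonneg _) (Finset.mem_univ j)

/-- The weight `α! ∑ₐ |2πk|ᵃ R^(a+|α|) / (a+|α|)!`. -/
def fourierWeightVal (R : ℝ) (i : FourierIndex) : ℝ :=
  (∏ j, ((i.2 j).factorial : ℝ)) * shiftedExp R (frequency i.1) (∑ j, i.2 j)

/-- A product of binomial coefficients is at most the binomial coefficient of the sums, by
Vandermonde applied twice. The right side is the loss that `shiftedExp_add_le` compensates. -/
theorem factorial_add_le_choose (α β : Fin 3 → ℕ) :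
    (∏ j, (((α + β) j).factorial : ℝ)) ≤ ((∑ j, α j + ∑ j, β j).choose (∑ j, α j) : ℕ) *
      ((∏ j, ((α j).factorial : ℝ)) * ∏ j, ((β j).factorial : ℝ)) := by
  have h : ∀ j, (((α + β) j).factorial) = (α j + β j).choose (α j) * (α j).factorial * (β j).factorial :=
    fun j => (add_choose_mul_factorial _ _).symm
  have h1 := choose_mul_choose_le (α 0) (β 0) (α 1) (β 1)
  have h2 := choose_mul_choose_le (α 0 + α 1) (β 0 + β 1) (α 2) (β 2)
  have h3 : (α 0 + β 0).choose (α 0) * (α 1 + β 1).choose (α 1) * (α 2 + β 2).choose (α 2) ≤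
      (∑ j, α j + ∑ j, β j).choose (∑ j, α j) := by
    rw [Fin.sum_univ_three, Fin.sum_univ_three]
    refine le_trans (Nat.mul_le_mul_right _ h1) ?_
    rw [show α 0 + β 0 + (α 1 + β 1) = α 0 + α 1 + (β 0 + β 1) by ring]
    refine h2.trans (le_of_eq ?_)
    congr 1; ring
  have h4 : (∏ j, ((α + β) j).factorial) ≤ (∑ j, α j + ∑ j, β j).choose (∑ j, α j) *
      ((∏ j, (α j).factorial) * ∏ j, (β j).factorial) := by
    simp_rw [h, Fin.prod_univ_three]
    calc _ = ((α 0 + β 0).choose (α 0) * (α 1 + β 1).choose (α 1) * (α 2 + β 2).choose (α 2)) *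
          ((α 0).factorial * (α 1).factorial * (α 2).factorial *
            ((β 0).factorial * (β 1).factorial * (β 2).factorial)) := by ring
      _ ≤ _ := Nat.mul_le_mul_right _ h3
  exact_mod_cast h4

/-- The weight `fourierWeightVal` is submultiplicative. -/
def fourierWeight (R : {R : ℝ // 0 < R}) : AddMonoidWeight FourierIndex where
  val := fourierWeightVal R
  pos i := mul_pos (Finset.prod_pos fun j _ => by positivity)
    (shiftedExp_pos R.2 (frequency_nonneg _) _)
  add_le i j := by
    have hR := R.2.le
    unfold fourierWeightVal
    have hp : ∀ α : Fin 3 → ℕ, 0 ≤ ∏ j, ((α j).factorial : ℝ) := fun α => by positivity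
    have hf : ∀ n, 0 ≤ shiftedExp (R : ℝ) (frequency i.1 + frequency j.1) n := fun n =>
      (shiftedExp_pos R.2 (add_nonneg (frequency_nonneg _) (frequency_nonneg _)) n).le
    have h0 : ∑ l, (i + j).2 l = ∑ l, i.2 l + ∑ l, j.2 l := by simp [Finset.sum_add_distrib]
    rw [h0]
    calc _ ≤ (∏ l, (((i.2 + j.2) l).factorial : ℝ)) *
          shiftedExp R (frequency i.1 + frequency j.1) (∑ l, i.2 l + ∑ l, j.2 l) :=
          mul_le_mul_of_nonneg_left (shiftedExp_mono hR (frequency_nonneg _)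
            (frequency_add_le _ _) _) (hp _)
      _ ≤ _ := mul_le_mul_of_nonneg_right (factorial_add_le_choose i.2 j.2) (hf _)
      _ = ((∏ l, ((i.2 l).factorial : ℝ)) * ∏ l, ((j.2 l).factorial : ℝ)) *
        (((∑ l, i.2 l + ∑ l, j.2 l).choose (∑ l, i.2 l) : ℕ) *
          shiftedExp R (frequency i.1 + frequency j.1) (∑ l, i.2 l + ∑ l, j.2 l)) := by ring
      _ ≤ ((∏ l, ((i.2 l).factorial : ℝ)) * ∏ l, ((j.2 l).factorial : ℝ)) * _ :=
          mul_le_mul_of_nonneg_left (shiftedExp_add_le hR (frequency_nonneg _) (frequency_nonneg _) _ _)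
            (mul_nonneg (hp _) (hp _))
      _ = _ := by ring

/-- A function of x alone lies in the algebra as soon as its Fourier coefficients are summable
against exp(R|2πk|). -/
theorem fourierWeight_zero_le (R : {R : ℝ // 0 < R}) (k : Fin 3 → ℤ) :
    (fourierWeight R).val (k, 0) ≤ Real.exp (R * frequency k) := by
  have := shiftedExp_le R.2.le (frequency_nonneg k) 0
  simpa [fourierWeight, fourierWeightVal] using this

/-- The multinomial coefficient is a product of two binomial coefficients, each at most 2^|α|. -/
theorem factorial_sum_le (α : Fin 3 → ℕ) :
    ((∑ j, α j).factorial : ℝ) ≤ 4 ^ (∑ j, α j) * ∏ j, ((α j).factorial : ℝ) := by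
  have h : (∑ j, α j).factorial ≤ 4 ^ (∑ j, α j) * ∏ j, (α j).factorial := by
    rw [Fin.sum_univ_three, Fin.prod_univ_three,
      ← add_choose_mul_factorial (α 0 + α 1) (α 2),
      ← add_choose_mul_factorial (α 0) (α 1)]
    have h1 : (α 0 + α 1 + α 2).choose (α 0 + α 1) ≤ 2 ^ (α 0 + α 1 + α 2) :=
      Nat.choose_le_two_pow _ _
    have h2 : (α 0 + α 1).choose (α 0) ≤ 2 ^ (α 0 + α 1 + α 2) :=
      (Nat.choose_le_two_pow _ _).trans (Nat.pow_le_pow_right (by norm_num) (by omega))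
    calc _ = (α 0 + α 1 + α 2).choose (α 0 + α 1) * (α 0 + α 1).choose (α 0) *
          ((α 0).factorial * (α 1).factorial * (α 2).factorial) := by ring
      _ ≤ 2 ^ (α 0 + α 1 + α 2) * 2 ^ (α 0 + α 1 + α 2) *
          ((α 0).factorial * (α 1).factorial * (α 2).factorial) :=
          Nat.mul_le_mul_right _ (Nat.mul_le_mul h1 h2)
      _ = _ := by rw [← mul_pow]; norm_num
  exact_mod_cast h

/-- Only the term a = 0 of the weight is kept. The factor 4 from `factorial_sum_le` is the reason
why evaluation is restricted to |s_j| < R/4. -/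
theorem pow_le_fourierWeight (R : {R : ℝ // 0 < R}) (i : FourierIndex) :
    (R / 4 : ℝ) ^ (∑ j, i.2 j) ≤ (fourierWeight R).val i := by
  have hR := R.2
  refine le_trans ?_ (mul_le_mul_of_nonneg_left (le_shiftedExp hR.le (frequency_nonneg i.1) _)
    (by positivity))
  rw [mul_div_assoc', le_div_iff₀ (by positivity), div_pow, div_mul_eq_mul_div,
    div_le_iff₀ (by positivity)]
  calc _ ≤ (R : ℝ) ^ (∑ j, i.2 j) * (4 ^ (∑ j, i.2 j) * ∏ j, ((i.2 j).factorial : ℝ)) := by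
        gcongr; exact factorial_sum_le _
    _ = _ := by ring

end

noncomputable section

open UniformSpace

/-! ### The Banach algebra of Fourier–Taylor series -/

/-- Finite sums of monomials `exp (2π i k·x) s^α`. -/
abbrev FourierPoly (R : {R : ℝ // 0 < R}) : Type := WeightedAlgebra (fourierWeight R)

/-- The Banach algebra of Fourier–Taylor series of finite weighted `ℓ¹` norm. -/
abbrev FourierSeries (R : {R : ℝ // 0 < R}) : Type := Completion (FourierPoly R)

/-- The six coordinate directions, three periodic ones and three others. -/
abbrev Direction : Type := Fin 3 ⊕ Fin 3

namespace FourierPoly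

open WeightedAlgebra

variable {R : {R : ℝ // 0 < R}}

/-- The partial derivatives. -/
def deriv : Direction → FourierPoly R →ₗ[ℂ] FourierPoly R
  | .inl j => lift fun i => single i (2 * Real.pi * Complex.I * i.1 j)
  | .inr j => lift fun i => single (i.1, i.2 - Pi.single j 1) (i.2 j)

theorem deriv_inl (j : Fin 3) (i : FourierIndex) (z : ℂ) :
    deriv (R := R) (.inl j) (single i z) = single i (z * (2 * Real.pi * Complex.I * i.1 j)) := by
  rw [deriv, lift_single, smul_single]

theorem deriv_inr (j : Fin 3) (i : FourierIndex) (z : ℂ) :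
    deriv (R := R) (.inr j) (single i z) = single (i.1, i.2 - Pi.single j 1) (z * i.2 j) := by
  rw [deriv, lift_single, smul_single]

/-- Integration in the last variable. -/
def integral : FourierPoly R →ₗ[ℂ] FourierPoly R :=
  lift fun i => single (i.1, i.2 + Pi.single 2 1) ((i.2 2 + 1 : ℂ)⁻¹)

theorem integral_single (i : FourierIndex) (z : ℂ) :
    integral (R := R) (single i z) = single (i.1, i.2 + Pi.single 2 1) (z * (i.2 2 + 1 : ℂ)⁻¹) := by
  rw [integral, lift_single, smul_single]

theorem linearMap_ext {E : Type*} [AddCommGroup E] [Module ℂ E] {f g : FourierPoly R →ₗ[ℂ] E}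
    (h : ∀ i z, f (single i z) = g (single i z)) : f = g :=
  LinearMap.toAddMonoidHom_injective (addHom_ext h)

theorem deriv_inr_two_integral (a : FourierPoly R) : deriv (.inr 2) (integral a) = a := by
  refine LinearMap.congr_fun (linearMap_ext (f := deriv (.inr 2) ∘ₗ integral) (g := LinearMap.id)
    fun i z => ?_) a
  have h : (i.2 2 + 1 : ℂ) ≠ 0 := by exact_mod_cast Nat.succ_ne_zero (i.2 2)
  simp [integral_single, deriv_inr, h]

theorem deriv_integral_comm (d : Direction) (hd : d ≠ .inr 2) (a : FourierPoly R) :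
    deriv d (integral a) = integral (deriv d a) := by
  refine LinearMap.congr_fun (linearMap_ext (f := deriv d ∘ₗ integral) (g := integral ∘ₗ deriv d)
    fun i z => ?_) a
  rcases d with j | j
  · simp only [LinearMap.comp_apply, integral_single, deriv_inl]
    congr 1; ring
  · have hj : j ≠ 2 := fun h => hd (by rw [h])
    simp only [LinearMap.comp_apply, integral_single, deriv_inr]
    -- The truncated exponent α − e_j is wrong when α_j = 0, but the coefficient α_j then vanishes.
    rcases Nat.eq_zero_or_pos (i.2 j) with h0 | h0
    · simp [h0, hj, single_zero]
    · have : i.2 + Pi.single 2 1 - Pi.single j 1 = i.2 - Pi.single j 1 + Pi.single 2 1 := by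
        funext l
        by_cases hl : l = j
        · subst hl; simp [hj]
        · simp [hl]
      rw [this]
      simp [hj, hj.symm]
      congr 1; ring

/-- Integration in the last variable, followed by a partial derivative. -/
def derivIntegral (d : Direction) : FourierPoly R →ₗ[ℂ] FourierPoly R := deriv d ∘ₗ integral

theorem derivIntegral_apply (d : Direction) (a : FourierPoly R) :
    derivIntegral d a = deriv d (integral a) := rfl

theorem norm_two_pi_I_mul (n : ℤ) :
    ‖(2 * Real.pi * Complex.I * n : ℂ)‖ = 2 * Real.pi * |(n : ℝ)| := by
  have := Real.pi_pos
  simp [abs_of_pos this]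

theorem prod_factorial_add_single (α : Fin 3 → ℕ) (j : Fin 3) :
    (∏ l, (((α + Pi.single j 1 : Fin 3 → ℕ) l).factorial : ℝ)) = (α j + 1) * ∏ l, ((α l).factorial : ℝ) := by
  have h : ∀ l, (((α + Pi.single j 1 : Fin 3 → ℕ) l).factorial : ℝ) =
      (if l = j then (α j + 1 : ℝ) else 1) * (α l).factorial := fun l => by
    by_cases hl : l = j
    · subst hl; simp [Nat.factorial_succ]
    · simp [hl]
  simp_rw [h, Finset.prod_mul_distrib]
  simp

theorem sum_add_single (α : Fin 3 → ℕ) (j : Fin 3) :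
    ∑ l, (α + Pi.single j 1 : Fin 3 → ℕ) l = ∑ l, α l + 1 := by
  simp [Finset.sum_add_distrib]

theorem fourierWeightVal_add_single (R : ℝ) (k : Fin 3 → ℤ) (α : Fin 3 → ℕ) (j : Fin 3) :
    fourierWeightVal R (k, α + Pi.single j 1) =
      (α j + 1) * ((∏ l, ((α l).factorial : ℝ)) * shiftedExp R (frequency k) (∑ l, α l + 1)) := by
  rw [fourierWeightVal, prod_factorial_add_single, sum_add_single, mul_assoc]

theorem norm_natCast_add_one (n : ℕ) : ‖(n : ℂ) + 1‖ = (n : ℝ) + 1 := by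
  exact_mod_cast Complex.norm_natCast (n + 1)

theorem norm_inv_succ (n : ℕ) : ‖((n : ℂ) + 1)⁻¹‖ = ((n : ℝ) + 1)⁻¹ := by
  rw [norm_inv, norm_natCast_add_one]

theorem norm_integral_le (a : FourierPoly R) : ‖integral a‖ ≤ R * ‖a‖ := by
  refine norm_map_le integral.toAddMonoidHom (fun i z => ?_) a
  change ‖integral (single i z)‖ ≤ _
  rw [integral_single, norm_single, norm_mul, norm_inv_succ]
  change _ * fourierWeightVal R _ ≤ R * (_ * fourierWeightVal R _)
  rw [fourierWeightVal_add_single, mul_assoc, inv_mul_cancel_left₀ (by positivity)]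
  rw [mul_left_comm (R : ℝ)]
  refine mul_le_mul_of_nonneg_left ?_ (norm_nonneg z)
  rw [fourierWeightVal, mul_left_comm (R : ℝ)]
  refine mul_le_mul_of_nonneg_left ?_ (by positivity)
  exact shiftedExp_succ_le R.2.le (frequency_nonneg _) _

theorem exists_add_single {α : Fin 3 → ℕ} {j : Fin 3} (h : α j ≠ 0) :
    ∃ β : Fin 3 → ℕ, α = β + Pi.single j 1 :=
  ⟨α - Pi.single j 1, by
    funext l
    by_cases hl : l = j
    · subst hl; simp; omega
    · simp [hl]⟩

/-- The key estimate. Integration raises α₂ and divides by α₂ + 1, which cancels the growth of α!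
and leaves the shift |α| + 1. A derivative in x then multiplies by at most |2πk| and brings the
shift back to |α|. A derivative in s_j with j ≠ 2 brings the degree back to |α|, its factor α_j
being cancelled by the drop in the factorial. For s₂ the operator is the identity. -/
theorem norm_derivIntegral_le (d : Direction) (a : FourierPoly R) : ‖derivIntegral d a‖ ≤ ‖a‖ := by
  rw [← one_mul ‖a‖]
  refine norm_map_le (derivIntegral d).toAddMonoidHom (fun i z => ?_) a
  change ‖derivIntegral d (single i z)‖ ≤ _
  rw [one_mul]
  by_cases hd : d = .inr 2
  · rw [hd, derivIntegral_apply, deriv_inr_two_integral, norm_single]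
  rw [derivIntegral_apply, deriv_integral_comm d hd]
  have hp : (0 : ℝ) ≤ ∏ l, ((i.2 l).factorial : ℝ) := by positivity
  have hR := R.2.le
  rcases d with j | j
  · rw [deriv_inl, integral_single, norm_single, norm_mul, norm_mul, norm_inv_succ,
      norm_two_pi_I_mul]
    change _ * fourierWeightVal R _ ≤ _ * fourierWeightVal R _
    rw [fourierWeightVal_add_single, mul_assoc, mul_assoc, inv_mul_cancel_left₀ (by positivity)]
    refine mul_le_mul_of_nonneg_left ?_ (norm_nonneg _)
    rw [fourierWeightVal, mul_left_comm]
    refine mul_le_mul_of_nonneg_left ?_ hp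
    refine le_trans (mul_le_mul_of_nonneg_right (le_frequency i.1 j)
      (shiftedExp_pos R.2 (frequency_nonneg _) _).le) ?_
    exact mul_shiftedExp_succ_le hR (frequency_nonneg _) _
  · have hj : j ≠ 2 := fun h => hd (by rw [h])
    rw [deriv_inr, integral_single, norm_single, norm_mul, norm_mul, norm_inv_succ]
    by_cases h0 : i.2 j = 0
    · rw [h0]
      simpa using mul_nonneg (norm_nonneg z) ((fourierWeight R).pos i).le
    · obtain ⟨k, α⟩ := i
      obtain ⟨β, rfl⟩ := exists_add_single h0
      change _ * fourierWeightVal R _ ≤ _ * fourierWeightVal R _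
      simp only [add_tsub_cancel_right]
      rw [fourierWeightVal_add_single, fourierWeightVal_add_single, mul_assoc, mul_assoc,
        inv_mul_cancel_left₀ (by positivity)]
      refine mul_le_mul_of_nonneg_left ?_ (norm_nonneg _)
      simp only [Pi.add_apply, Pi.single_eq_same, Nat.cast_add, Nat.cast_one]
      rw [norm_natCast_add_one]

/-- A finite sum, seen as an element of an algebra with another radius. -/
def shrink {R R' : {R : ℝ // 0 < R}} : FourierPoly R →+ FourierPoly R' where
  toFun a := a
  map_zero' := rfl
  map_add' _ _ := rfl

/-- Without an integration to compensate, a derivative is bounded only into the algebra of a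
strictly smaller radius. -/
theorem exists_norm_deriv_le {R R' : {R : ℝ // 0 < R}} (h : R' < R) :
    ∃ C : ℝ, 0 ≤ C ∧ ∀ (d : Direction) (a : FourierPoly R),
      ‖(deriv d (shrink a) : FourierPoly R')‖ ≤ C * ‖a‖ := by
  obtain ⟨C, hC0, hC1, hC2⟩ := shiftedExp_shrink R'.2 h
  refine ⟨C, hC0, fun d a => ?_⟩
  refine norm_map_le ((deriv d).toAddMonoidHom.comp shrink) (fun i z => ?_) a
  change ‖(deriv d (single i z) : FourierPoly R')‖ ≤ _
  have hp : (0 : ℝ) ≤ ∏ l, ((i.2 l).factorial : ℝ) := by positivity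
  rcases d with j | j
  · rw [deriv_inl, norm_single, norm_mul, norm_two_pi_I_mul]
    change _ * fourierWeightVal R' _ ≤ C * (_ * fourierWeightVal R _)
    rw [mul_assoc, mul_left_comm C]
    refine mul_le_mul_of_nonneg_left ?_ (norm_nonneg _)
    rw [fourierWeightVal, fourierWeightVal, mul_left_comm, mul_left_comm C]
    refine mul_le_mul_of_nonneg_left ?_ hp
    refine le_trans (mul_le_mul_of_nonneg_right (le_frequency i.1 j)
      (shiftedExp_pos R'.2 (frequency_nonneg _) _).le) ?_
    exact hC1 _ _ (frequency_nonneg _)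
  · rw [deriv_inr, norm_single, norm_mul]
    by_cases h0 : i.2 j = 0
    · rw [h0]
      simpa using mul_nonneg hC0 (mul_nonneg (norm_nonneg z) ((fourierWeight R).pos i).le)
    · obtain ⟨k, α⟩ := i
      obtain ⟨β, rfl⟩ := exists_add_single h0
      change _ * fourierWeightVal R' _ ≤ C * (_ * fourierWeightVal R _)
      simp only [add_tsub_cancel_right]
      rw [fourierWeightVal_add_single, mul_assoc, mul_left_comm C]
      refine mul_le_mul_of_nonneg_left ?_ (norm_nonneg _)
      rw [fourierWeightVal, mul_left_comm C, mul_left_comm C]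
      simp only [Pi.add_apply, Pi.single_eq_same, Nat.cast_add, Nat.cast_one]
      rw [norm_natCast_add_one]
      refine mul_le_mul_of_nonneg_left ?_ (by positivity)
      refine mul_le_mul_of_nonneg_left ?_ (by positivity)
      exact hC2 _ _ (frequency_nonneg _)

theorem norm_shrink_le {R R' : {R : ℝ // 0 < R}} (h : R' ≤ R) (a : FourierPoly R) :
    ‖(shrink a : FourierPoly R')‖ ≤ ‖a‖ := by
  refine Finset.sum_le_sum fun i _ => ?_
  refine mul_le_mul_of_nonneg_left ?_ (norm_nonneg _)
  exact mul_le_mul_of_nonneg_left (shiftedExp_mono_radius R'.2.le (frequency_nonneg _) h _)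
    (by positivity)

/-! ### Conjugation -/

/-- Complex conjugation of functions. -/
def conj : FourierPoly R →+* FourierPoly R :=
  (AddMonoidAlgebra.mapDomainRingHom ℂ
    ((negAddMonoidHom : (Fin 3 → ℤ) →+ (Fin 3 → ℤ)).prodMap (AddMonoidHom.id (Fin 3 → ℕ)))).comp
    (AddMonoidAlgebra.mapRingHom FourierIndex (starRingEnd ℂ))

theorem conj_single (i : FourierIndex) (z : ℂ) :
    conj (R := R) (single i z) = single (-i.1, i.2) (starRingEnd ℂ z) := by
  change AddMonoidAlgebra.mapDomainRingHom ℂ _ (AddMonoidAlgebra.mapRingHom FourierIndex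
    (starRingEnd ℂ) (AddMonoidAlgebra.single i z)) = _
  rw [AddMonoidAlgebra.mapRingHom_single, AddMonoidAlgebra.mapDomainRingHom_apply,
    AddMonoidAlgebra.mapDomain_single]
  rfl

theorem conj_conj (a : FourierPoly R) : conj (conj a) = a := by
  refine DFunLike.congr_fun (addHom_ext (f := (conj.comp conj).toAddMonoidHom)
    (g := AddMonoidHom.id _) fun i z => ?_) a
  change conj (conj (single i z)) = single i z
  simp [conj_single]

theorem norm_conj_le (a : FourierPoly R) : ‖conj a‖ ≤ ‖a‖ := by
  rw [← one_mul ‖a‖]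
  refine norm_map_le conj.toAddMonoidHom (fun i z => ?_) a
  change ‖conj (single i z)‖ ≤ _
  rw [conj_single, norm_single, one_mul, RCLike.norm_conj]
  change _ * fourierWeightVal R _ ≤ _ * fourierWeightVal R _
  rw [fourierWeightVal, fourierWeightVal, frequency_neg]

theorem conj_smul (c : ℂ) (a : FourierPoly R) : conj (c • a) = starRingEnd ℂ c • conj a := by
  refine DFunLike.congr_fun (addHom_ext (f := conj.toAddMonoidHom.comp (DistribSMul.toAddMonoidHom _ c))
    (g := (DistribSMul.toAddMonoidHom _ (starRingEnd ℂ c)).comp conj.toAddMonoidHom) fun i z => ?_) a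
  change conj (c • single i z) = starRingEnd ℂ c • conj (single i z)
  simp [conj_single, smul_single]

theorem conj_derivIntegral (d : Direction) (a : FourierPoly R) :
    conj (derivIntegral d a) = derivIntegral d (conj a) := by
  refine DFunLike.congr_fun (addHom_ext (f := conj.toAddMonoidHom.comp (derivIntegral d).toAddMonoidHom)
    (g := (derivIntegral d).toAddMonoidHom.comp conj.toAddMonoidHom) fun i z => ?_) a
  change conj (derivIntegral d (single i z)) = derivIntegral d (conj (single i z))
  rcases d with j | j <;>
  simp [conj_single, derivIntegral_apply, integral_single, deriv_inl, deriv_inr, Complex.conj_ofNat]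

end FourierPoly

end

noncomputable section

open UniformSpace

/-! ### Evaluation of Fourier–Taylor series -/

/-- The space of the variables `(x, s)`. -/
abbrev FourierPoint : Type := (Fin 3 → ℝ) × (Fin 3 → ℝ)

/-- The domain on which series of the class `FourierSeries R` converge. -/
def fourierDomain (R : {R : ℝ // 0 < R}) : Set FourierPoint := {p | ∀ j, |p.2 j| < R / 4}

theorem isOpen_fourierDomain (R : {R : ℝ // 0 < R}) : IsOpen (fourierDomain R) := by
  simp only [fourierDomain, Set.ofPred_forall]
  exact isOpen_iInter_of_finite fun j => isOpen_lt (by fun_prop) continuous_const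

theorem fourierDomain_mono {R R' : {R : ℝ // 0 < R}} (h : R' ≤ R) :
    fourierDomain R' ⊆ fourierDomain R := fun p hp j =>
  (hp j).trans_le (div_le_div_of_nonneg_right h (by norm_num))

/-- The coordinate functions. -/
def fourierCoord : Direction → FourierPoint →L[ℝ] ℝ
  | .inl j => (ContinuousLinearMap.proj j).comp (ContinuousLinearMap.fst ℝ _ _)
  | .inr j => (ContinuousLinearMap.proj j).comp (ContinuousLinearMap.snd ℝ _ _)

/-- The linear form with given components. -/
def gradForm (c : Direction → ℂ) : FourierPoint →L[ℝ] ℂ :=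
  ∑ d, (fourierCoord d).smulRight (c d)

theorem gradForm_apply (c : Direction → ℂ) (v : FourierPoint) :
    gradForm c v = ∑ j, (v.1 j : ℂ) * c (.inl j) + ∑ j, (v.2 j : ℂ) * c (.inr j) := by
  rw [gradForm, sum_apply, Fintype.sum_sum_type]
  rfl

theorem norm_gradForm_le (c : Direction → ℂ) : ‖gradForm c‖ ≤ ∑ d, ‖fourierCoord d‖ * ‖c d‖ :=
  (norm_sum_le _ _).trans (Finset.sum_le_sum fun _ _ =>
    (ContinuousLinearMap.norm_smulRight_apply _ _).le)

/-- The monomial `exp (2π i k·x) s^α`. -/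
def fourierMonomial (p : FourierPoint) (i : FourierIndex) : ℂ :=
  Complex.exp (2 * Real.pi * Complex.I * ∑ j, (i.1 j : ℂ) * p.1 j) * ∏ j, (p.2 j : ℂ) ^ i.2 j

theorem norm_fourierMonomial (p : FourierPoint) (i : FourierIndex) :
    ‖fourierMonomial p i‖ = ∏ j, |p.2 j| ^ i.2 j := by
  rw [fourierMonomial, norm_mul, norm_prod]
  have h : (2 * Real.pi * Complex.I * ∑ j, (i.1 j : ℂ) * p.1 j) =
      ((2 * Real.pi * ∑ j, (i.1 j : ℝ) * p.1 j : ℝ) : ℂ) * Complex.I := by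
    push_cast; ring
  rw [h, Complex.norm_exp_ofReal_mul_I, one_mul]
  simp

/-- As for `FourierPoly.deriv`, the truncated index α − e_j is harmless: its coefficient is zero
when α_j = 0. -/
theorem hasFDerivAt_fourierMonomial (i : FourierIndex) (p : FourierPoint) :
    HasFDerivAt (fun p => fourierMonomial p i)
      (gradForm (Sum.elim (fun j => 2 * Real.pi * Complex.I * i.1 j * fourierMonomial p i)
        (fun j => i.2 j * fourierMonomial p (i.1, i.2 - Pi.single j 1)))) p := by
  have hx : ∀ j, HasFDerivAt (fun p : FourierPoint => (p.1 j : ℂ))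
      (Complex.ofRealCLM.comp (fourierCoord (.inl j))) p := fun j =>
    (Complex.ofRealCLM.comp (fourierCoord (.inl j))).hasFDerivAt
  have hs : ∀ j, HasFDerivAt (fun p : FourierPoint => (p.2 j : ℂ))
      (Complex.ofRealCLM.comp (fourierCoord (.inr j))) p := fun j =>
    (Complex.ofRealCLM.comp (fourierCoord (.inr j))).hasFDerivAt
  have h1 := ((HasFDerivAt.fun_sum (u := Finset.univ) fun j _ =>
    (hx j).const_mul (i.1 j : ℂ)).const_mul (2 * Real.pi * Complex.I : ℂ)).cexp
  have h2 := (((hs 0).pow (i.2 0)).mul ((hs 1).pow (i.2 1))).mul ((hs 2).pow (i.2 2))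
  have h3 := h1.mul h2
  refine (h3.congr_of_eventuallyEq ?_).congr_fderiv ?_
  · refine Filter.Eventually.of_forall fun q => ?_
    simp [fourierMonomial, Fin.prod_univ_three]
  · refine ContinuousLinearMap.ext fun v => ?_
    rw [gradForm_apply]
    simp only [fourierMonomial, fourierCoord, Fin.sum_univ_three, Fin.prod_univ_three, Pi.sub_apply,
      add_apply, smul_apply, ContinuousLinearMap.comp_apply,
      ContinuousLinearMap.proj_apply, ContinuousLinearMap.coe_fst', ContinuousLinearMap.coe_snd',
      Complex.ofRealCLM_apply, smul_eq_mul, Sum.elim_inl, Sum.elim_inr, nsmul_eq_mul,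
      Pi.single_apply, Pi.mul_apply]
    simp
    ring

/-- Evaluation of a finite Fourier–Taylor sum. -/
def evalPoly {R : {R : ℝ // 0 < R}} (p : FourierPoint) : FourierPoly R →ₐ[ℂ] ℂ :=
  AddMonoidAlgebra.lift ℂ ℂ FourierIndex
    { toFun := fun i => fourierMonomial p i.toAdd
      map_one' := by simp [fourierMonomial]
      map_mul' := fun i j => by
        simp only [fourierMonomial, toAdd_mul, Prod.fst_add, Prod.snd_add, Pi.add_apply, pow_add,
          Finset.prod_mul_distrib, Int.cast_add, add_mul, Finset.sum_add_distrib, mul_add,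
          Complex.exp_add]
        ring }

namespace FourierPoly

open WeightedAlgebra

variable {R : {R : ℝ // 0 < R}}

theorem evalPoly_single (p : FourierPoint) (i : FourierIndex) (z : ℂ) :
    evalPoly (R := R) p (single i z) = z * fourierMonomial p i :=
  AddMonoidAlgebra.lift_single _ _ _

theorem norm_evalPoly_le {p : FourierPoint} (hp : p ∈ fourierDomain R) (a : FourierPoly R) :
    ‖evalPoly p a‖ ≤ ‖a‖ := by
  rw [← one_mul ‖a‖]
  refine norm_map_le (evalPoly p).toLinearMap.toAddMonoidHom (fun i z => ?_) a
  change ‖evalPoly p (single i z)‖ ≤ _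
  rw [evalPoly_single, norm_mul, one_mul, norm_fourierMonomial]
  refine mul_le_mul_of_nonneg_left ?_ (norm_nonneg _)
  refine le_trans ?_ (pow_le_fourierWeight R i)
  rw [← Finset.prod_pow_eq_pow_sum]
  exact Finset.prod_le_prod (fun j _ => by positivity) fun j _ =>
    pow_le_pow_left₀ (abs_nonneg _) (hp j).le _

theorem hasFDerivAt_evalPoly (a : FourierPoly R) (p : FourierPoint) :
    HasFDerivAt (fun p => evalPoly p a) (gradForm fun d => evalPoly p (deriv d a)) p := by
  have h : (fun p => evalPoly p a) = fun p => ∑ i ∈ a.coeff.support, a.coeff i * fourierMonomial p i := by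
    funext p
    conv_lhs => rw [sum_single a]
    rw [Finsupp.sum, map_sum]
    exact Finset.sum_congr rfl fun i _ => evalPoly_single p i _
  rw [h]
  refine (HasFDerivAt.fun_sum fun i _ =>
    (hasFDerivAt_fourierMonomial i p).const_mul (a.coeff i)).congr_fderiv ?_
  refine ContinuousLinearMap.ext fun v => ?_
  have h2 : ∀ d, evalPoly p (deriv d a) = ∑ i ∈ a.coeff.support, evalPoly p (deriv d (single i (a.coeff i) : FourierPoly R)) := fun d => by
    conv_lhs => rw [sum_single a]
    rw [Finsupp.sum, map_sum, map_sum]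
  rw [gradForm_apply, sum_apply]
  simp only [h2, smul_apply, gradForm_apply, Finset.mul_sum, mul_add,
    smul_eq_mul, Finset.sum_add_distrib, Sum.elim_inl, Sum.elim_inr, deriv_inl, deriv_inr,
    evalPoly_single]
  congr 1 <;> rw [Finset.sum_comm] <;>
    exact Finset.sum_congr rfl fun _ _ => Finset.sum_congr rfl fun _ _ => by ring

theorem fourierMonomial_conj (p : FourierPoint) (i : FourierIndex) :
    fourierMonomial p (-i.1, i.2) = starRingEnd ℂ (fourierMonomial p i) := by
  simp only [fourierMonomial, map_mul, map_prod, map_pow, Complex.conj_ofReal, ← Complex.exp_conj,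
    map_sum, map_intCast, Complex.conj_I, Complex.conj_ofNat]
  congr 2
  simp

theorem evalPoly_conj (p : FourierPoint) (a : FourierPoly R) :
    evalPoly p (conj a) = starRingEnd ℂ (evalPoly p a) := by
  refine DFunLike.congr_fun (addHom_ext
    (f := (evalPoly p).toLinearMap.toAddMonoidHom.comp conj.toAddMonoidHom)
    (g := (starRingEnd ℂ).toAddMonoidHom.comp (evalPoly p).toLinearMap.toAddMonoidHom)
    fun i z => ?_) a
  change evalPoly p (conj (single i z)) = starRingEnd ℂ (evalPoly p (single i z))
  rw [conj_single, evalPoly_single, evalPoly_single, map_mul, fourierMonomial_conj]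

end FourierPoly

namespace FourierSeries

variable {R : {R : ℝ // 0 < R}}

instance : NormedCommRing (FourierSeries R) := inferInstance

instance : T2Space (FourierSeries R) := inferInstance

instance : CompleteSpace (FourierSeries R) := inferInstance

/-- Evaluation of a Fourier–Taylor series. The value is meaningful in `fourierDomain R`. -/
def eval (u : FourierSeries R) (p : FourierPoint) : ℂ := Completion.extension (evalPoly p) u

theorem continuous_evalPoly {p : FourierPoint} (hp : p ∈ fourierDomain R) :
    Continuous (evalPoly (R := R) p) :=
  AddMonoidHomClass.continuous_of_bound (evalPoly p) 1 fun a => by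
    rw [one_mul]; exact FourierPoly.norm_evalPoly_le hp a

/-- Evaluation at a point of the domain as a ring homomorphism. -/
def evalHom {p : FourierPoint} (hp : p ∈ fourierDomain R) : FourierSeries R →+* ℂ :=
  Completion.extensionHom (evalPoly p).toRingHom (continuous_evalPoly hp)

theorem evalHom_apply {p : FourierPoint} (hp : p ∈ fourierDomain R) (u : FourierSeries R) :
    evalHom hp u = eval u p := rfl

theorem eval_coe {p : FourierPoint} (hp : p ∈ fourierDomain R) (a : FourierPoly R) :
    eval (a : FourierSeries R) p = evalPoly p a :=
  Completion.extensionHom_coe (evalPoly p).toRingHom (continuous_evalPoly hp) a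

theorem continuous_eval (p : FourierPoint) : Continuous fun u : FourierSeries R => eval u p :=
  Completion.continuous_extension

theorem norm_eval_le {p : FourierPoint} (hp : p ∈ fourierDomain R) (u : FourierSeries R) :
    ‖eval u p‖ ≤ ‖u‖ := by
  induction u using Completion.induction_on with
  | hp => exact isClosed_le (continuous_eval p).norm continuous_norm
  | ih a => rw [eval_coe hp, Completion.norm_coe]; exact FourierPoly.norm_evalPoly_le hp a

theorem eval_add {p : FourierPoint} (hp : p ∈ fourierDomain R) (u v : FourierSeries R) :
    eval (u + v) p = eval u p + eval v p := map_add (evalHom hp) u v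

theorem eval_sub {p : FourierPoint} (hp : p ∈ fourierDomain R) (u v : FourierSeries R) :
    eval (u - v) p = eval u p - eval v p := map_sub (evalHom hp) u v

theorem eval_mul {p : FourierPoint} (hp : p ∈ fourierDomain R) (u v : FourierSeries R) :
    eval (u * v) p = eval u p * eval v p := map_mul (evalHom hp) u v

theorem eval_sum {p : FourierPoint} (hp : p ∈ fourierDomain R) {ι : Type*} (s : Finset ι)
    (u : ι → FourierSeries R) : eval (∑ i ∈ s, u i) p = ∑ i ∈ s, eval (u i) p :=
  map_sum (evalHom hp) u s

theorem eval_smul {p : FourierPoint} (hp : p ∈ fourierDomain R) (c : ℂ) (u : FourierSeries R) :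
    eval (c • u) p = c * eval u p := by
  induction u using Completion.induction_on with
  | hp =>
    refine isClosed_eq ?_ ?_
    · exact ((continuous_eval p).comp (continuous_const_smul c))
    · exact (continuous_const.mul (continuous_eval p))
  | ih a => rw [← Completion.coe_smul, eval_coe hp, eval_coe hp, map_smul, smul_eq_mul]

/-- Integration in the last variable. -/
def integral : FourierSeries R →L[ℂ] FourierSeries R :=
  (LinearMap.mkContinuous FourierPoly.integral R FourierPoly.norm_integral_le).completion

theorem integral_coe (a : FourierPoly R) :
    integral (a : FourierSeries R) = (FourierPoly.integral a : FourierPoly R) :=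
  ContinuousLinearMap.completion_apply_coe _ a

/-- Integration in the last variable, followed by a partial derivative. -/
def derivIntegral (d : Direction) : FourierSeries R →L[ℂ] FourierSeries R :=
  (LinearMap.mkContinuous (FourierPoly.derivIntegral d) 1
    fun a => by rw [one_mul]; exact FourierPoly.norm_derivIntegral_le d a).completion

theorem derivIntegral_coe (d : Direction) (a : FourierPoly R) :
    derivIntegral d (a : FourierSeries R) = (FourierPoly.derivIntegral d a : FourierPoly R) :=
  ContinuousLinearMap.completion_apply_coe _ a

theorem derivIntegral_two (u : FourierSeries R) : derivIntegral (.inr 2) u = u := by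
  induction u using Completion.induction_on with
  | hp =>
    refine isClosed_eq ?_ ?_
    · exact (derivIntegral _).continuous
    · exact continuous_id
  | ih a => rw [derivIntegral_coe, FourierPoly.derivIntegral_apply,
      FourierPoly.deriv_inr_two_integral]

theorem continuous_conjPoly : Continuous (FourierPoly.conj (R := R)) :=
  AddMonoidHomClass.continuous_of_bound FourierPoly.conj 1 fun a => by
    rw [one_mul]; exact FourierPoly.norm_conj_le a

/-- Complex conjugation of functions. -/
def conj : FourierSeries R →+* FourierSeries R :=
  Completion.mapRingHom FourierPoly.conj continuous_conjPoly

theorem continuous_conj : Continuous (conj (R := R)) := Completion.continuous_map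

theorem conj_coe (a : FourierPoly R) :
    conj (a : FourierSeries R) = (FourierPoly.conj a : FourierPoly R) :=
  Completion.map_coe (uniformContinuous_addMonoidHom_of_continuous continuous_conjPoly) a

theorem conj_conj (u : FourierSeries R) : conj (conj u) = u := by
  induction u using Completion.induction_on with
  | hp =>
    refine isClosed_eq ?_ ?_
    · exact (continuous_conj.comp continuous_conj)
    · exact continuous_id
  | ih a => rw [conj_coe, conj_coe, FourierPoly.conj_conj]

theorem conj_smul (c : ℂ) (u : FourierSeries R) : conj (c • u) = starRingEnd ℂ c • conj u := by
  induction u using Completion.induction_on with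
  | hp =>
    refine isClosed_eq ?_ ?_
    · exact (continuous_conj.comp (continuous_const_smul c))
    · exact ((continuous_const_smul (starRingEnd ℂ c)).comp continuous_conj)
  | ih a => rw [← Completion.coe_smul, conj_coe, conj_coe, FourierPoly.conj_smul,
      Completion.coe_smul]

theorem conj_derivIntegral (d : Direction) (u : FourierSeries R) :
    conj (derivIntegral d u) = derivIntegral d (conj u) := by
  induction u using Completion.induction_on with
  | hp =>
    refine isClosed_eq ?_ ?_
    · exact (continuous_conj.comp (derivIntegral d).continuous)
    · exact ((derivIntegral d).continuous.comp continuous_conj)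
  | ih a => rw [derivIntegral_coe, conj_coe, conj_coe, derivIntegral_coe,
      FourierPoly.conj_derivIntegral]

theorem eval_conj {p : FourierPoint} (hp : p ∈ fourierDomain R) (u : FourierSeries R) :
    eval (conj u) p = starRingEnd ℂ (eval u p) := by
  induction u using Completion.induction_on with
  | hp =>
    refine isClosed_eq ?_ ?_
    · exact ((continuous_eval p).comp continuous_conj)
    · exact (Complex.continuous_conj.comp (continuous_eval p))
  | ih a => rw [conj_coe, eval_coe hp, eval_coe hp, FourierPoly.evalPoly_conj]

/-! ### Differentiation of the evaluation -/

/-- On the domain, evaluation is dominated by the norm, so convergence in the algebra is uniform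
convergence of functions; the limit may then be differentiated term by term. -/
theorem hasFDerivAt_eval {u : FourierSeries R} {v : Direction → FourierSeries R}
    {a : ℕ → FourierPoly R}
    (hu : Filter.Tendsto (fun n => (a n : FourierSeries R)) Filter.atTop (nhds u))
    (hv : ∀ d, Filter.Tendsto (fun n => ((FourierPoly.deriv d (a n) : FourierPoly R) :
      FourierSeries R)) Filter.atTop (nhds (v d)))
    {p : FourierPoint} (hp : p ∈ fourierDomain R) :
    HasFDerivAt (eval u) (gradForm fun d => eval (v d) p) p := by
  refine hasFDerivAt_of_tendstoUniformlyOn (isOpen_fourierDomain R) (l := Filter.atTop)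
    (f := fun n p => evalPoly p (a n)) (f' := fun n p => gradForm fun d => evalPoly p (FourierPoly.deriv d (a n)))
    (g' := fun p => gradForm fun d => eval (v d) p) ?_ (fun n q _ => FourierPoly.hasFDerivAt_evalPoly _ _) (fun q hq => ?_) hp
  · rw [Metric.tendstoUniformlyOn_iff]
    intro ε hε
    have h : Filter.Tendsto (fun n => ∑ d, ‖fourierCoord d‖ * ‖v d - ((FourierPoly.deriv d (a n) : FourierPoly R) :
      FourierSeries R)‖) Filter.atTop (nhds (∑ d, ‖fourierCoord d‖ * ‖v d - v d‖)) :=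
      tendsto_finsetSum _ fun d _ => ((hv d).const_sub (v d)).norm.const_mul _
    simp only [sub_self, norm_zero, mul_zero, Finset.sum_const_zero] at h
    filter_upwards [h.eventually_lt_const hε] with n hn q hq
    rw [dist_eq_norm]
    refine lt_of_le_of_lt ?_ hn
    have e : (gradForm fun d => eval (v d) q) - (gradForm fun d => evalPoly q (FourierPoly.deriv d (a n))) =
        gradForm fun d => eval (v d - ((FourierPoly.deriv d (a n) : FourierPoly R) : FourierSeries R)) q := by
      refine ContinuousLinearMap.ext fun w => ?_
      rw [sub_apply]
      simp only [gradForm_apply, eval_sub hq, eval_coe hq, mul_sub, Finset.sum_sub_distrib]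
      ring
    rw [e]
    refine (norm_gradForm_le _).trans (Finset.sum_le_sum fun d _ => ?_)
    exact mul_le_mul_of_nonneg_left (norm_eval_le hq _) (norm_nonneg _)
  · have := ((continuous_eval q).tendsto u).comp hu
    refine this.congr fun n => ?_
    exact eval_coe hq _

theorem exists_seq_tendsto (u : FourierSeries R) : ∃ a : ℕ → FourierPoly R,
    Filter.Tendsto (fun n => (a n : FourierSeries R)) Filter.atTop (nhds u) := by
  obtain ⟨x, hx, hxu⟩ := mem_closure_iff_seq_limit.1 (Completion.denseRange_coe (α := FourierPoly R) u)
  choose a ha using hx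
  exact ⟨a, by simpa only [ha] using hxu⟩

/-- No radius is lost, since both S and ∂_d S are bounded on the same algebra. -/
theorem hasFDerivAt_eval_integral (u : FourierSeries R) {p : FourierPoint}
    (hp : p ∈ fourierDomain R) :
    HasFDerivAt (eval (integral u)) (gradForm fun d => eval (derivIntegral d u) p) p := by
  obtain ⟨a, ha⟩ := exists_seq_tendsto u
  refine hasFDerivAt_eval (a := fun n => FourierPoly.integral (a n)) ?_ (fun d => ?_) hp
  · simp only [← integral_coe]
    exact (integral.continuous.tendsto u).comp ha
  · simp only [← FourierPoly.derivIntegral_apply, ← derivIntegral_coe]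
    exact ((derivIntegral d).continuous.tendsto u).comp ha

theorem cauchySeq_of_bound {R R' : {R : ℝ // 0 < R}} {a : ℕ → FourierPoly R}
    {T : FourierPoly R →+ FourierPoly R'} {C : ℝ} (hT : ∀ b, ‖T b‖ ≤ C * ‖b‖)
    (ha : CauchySeq a) : CauchySeq fun n => T (a n) :=
  (AddMonoidHomClass.uniformContinuous_of_bound T C hT).comp_cauchySeq ha

theorem exists_hasFDerivAt_eval {R R' : {R : ℝ // 0 < R}} (h : R' < R) (u : FourierSeries R) :
    ∃ v : Direction → FourierSeries R', ∀ p ∈ fourierDomain R',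
      HasFDerivAt (eval u) (gradForm fun d => eval (v d) p) p := by
  obtain ⟨a, ha⟩ := exists_seq_tendsto u
  -- Completeness is used in the smaller algebra, so the approximating sequence has to be Cauchy
  -- among finite sums and not merely convergent in the completion.
  have hc : CauchySeq a := by
    have h0 : Cauchy (Filter.map ((↑) : FourierPoly R → FourierSeries R)
        (Filter.map a Filter.atTop)) := by
      rw [Filter.map_map]; exact ha.cauchySeq
    exact (Completion.isUniformInducing_coe _).cauchy_map_iff.1 h0
  obtain ⟨C, -, hC⟩ := FourierPoly.exists_norm_deriv_le h
  have h1 : CauchySeq fun n => ((FourierPoly.shrink (a n) : FourierPoly R') : FourierSeries R') :=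
    (Completion.uniformContinuous_coe _).comp_cauchySeq
      (cauchySeq_of_bound (C := 1) (fun b => by
          rw [one_mul]; exact FourierPoly.norm_shrink_le h.le b) hc)
  have h2 : ∀ d, CauchySeq fun n =>
      ((FourierPoly.deriv d (FourierPoly.shrink (a n)) : FourierPoly R') : FourierSeries R') :=
    fun d => (Completion.uniformContinuous_coe _).comp_cauchySeq
      (cauchySeq_of_bound (T := (FourierPoly.deriv d).toAddMonoidHom.comp FourierPoly.shrink)
        (C := C) (fun b => hC d b) hc)
  obtain ⟨u', hu'⟩ := cauchySeq_tendsto_of_complete h1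
  choose v hv using fun d => cauchySeq_tendsto_of_complete (h2 d)
  have heq : ∀ p ∈ fourierDomain R', eval u p = eval u' p := fun p hp => by
    refine tendsto_nhds_unique (((continuous_eval p).tendsto u).comp ha)
      ((((continuous_eval p).tendsto u').comp hu').congr fun n => ?_)
    exact (eval_coe hp (FourierPoly.shrink (a n))).trans
      (eval_coe (fourierDomain_mono h.le hp) (a n)).symm
  refine ⟨v, fun p hp => (hasFDerivAt_eval hu' hv hp).congr_of_eventuallyEq ?_⟩
  filter_upwards [(isOpen_fourierDomain R').mem_nhds hp] with q hq using heq q hq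

/-- Each derivative costs some radius. The induction inserts an intermediate radius, so any finite
number of derivatives fits between R' and R. -/
theorem contDiffOn_eval_nat (n : ℕ) : ∀ {R R' : {R : ℝ // 0 < R}}, R' < R →
    ∀ u : FourierSeries R, ContDiffOn ℝ n (eval u) (fourierDomain R') := by
  induction n with
  | zero =>
    intro R R' h u
    obtain ⟨v, hv⟩ := exists_hasFDerivAt_eval h u
    exact contDiffOn_zero.2 fun p hp => (hv p hp).continuousAt.continuousWithinAt
  | succ n ih =>
    intro R R' h u
    obtain ⟨r, hr1, hr2⟩ := exists_between (show (R' : ℝ) < R from h)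
    obtain ⟨v, hv⟩ := exists_hasFDerivAt_eval (R := R) (R' := ⟨r, R'.2.trans hr1⟩) hr2 u
    have hsub : fourierDomain R' ⊆ fourierDomain ⟨r, R'.2.trans hr1⟩ :=
      fourierDomain_mono (show R' ≤ ⟨r, R'.2.trans hr1⟩ from hr1.le)
    rw [Nat.cast_add, Nat.cast_one, contDiffOn_succ_iff_hasFDerivWithinAt_of_uniqueDiffOn
      (isOpen_fourierDomain R').uniqueDiffOn]
    refine ⟨by simp, fun p => gradForm fun d => eval (v d) p, ?_, fun p hp =>
      (hv p (hsub hp)).hasFDerivWithinAt⟩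
    unfold gradForm
    refine ContDiffOn.sum fun d _ => contDiffOn_const.smulRight (ih (R := ⟨r, R'.2.trans hr1⟩) ?_ _)
    exact hr1

theorem contDiffOn_eval (u : FourierSeries R) : ContDiffOn ℝ ∞ (eval u) (fourierDomain R) := by
  refine contDiffOn_infty.2 fun n p hp => ?_
  -- The domain is defined by strict inequalities, so each of its points already lies in the domain
  -- of a smaller radius.
  have h : ∃ r : ℝ, 0 < r ∧ r < R ∧ ∀ j, |p.2 j| < r / 4 := by
    have h1 : ∀ᶠ r : ℝ in nhdsWithin (R : ℝ) (Set.Iio R), ∀ j, |p.2 j| < r / 4 :=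
      Filter.eventually_all.2 fun j =>
        ((continuous_id.div_const 4).tendsto (R : ℝ)).eventually_const_lt (hp j) |>.filter_mono
          nhdsWithin_le_nhds
    have h2 : ∀ᶠ r : ℝ in nhdsWithin (R : ℝ) (Set.Iio R), 0 < r :=
      ((continuous_id.tendsto (R : ℝ)).eventually_const_lt R.2).filter_mono nhdsWithin_le_nhds
    obtain ⟨r, hr⟩ := (h1.and (h2.and self_mem_nhdsWithin)).exists
    exact ⟨r, hr.2.1, hr.2.2, hr.1⟩
  obtain ⟨r, hr0, hrR, hp'⟩ := h
  refine ContDiffAt.contDiffWithinAt ?_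
  exact (contDiffOn_eval_nat n (R' := ⟨r, hr0⟩) hrR u).contDiffAt
    ((isOpen_fourierDomain ⟨r, hr0⟩).mem_nhds hp')

end FourierSeries

end

noncomputable section

/-! ### Fourier series of real-analytic periodic functions -/

/-- Cauchy estimates uniform in the base point. The multiple series that defines all re-expansions
converges at radii r and r when 2r is below the radius of convergence; T is its full sum, and each n
contributes only a slice of it. -/
theorem FormalMultilinearSeries.exists_nnnorm_changeOrigin_mul_pow_le {E F : Type*}
    [NormedAddCommGroup E] [NormedSpace ℝ E] [NormedAddCommGroup F] [NormedSpace ℝ F]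
    [CompleteSpace F] (p : FormalMultilinearSeries ℝ E F) {r : NNReal}
    (hr : (r + r : ENNReal) < p.radius) :
    ∃ T : NNReal, ∀ x, ‖x‖₊ ≤ r → ∀ n, ‖p.changeOrigin x n‖₊ * r ^ n ≤ T := by
  let G : (Σ k l : ℕ, { s : Finset (Fin (k + l)) // s.card = l }) → NNReal :=
    fun s => ‖p (s.1 + s.2.1)‖₊ * r ^ s.2.1 * r ^ s.1
  have hsum : Summable G := p.changeOriginSeries_summable_aux₁ hr
  refine ⟨∑' s, G s, fun x hx n => ?_⟩
  have hrp : (r : ENNReal) < p.radius := le_self_add.trans_lt hr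
  have h3 := p.changeOriginSeries_summable_aux₂ hrp n
  have h5 : ∀ s : Σ l : ℕ, { s : Finset (Fin (n + l)) // s.card = l },
      ‖p (n + s.1)‖₊ * ‖x‖₊ ^ s.1 ≤ ‖p (n + s.1)‖₊ * r ^ s.1 := fun s => by gcongr
  have h4 := (NNReal.summable_of_le h5 h3).tsum_le_tsum h5 h3
  have h6 := (p.nnnorm_changeOrigin_le n ((ENNReal.coe_le_coe.2 hx).trans_lt hrp)).trans h4
  calc ‖p.changeOrigin x n‖₊ * r ^ n ≤ (∑' s : Σ l : ℕ, { s : Finset (Fin (n + l)) // s.card = l },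
        ‖p (n + s.1)‖₊ * r ^ s.1) * r ^ n := mul_le_mul_left h6 _
    _ = ∑' s : Σ l : ℕ, { s : Finset (Fin (n + l)) // s.card = l }, G ⟨n, s⟩ :=
        (NNReal.tsum_mul_right _ _).symm
    _ ≤ _ := NNReal.tsum_comp_le_tsum_of_inj (f := G) hsum (i := fun s => ⟨n, s⟩)
        fun a b h => by simpa using h

/-- Real-analytic functions on `ℝ³` which are invariant under `ℤ³`. -/
structure IsAnalyticPeriodic (f : (Fin 3 → ℝ) → ℝ) : Prop where
  analytic : AnalyticOnNhd ℝ f Set.univ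
  periodic : ∀ (k : Fin 3 → ℤ) (x : Fin 3 → ℝ), f (x + fun j => (k j : ℝ)) = f x

/-- The partial derivatives of a function on `ℝ³`. -/
def partialDeriv (j : Fin 3) (f : (Fin 3 → ℝ) → ℝ) (x : Fin 3 → ℝ) : ℝ :=
  fderiv ℝ f x (Pi.single j 1)

namespace IsAnalyticPeriodic

variable {f g : (Fin 3 → ℝ) → ℝ}

theorem const (c : ℝ) : IsAnalyticPeriodic fun _ => c := ⟨analyticOnNhd_const, fun _ _ => rfl⟩

theorem add (hf : IsAnalyticPeriodic f) (hg : IsAnalyticPeriodic g) :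
    IsAnalyticPeriodic fun x => f x + g x :=
  ⟨hf.analytic.add hg.analytic, fun k x => by rw [hf.periodic, hg.periodic]⟩

theorem sub (hf : IsAnalyticPeriodic f) (hg : IsAnalyticPeriodic g) :
    IsAnalyticPeriodic fun x => f x - g x :=
  ⟨hf.analytic.sub hg.analytic, fun k x => by rw [hf.periodic, hg.periodic]⟩

theorem mul (hf : IsAnalyticPeriodic f) (hg : IsAnalyticPeriodic g) :
    IsAnalyticPeriodic fun x => f x * g x :=
  ⟨hf.analytic.mul hg.analytic, fun k x => by rw [hf.periodic, hg.periodic]⟩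

theorem inv (hf : IsAnalyticPeriodic f) (h0 : ∀ x, f x ≠ 0) :
    IsAnalyticPeriodic fun x => (f x)⁻¹ :=
  ⟨fun x _ => (hf.analytic x trivial).inv (h0 x), fun k x => by rw [hf.periodic]⟩

theorem sqrt (hf : IsAnalyticPeriodic f) (h0 : ∀ x, 0 < f x) :
    IsAnalyticPeriodic fun x => √(f x) := by
  refine ⟨fun x hx => ?_, fun k x => by rw [hf.periodic]⟩
  -- Writing the root as exp(½ log f) reduces analyticity to that of the logarithm on positive
  -- numbers.
  have h : (fun x => √(f x)) = fun x => Real.exp (Real.log (f x) / 2) := by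
    funext y
    rw [Real.sqrt_eq_rpow, Real.rpow_def_of_pos (h0 y)]
    congr 1; ring
  rw [h]
  have h1 : AnalyticAt ℝ (fun x => Real.log (f x)) x := (analyticAt_log (h0 x)).comp (hf.analytic x hx)
  have h2 : AnalyticAt ℝ (fun x => Real.log (f x) / 2) x := h1.div analyticAt_const two_ne_zero
  exact h2.rexp

theorem contDiff (hf : IsAnalyticPeriodic f) : ContDiff ℝ ω f :=
  contDiff_iff_contDiffAt.2 fun x => (hf.analytic x trivial).contDiffAt

theorem partialDeriv (hf : IsAnalyticPeriodic f) (j : Fin 3) :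
    IsAnalyticPeriodic (partialDeriv j f) := by
  refine ⟨fun x hx => ?_, fun k x => ?_⟩
  · exact (ContinuousLinearMap.apply ℝ ℝ (Pi.single j 1 : Fin 3 → ℝ)).analyticAt _ |>.comp
      (hf.analytic.fderiv x hx)
  · have h : f = fun y => f (y + fun j => (k j : ℝ)) := funext fun y => (hf.periodic k y).symm
    unfold _root_.partialDeriv
    conv_rhs => rw [h, fderiv_comp_add_right]

theorem partialDeriv_iterate (hf : IsAnalyticPeriodic f) (j : Fin 3) (n : ℕ) :
    IsAnalyticPeriodic ((_root_.partialDeriv j)^[n] f) := by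
  induction n with
  | zero => exact hf
  | succ n ih => rw [Function.iterate_succ_apply']; exact ih.partialDeriv j

theorem partialDeriv_iterate_eq (hf : IsAnalyticPeriodic f) (j : Fin 3) (n : ℕ) (x : Fin 3 → ℝ) :
    (_root_.partialDeriv j)^[n] f x = iteratedFDeriv ℝ n f x fun _ => Pi.single j 1 := by
  induction n generalizing x with
  | zero => simp
  | succ n ih =>
    rw [Function.iterate_succ_apply', _root_.partialDeriv, iteratedFDeriv_succ_apply_left]
    have h : (_root_.partialDeriv j)^[n] f = fun x => iteratedFDeriv ℝ n f x fun _ => Pi.single j 1 :=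
      funext ih
    rw [h]
    have hd : DifferentiableAt ℝ (iteratedFDeriv ℝ n f) x :=
      (hf.contDiff.differentiable_iteratedFDeriv (by exact_mod_cast WithTop.coe_lt_top _)) x
    rw [fderiv_continuousMultilinear_apply_const_apply hd]
    rfl

/-- The n-th pure derivative at y is n! times the n-th coefficient of the expansion re-centred at y,
on the unit vector e_j. -/
theorem exists_local_bound (hf : IsAnalyticPeriodic f) (x : Fin 3 → ℝ) :
    ∃ C r : ℝ, 0 < r ∧ ∀ᶠ y in nhds x, ∀ j n,
      |(_root_.partialDeriv j)^[n] f y| * r ^ n ≤ C * n.factorial := by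
  obtain ⟨p, R, hp⟩ := hf.analytic x trivial
  -- Half of a radius below R, as the uniform estimate requires 2r < R.
  obtain ⟨r, hr0, hr⟩ : ∃ r : NNReal, 0 < r ∧ ((r : ENNReal) + r) < R := by
    obtain ⟨s, hs0, hs⟩ := ENNReal.lt_iff_exists_nnreal_btwn.1 hp.r_pos
    refine ⟨s / 2, half_pos (by exact_mod_cast hs0), ?_⟩
    rw [← ENNReal.coe_add, add_halves]
    exact hs
  obtain ⟨T, hT⟩ := p.exists_nnnorm_changeOrigin_mul_pow_le (hr.trans_le hp.r_le)
  refine ⟨T, r, hr0, ?_⟩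
  have hball : Metric.ball x r ∈ nhds x := Metric.ball_mem_nhds x hr0
  filter_upwards [hball] with y hy j n
  have hy' : ‖y - x‖₊ < r := by
    rw [← NNReal.coe_lt_coe, coe_nnnorm, ← dist_eq_norm]; exact hy
  have hyR : (‖y - x‖₊ : ENNReal) < R :=
    (ENNReal.coe_lt_coe.2 hy').trans_le (le_self_add.trans hr.le)
  have h1 := (hp.changeOrigin hyR).factorial_smul (Pi.single j 1) n
  rw [add_sub_cancel] at h1
  rw [hf.partialDeriv_iterate_eq, ← h1]
  have h2 := hT (y - x) hy'.le n
  have h6 : ‖p.changeOrigin (y - x) n fun _ => Pi.single j 1‖ ≤ ‖p.changeOrigin (y - x) n‖ := by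
    refine ((p.changeOrigin (y - x) n).le_opNorm _).trans (le_of_eq ?_)
    simp [Pi.norm_single]
  have h2' : ‖p.changeOrigin (y - x) n‖ * (r : ℝ) ^ n ≤ T := by exact_mod_cast h2
  rw [nsmul_eq_mul, abs_mul, Nat.abs_cast, mul_assoc, mul_comm _ (n.factorial : ℝ)]
  refine mul_le_mul_of_nonneg_left ?_ (by positivity)
  exact (mul_le_mul_of_nonneg_right h6 (by positivity)).trans h2'

theorem exists_mem_cube (x : Fin 3 → ℝ) : ∃ (k : Fin 3 → ℤ) (y : Fin 3 → ℝ),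
    y ∈ Set.Icc (0 : Fin 3 → ℝ) 1 ∧ x = y + fun j => (k j : ℝ) :=
  ⟨fun j => ⌊x j⌋, fun j => Int.fract (x j),
    ⟨fun _ => Int.fract_nonneg _, fun _ => (Int.fract_lt_one _).le⟩,
    funext fun j => (Int.fract_add_floor (x j)).symm⟩

/-- Compactness of the unit cube makes the local constants uniform, and periodicity carries the
bound to all of ℝ³. -/
theorem exists_bound (hf : IsAnalyticPeriodic f) :
    ∃ C r : ℝ, 0 < r ∧ ∀ y j n, |(_root_.partialDeriv j)^[n] f y| * r ^ n ≤ C * n.factorial := by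
  have h : ∃ C r : ℝ, 0 < r ∧ ∀ y ∈ Set.Icc (0 : Fin 3 → ℝ) 1, ∀ j n,
      |(_root_.partialDeriv j)^[n] f y| * r ^ n ≤ C * n.factorial := by
    refine IsCompact.induction_on (p := fun s => ∃ C r : ℝ, 0 < r ∧ ∀ y ∈ s, ∀ j n,
      |(_root_.partialDeriv j)^[n] f y| * r ^ n ≤ C * n.factorial) isCompact_Icc
      ⟨0, 1, one_pos, by simp⟩ ?_ ?_ ?_
    · rintro s t hst ⟨C, r, hr, h⟩
      exact ⟨C, r, hr, fun y hy => h y (hst hy)⟩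
    · rintro s t ⟨C, r, hr, h⟩ ⟨C', r', hr', h'⟩
      refine ⟨max C C', min r r', lt_min hr hr', fun y hy j n => ?_⟩
      rcases hy with hy | hy
      · calc _ ≤ |(_root_.partialDeriv j)^[n] f y| * r ^ n := by gcongr; exact min_le_left _ _
          _ ≤ C * n.factorial := h y hy j n
          _ ≤ _ := by gcongr; exact le_max_left _ _
      · calc _ ≤ |(_root_.partialDeriv j)^[n] f y| * r' ^ n := by gcongr; exact min_le_right _ _
          _ ≤ C' * n.factorial := h' y hy j n
          _ ≤ _ := by gcongr; exact le_max_right _ _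
    · intro x _
      obtain ⟨C, r, hr, h⟩ := hf.exists_local_bound x
      exact ⟨_, mem_nhdsWithin_of_mem_nhds h, C, r, hr, fun y hy => hy⟩
  obtain ⟨C, r, hr, h⟩ := h
  refine ⟨C, r, hr, fun x j n => ?_⟩
  obtain ⟨k, y, hy, rfl⟩ := exists_mem_cube x
  rw [(hf.partialDeriv_iterate j n).periodic]
  exact h y hy j n

end IsAnalyticPeriodic

end

/-! ### Exponential decay of the Fourier coefficients of a periodic analytic function. -/

noncomputable section

open UnitAddTorus MeasureTheory

/-- The Haar probability measure of the torus `(ℝ/ℤ)³`. -/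
def unitTorusMeasure : Measure (UnitAddTorus (Fin 3)) := Measure.pi fun _ => AddCircle.haarAddCircle

instance : IsProbabilityMeasure unitTorusMeasure :=
  inferInstanceAs (IsProbabilityMeasure (Measure.pi fun _ : Fin 3 => AddCircle.haarAddCircle))

instance : Measure.IsAddHaarMeasure unitTorusMeasure :=
  inferInstanceAs (Measure.IsAddHaarMeasure (Measure.pi fun _ : Fin 3 => AddCircle.haarAddCircle))

theorem mFourierCoeff_eq (F : UnitAddTorus (Fin 3) → ℂ) (k : Fin 3 → ℤ) :
    mFourierCoeff F k = ∫ t, mFourier (-k) t * F t ∂unitTorusMeasure := rfl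

/-- The projection `ℝ³ → (ℝ/ℤ)³`. -/
def unitTorusProj (x : Fin 3 → ℝ) : UnitAddTorus (Fin 3) := fun j => (x j : UnitAddCircle)

theorem unitTorusProj_surjective : Function.Surjective unitTorusProj := fun t =>
  ⟨fun j => (t j).out, funext fun j => Quotient.out_eq (t j)⟩

theorem isQuotientMap_unitTorusProj : Topology.IsQuotientMap unitTorusProj :=
  (IsOpenQuotientMap.piMap (f := fun (_ : Fin 3) (x : ℝ) => (x : UnitAddCircle)) fun _ =>
    QuotientAddGroup.isOpenQuotientMap_mk).isQuotientMap

theorem mFourier_unitTorusProj (k : Fin 3 → ℤ) (x : Fin 3 → ℝ) :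
    mFourier k (unitTorusProj x) = fourierMonomial (x, 0) (k, 0) := by
  simp only [mFourier, unitTorusProj, ContinuousMap.coe_mk, fourier_coe_apply, fourierMonomial,
    ← Complex.exp_sum]
  simp only [Pi.zero_apply, pow_zero, Finset.prod_const_one, mul_one]
  congr 1
  rw [Finset.mul_sum]
  exact Finset.sum_congr rfl fun j _ => by push_cast; ring

theorem fourierMonomial_add (k : Fin 3 → ℤ) (x y : Fin 3 → ℝ) :
    fourierMonomial (x + y, 0) (k, 0) = fourierMonomial (x, 0) (k, 0) * fourierMonomial (y, 0) (k, 0) := by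
  simp [fourierMonomial, ← Complex.exp_add, ← mul_add, ← Finset.sum_add_distrib]

namespace IsAnalyticPeriodic

variable {f g : (Fin 3 → ℝ) → ℝ}

theorem apply_eq_of_proj_eq (hf : IsAnalyticPeriodic f) {x y : Fin 3 → ℝ}
    (h : unitTorusProj x = unitTorusProj y) : f x = f y := by
  have h1 : ∀ j, ∃ k : ℤ, y j = x j + k := fun j => by
    have h2 := congrFun h j
    obtain ⟨k, hk⟩ := AddSubgroup.mem_zmultiples_iff.1 (QuotientAddGroup.eq.1 h2)
    refine ⟨k, ?_⟩
    rw [zsmul_eq_mul, mul_one] at hk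
    rw [hk]; ring
  choose k hk using h1
  rw [show y = x + fun j => (k j : ℝ) from funext hk, hf.periodic]

/-- The function induced on the torus. -/
def toTorus (hf : IsAnalyticPeriodic f) : C(UnitAddTorus (Fin 3), ℂ) where
  toFun t := f fun j => (t j).out
  continuous_toFun := by
    rw [isQuotientMap_unitTorusProj.continuous_iff]
    have h : (fun t : UnitAddTorus (Fin 3) => (f fun j => (t j).out : ℂ)) ∘ unitTorusProj =
        fun x => (f x : ℂ) := funext fun x => by
      have := hf.apply_eq_of_proj_eq (x := fun j => (unitTorusProj x j).out) (y := x)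
        (funext fun j => Quotient.out_eq _)
      simp [this]
    rw [h]
    exact Complex.continuous_ofReal.comp hf.contDiff.continuous

theorem toTorus_proj (hf : IsAnalyticPeriodic f) (x : Fin 3 → ℝ) :
    hf.toTorus (unitTorusProj x) = f x := by
  have := hf.apply_eq_of_proj_eq (x := fun j => (unitTorusProj x j).out) (y := x)
    (funext fun j => Quotient.out_eq _)
  exact congrArg (fun z : ℝ => (z : ℂ)) this

/-- The Fourier coefficients. -/
def coeff (hf : IsAnalyticPeriodic f) (k : Fin 3 → ℤ) : ℂ := mFourierCoeff hf.toTorus k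

theorem coeff_neg (hf : IsAnalyticPeriodic f) (k : Fin 3 → ℤ) :
    hf.coeff (-k) = starRingEnd ℂ (hf.coeff k) := by
  rw [coeff, coeff, mFourierCoeff_eq, mFourierCoeff_eq, ← integral_conj]
  refine integral_congr_ae (Filter.Eventually.of_forall fun t => ?_)
  simp only [map_mul]
  rw [← mFourier_neg, toTorus]
  simp

theorem norm_coeff_le (hf : IsAnalyticPeriodic f) {C : ℝ} (hC : ∀ x, |f x| ≤ C) (k : Fin 3 → ℤ) :
    ‖hf.coeff k‖ ≤ C := by
  have h := norm_integral_le_of_norm_le_const (μ := unitTorusMeasure)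
    (f := fun t => mFourier (-k) t • hf.toTorus t) (C := C)
    (Filter.Eventually.of_forall fun t => by
      obtain ⟨x, rfl⟩ := unitTorusProj_surjective t
      rw [norm_smul, toTorus_proj, mFourier_unitTorusProj, norm_fourierMonomial]
      simpa using hC x)
  rw [probReal_univ, mul_one] at h
  exact h

theorem mFourier_add_apply (k : Fin 3 → ℤ) (s t : UnitAddTorus (Fin 3)) :
    mFourier k (s + t) = mFourier k s * mFourier k t := by
  obtain ⟨x, rfl⟩ := unitTorusProj_surjective s
  obtain ⟨y, rfl⟩ := unitTorusProj_surjective t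
  have h : unitTorusProj x + unitTorusProj y = unitTorusProj (x + y) := rfl
  rw [h]
  simp only [mFourier_unitTorusProj, fourierMonomial_add]

/-- Translation invariance of Haar measure: translating a function by s multiplies its k-th
coefficient by the character at s. -/
theorem integral_translate (hf : IsAnalyticPeriodic f) (k : Fin 3 → ℤ) (s : UnitAddTorus (Fin 3)) :
    ∫ t, mFourier (-k) t • hf.toTorus (t + s) ∂unitTorusMeasure = mFourier k s * hf.coeff k := by
  have h := integral_add_right_eq_self (μ := unitTorusMeasure)
    (fun t => mFourier (-k) (t - s) • hf.toTorus t) s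
  simp only [add_sub_cancel_right] at h
  rw [h, coeff, mFourierCoeff_eq]
  refine Eq.trans ?_ (MeasureTheory.integral_const_mul (mFourier k s) _)
  refine integral_congr_ae (Filter.Eventually.of_forall fun t => ?_)
  have h2 : mFourier (-k) (-s) = mFourier k s := by
    obtain ⟨x, rfl⟩ := unitTorusProj_surjective s
    have h : -unitTorusProj x = unitTorusProj (-x) := rfl
    rw [h, mFourier_unitTorusProj, mFourier_unitTorusProj]
    simp [fourierMonomial]
  simp only [sub_eq_add_neg, mFourier_add_apply, h2, smul_eq_mul]
  ring

/-- In place of integration by parts, `integral_translate` with s = σ e_j is differentiated at σ =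
0. The left side is differentiated under the integral sign, the right side is an exponential in σ,
and derivatives are unique. -/
theorem coeff_partialDeriv (hf : IsAnalyticPeriodic f) (j : Fin 3) (k : Fin 3 → ℤ) :
    (hf.partialDeriv j).coeff k = 2 * Real.pi * Complex.I * k j * hf.coeff k := by
  obtain ⟨C, hC⟩ : ∃ C, ∀ t, ‖(hf.partialDeriv j).toTorus t‖ ≤ C :=
    ⟨_, fun t => (hf.partialDeriv j).toTorus.norm_coe_le_norm t⟩
  have hcont : ∀ {h : (Fin 3 → ℝ) → ℝ} (hh : IsAnalyticPeriodic h) (s : UnitAddTorus (Fin 3)),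
      Continuous fun t => mFourier (-k) t • hh.toTorus (t + s) := fun hh s =>
    (mFourier (-k)).continuous.smul (hh.toTorus.continuous.comp (continuous_add_const s))
  have key := (hasDerivAt_integral_of_dominated_loc_of_deriv_le
    (μ := unitTorusMeasure) (x₀ := (0 : ℝ)) (s := Set.univ)
    (F := fun σ t => mFourier (-k) t • hf.toTorus (t + unitTorusProj (Pi.single j σ)))
    (F' := fun σ t => mFourier (-k) t • (hf.partialDeriv j).toTorus (t + unitTorusProj (Pi.single j σ)))
    (bound := fun _ => C) Filter.univ_mem
    (Filter.Eventually.of_forall fun σ => (hcont hf _).aestronglyMeasurable)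
    ((hcont hf _).integrable_of_hasCompactSupport (HasCompactSupport.of_compactSpace _))
    (hcont _ _).aestronglyMeasurable
    (Filter.Eventually.of_forall fun t σ _ => by
      rw [norm_smul]
      have h1 : ‖mFourier (-k) t‖ ≤ 1 := 
        ((mFourier (-k)).norm_coe_le_norm t).trans mFourier_norm.le
      calc _ ≤ 1 * C := mul_le_mul h1 (hC _) (norm_nonneg _) zero_le_one
        _ = C := one_mul C)
    (integrable_const C)
    (Filter.Eventually.of_forall fun t σ _ => by
      refine HasDerivAt.fun_const_smul _ ?_
      obtain ⟨x, rfl⟩ := unitTorusProj_surjective t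
      have h : ∀ σ, unitTorusProj x + unitTorusProj (Pi.single j σ) =
        unitTorusProj (x + Pi.single j σ) := fun σ => rfl
      simp only [h, toTorus_proj]
      refine HasDerivAt.ofReal_comp ?_
      have h1 : HasDerivAt (fun σ : ℝ => x + (Pi.single j σ : Fin 3 → ℝ)) (Pi.single j 1) σ := by
        have h3 : (fun σ : ℝ => x + (Pi.single j σ : Fin 3 → ℝ)) = fun σ => x + σ • Pi.single j 1 := by
          funext σ; rw [← Pi.single_smul, smul_eq_mul, mul_one]
        rw [h3]
        simpa using ((hasDerivAt_id σ).smul_const (Pi.single j 1 : Fin 3 → ℝ)).const_add x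
      have h2 : HasFDerivAt f (fderiv ℝ f (x + Pi.single j σ)) (x + Pi.single j σ) :=
        (hf.analytic _ trivial).differentiableAt.hasFDerivAt
      exact h2.comp_hasDerivAt σ h1)).2
  simp only [integral_translate, mFourier_unitTorusProj] at key
  have h4 : HasDerivAt (fun σ : ℝ => fourierMonomial (Pi.single j σ, 0) (k, 0) * hf.coeff k)
      (2 * Real.pi * Complex.I * k j * hf.coeff k) 0 := by
    refine HasDerivAt.mul_const ?_ _
    have h5 : (fun σ : ℝ => fourierMonomial (Pi.single j σ, 0) (k, 0)) =
        fun σ : ℝ => Complex.exp (2 * Real.pi * Complex.I * k j * (σ : ℂ)) := by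
      funext σ
      have : ∑ l, (k l : ℂ) * ((Pi.single j σ : Fin 3 → ℝ) l : ℂ) = k j * σ := by
        rw [Finset.sum_eq_single j]
        · simp
        · intro l _ hl; simp [hl]
        · simp
      simp only [fourierMonomial, this]
      simp [mul_assoc]
    rw [h5]
    have h6 := (((hasDerivAt_id (0 : ℝ)).ofReal_comp).const_mul
      (2 * Real.pi * Complex.I * k j : ℂ)).cexp
    simpa using h6
  have h7 := key.unique h4
  have h8 : fourierMonomial (Pi.single j (0 : ℝ), 0) (k, 0) = 1 := by simp [fourierMonomial]
  rw [h8, one_mul] at h7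
  exact h7

theorem coeff_partialDeriv_iterate (hf : IsAnalyticPeriodic f) (j : Fin 3) (k : Fin 3 → ℤ) (n : ℕ) :
    (hf.partialDeriv_iterate j n).coeff k = (2 * Real.pi * Complex.I * k j) ^ n * hf.coeff k := by
  induction n with
  | zero => rw [pow_zero, one_mul]; rfl
  | succ n ih =>
    have h := (hf.partialDeriv_iterate j n).coeff_partialDeriv j k
    rw [ih, ← mul_assoc, ← pow_succ'] at h
    rw [← h]
    simp only [coeff, toTorus, Function.iterate_succ_apply']

/-- The coefficients of ∂_jⁿ f are (2πi k_j)ⁿ c_k, and they are bounded by C n!/rⁿ. Division by n!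
and summation over n turns these bounds into an exponential. -/
theorem exists_coeff_bound (hf : IsAnalyticPeriodic f) :
    ∃ C r : ℝ, 0 < r ∧ ∀ k, ‖hf.coeff k‖ * Real.exp (r * frequency k) ≤ C := by
  obtain ⟨C, r, hr, h⟩ := hf.exists_bound
  -- The rate r/2 rather than r leaves a factor 2⁻ⁿ, and the geometric series gives 2C.
  have h1 : ∀ k j, ‖hf.coeff k‖ * Real.exp (r / 2 * (2 * Real.pi * |(k j : ℝ)|)) ≤ 2 * C := by
    intro k j
    set a := 2 * Real.pi * |(k j : ℝ)| with ha
    have ha0 : 0 ≤ a := by have := Real.pi_pos; positivity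
    have h2 : ∀ n : ℕ, ‖hf.coeff k‖ * ((r / 2 * a) ^ n / n.factorial) ≤ C * (1 / 2) ^ n := fun n => by
      have h3 := (hf.partialDeriv_iterate j n).norm_coeff_le (C := C * n.factorial / r ^ n)
        (fun x => (le_div_iff₀ (by positivity)).2 (h x j n)) k
      rw [hf.coeff_partialDeriv_iterate, norm_mul, norm_pow, FourierPoly.norm_two_pi_I_mul, ← ha,
        le_div_iff₀ (by positivity)] at h3
      rw [mul_div_assoc', div_le_iff₀ (by positivity)]
      calc _ = (a ^ n * ‖hf.coeff k‖ * r ^ n) * (1 / 2) ^ n := by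
            rw [mul_pow, div_pow, div_pow, one_pow]; ring
        _ ≤ C * n.factorial * (1 / 2) ^ n := by gcongr
        _ = _ := by ring
    rw [Real.exp_eq_exp_ℝ, NormedSpace.exp_eq_tsum_div, ← tsum_mul_left]
    have h4 : ∑' n : ℕ, C * (1 / 2 : ℝ) ^ n = 2 * C := by
      rw [tsum_mul_left, tsum_geometric_two]; ring
    rw [← h4]
    exact ((Real.summable_pow_div_factorial _).mul_left _).tsum_le_tsum h2
      (summable_geometric_two.mul_left C)
  -- The three one-directional bounds are combined by a geometric mean: the cube of the quantity
  -- with rate r/6 is the product of the three bounds with rate r/2.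
  refine ⟨2 * C, r / 6, by positivity, fun k => ?_⟩
  have hC : 0 ≤ 2 * C := (mul_nonneg (norm_nonneg _) (Real.exp_pos _).le).trans (h1 0 0)
  refine le_of_pow_le_pow_left₀ three_ne_zero hC ?_
  calc (‖hf.coeff k‖ * Real.exp (r / 6 * frequency k)) ^ 3
      = ∏ j, ‖hf.coeff k‖ * Real.exp (r / 2 * (2 * Real.pi * |(k j : ℝ)|)) := by
        rw [Finset.prod_mul_distrib, Finset.prod_const, Finset.card_univ, Fintype.card_fin, mul_pow,
          ← Real.exp_sum, ← Real.exp_nat_mul]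
        congr 2
        rw [← Finset.mul_sum, ← Finset.mul_sum, frequency]
        push_cast; ring
    _ ≤ ∏ _j : Fin 3, (2 * C) := Finset.prod_le_prod (fun j _ => by positivity) fun j _ => h1 k j
    _ = (2 * C) ^ 3 := by simp

end IsAnalyticPeriodic

/-- The frequency is an ℓ¹ norm, so the series is a product of three geometric series over ℤ. -/
theorem summable_exp_neg_frequency {r : ℝ} (hr : 0 < r) :
    Summable fun k : Fin 3 → ℤ => Real.exp (-(r * frequency k)) := by
  set q := Real.exp (-(r * (2 * Real.pi))) with hq
  have hq1 : q < 1 := by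
    have := Real.pi_pos
    rw [hq, Real.exp_lt_one_iff]
    have : 0 < r * (2 * Real.pi) := by positivity
    linarith
  have h1 : Summable fun n : ℤ => q ^ n.natAbs := by
    refine Summable.of_nat_of_neg ?_ ?_ <;>
    simpa only [Int.natAbs_natCast, Int.natAbs_neg] using
      summable_geometric_of_lt_one (Real.exp_pos _).le hq1
  have hn : ∀ n : ℤ, 0 ≤ q ^ n.natAbs := fun n => pow_nonneg (Real.exp_pos _).le _
  have h2 := h1.mul_of_nonneg (h1.mul_of_nonneg h1 hn hn) hn fun _ => mul_nonneg (hn _) (hn _)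
  have hinj : Function.Injective fun k : Fin 3 → ℤ => (k 0, k 1, k 2) := fun k l h => by
    simp only [Prod.mk.injEq] at h
    funext j; fin_cases j
    exacts [h.1, h.2.1, h.2.2]
  refine (h2.comp_injective hinj).congr fun k => ?_
  simp only [Function.comp_apply, hq, ← Real.exp_nat_mul, ← Real.exp_add, frequency, Fin.sum_univ_three,
    Nat.cast_natAbs, Int.cast_abs]
  congr 1; ring

theorem IsAnalyticPeriodic.exists_summable {f : (Fin 3 → ℝ) → ℝ} (hf : IsAnalyticPeriodic f) :
    ∃ r : ℝ, 0 < r ∧ Summable fun k => ‖hf.coeff k‖ * Real.exp (r * frequency k) := by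
  obtain ⟨C, r, hr, h⟩ := hf.exists_coeff_bound
  refine ⟨r / 2, by positivity, ?_⟩
  refine Summable.of_nonneg_of_le (fun k => by positivity) (fun k => ?_)
    ((summable_exp_neg_frequency (half_pos hr)).mul_left C)
  calc ‖hf.coeff k‖ * Real.exp (r / 2 * frequency k)
      = ‖hf.coeff k‖ * Real.exp (r * frequency k) * Real.exp (-(r / 2 * frequency k)) := by
        rw [mul_assoc, ← Real.exp_add]; congr 2; ring
    _ ≤ _ := by gcongr; exact h k

end

/-! ### Periodic analytic functions as elements of the Banach algebra. -/

noncomputable section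

open UnitAddTorus MeasureTheory

/-- The product of two absolutely convergent series indexed by a group, as a convolution. -/
theorem tsum_mul_tsum_eq_tsum_tsum {G A : Type*} [AddCommGroup G] [NormedRing A] [CompleteSpace A]
    {u v : G → A} (hu : Summable fun k => ‖u k‖) (hv : Summable fun k => ‖v k‖) :
    (∑' k, u k) * ∑' k, v k = ∑' n, ∑' k, u k * v (n - k) := by
  have hs := summable_mul_of_summable_norm hu hv
  let e : G × G ≃ G × G :=
    { toFun := fun q => (q.2, q.1 - q.2)
      invFun := fun q => (q.1 + q.2, q.1)
      left_inv := fun q => by simp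
      right_inv := fun q => by simp }
  rw [tsum_mul_tsum_of_summable_norm hu hv, ← e.tsum_eq]
  exact Summable.tsum_prod (e.summable_iff.2 hs)

namespace FourierSeries

variable {R : {R : ℝ // 0 < R}}

theorem norm_one_le : ‖(1 : FourierSeries R)‖ ≤ 1 := by
  rw [← UniformSpace.Completion.coe_one, UniformSpace.Completion.norm_coe, WeightedAlgebra.one_def,
    WeightedAlgebra.norm_single]
  refine (mul_le_mul_of_nonneg_left (fourierWeight_zero_le R 0) (norm_nonneg _)).trans ?_
  simp [frequency_zero]

/-- The upper bound is the weight of the constant monomial; the lower one comes from evaluation at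
the origin. The norm estimate for exponentials needs ‖1‖ = 1. -/
instance : NormOneClass (FourierSeries R) where
  norm_one := by
    refine le_antisymm norm_one_le ?_
    have h := norm_eval_le (R := R) (p := 0)
      (fun j => by have := R.2; simpa using this) 1
    rwa [show eval (1 : FourierSeries R) 0 = 1 from
      map_one (evalHom (R := R) (p := 0) (fun j => by have := R.2; simpa using this)), norm_one] at h

/-- The series of the monomial `exp (2π i k·x) s^α`. -/
def monomial (i : FourierIndex) : FourierSeries R :=
  ((WeightedAlgebra.single i 1 : FourierPoly R) : FourierSeries R)

theorem monomial_mul_monomial (i j : FourierIndex) :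
    (monomial i * monomial j : FourierSeries R) = monomial (i + j) := by
  rw [monomial, monomial, monomial, ← UniformSpace.Completion.coe_mul,
    WeightedAlgebra.single_mul_single, one_mul]

theorem monomial_zero : (monomial 0 : FourierSeries R) = 1 := by
  rw [monomial, ← WeightedAlgebra.one_def, UniformSpace.Completion.coe_one]

theorem eval_monomial {p : FourierPoint} (hp : p ∈ fourierDomain R) (i : FourierIndex) :
    eval (monomial i : FourierSeries R) p = fourierMonomial p i := by
  rw [monomial, eval_coe hp, FourierPoly.evalPoly_single, one_mul]

theorem conj_monomial (i : FourierIndex) :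
    conj (monomial i : FourierSeries R) = monomial (-i.1, i.2) := by
  rw [monomial, conj_coe, FourierPoly.conj_single, map_one]
  rfl

theorem norm_monomial_zero_le (k : Fin 3 → ℤ) :
    ‖(monomial (k, 0) : FourierSeries R)‖ ≤ Real.exp (R * frequency k) := by
  rw [monomial, UniformSpace.Completion.norm_coe, WeightedAlgebra.norm_single, norm_one, one_mul]
  exact fourierWeight_zero_le R k

/-- The coordinate `s_j` as a series. -/
def coord (j : Fin 3) : FourierSeries R := monomial (0, Pi.single j 1)

theorem norm_coord_le (j : Fin 3) : ‖(coord j : FourierSeries R)‖ ≤ R := by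
  rw [coord, monomial, UniformSpace.Completion.norm_coe, WeightedAlgebra.norm_single, norm_one,
    one_mul]
  have h := shiftedExp_le R.2.le (frequency_nonneg 0) 1
  have e : (fourierWeight R).val (0, Pi.single j 1) = shiftedExp R (frequency 0) 1 := by
    have h1 : ∀ i, (Pi.single (M := fun _ : Fin 3 => ℕ) j 1 i).factorial = 1 := fun i => by
      by_cases hi : i = j
      · subst hi; simp
      · simp [hi]
    simp [fourierWeight, fourierWeightVal, h1]
  rw [e]
  simpa [frequency_zero] using h

theorem eval_coord {p : FourierPoint} (hp : p ∈ fourierDomain R) (j : Fin 3) :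
    eval (coord j : FourierSeries R) p = p.2 j := by
  rw [coord, eval_monomial hp, fourierMonomial]
  fin_cases j <;> simp [Fin.prod_univ_three]

theorem conj_coord (j : Fin 3) : conj (coord j : FourierSeries R) = coord j := by
  rw [coord, conj_monomial]; simp

end FourierSeries

namespace IsAnalyticPeriodic

variable {f g : (Fin 3 → ℝ) → ℝ} {R : {R : ℝ // 0 < R}}

/-- The Fourier coefficients decay so fast that the Fourier series defines an element of
`FourierSeries R`. -/
def SummableAt (hf : IsAnalyticPeriodic f) (r : ℝ) : Prop :=
  Summable fun k => ‖hf.coeff k‖ * Real.exp (r * frequency k)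

theorem SummableAt.mono {hf : IsAnalyticPeriodic f} {r r' : ℝ} (h : hf.SummableAt r) (hr : r' ≤ r) :
    hf.SummableAt r' :=
  Summable.of_nonneg_of_le (fun k => by positivity) (fun k => by
    have := frequency_nonneg k
    gcongr) h

theorem SummableAt.summable_norm {hf : IsAnalyticPeriodic f} {r : ℝ} (h : hf.SummableAt r)
    (hr : 0 ≤ r) : Summable fun k => ‖hf.coeff k‖ := by
  simpa [SummableAt] using h.mono hr

/-- The absolutely convergent Fourier series of f is multiplied by g and integrated term by term.
For g only boundedness is used. -/
theorem coeff_mul (hf : IsAnalyticPeriodic f) (hg : IsAnalyticPeriodic g)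
    (hs : Summable fun k => ‖hf.coeff k‖) (n : Fin 3 → ℤ) :
    (hf.mul hg).coeff n = ∑' k, hf.coeff k * hg.coeff (n - k) := by
  obtain ⟨C, r, -, hC'⟩ := hg.exists_bound
  have hC : ∀ x, |g x| ≤ C := fun x => by simpa using hC' x 0 0
  have hG : ∀ t, ‖hg.toTorus t‖ ≤ C := fun t => by
    obtain ⟨x, rfl⟩ := unitTorusProj_surjective t
    rw [toTorus_proj, Complex.norm_real]
    exact hC x
  have hsum := fun t => hasSum_mFourier_series_apply_of_summable (f := hf.toTorus) hs.of_norm t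
  have hb : ∀ k t, ‖hf.coeff k * mFourier k t * (mFourier (-n) t * hg.toTorus t)‖ ≤
      ‖hf.coeff k‖ * C := fun k t => by
    have h1 : ∀ k, ‖mFourier k t‖ ≤ 1 := fun k =>
      (ContinuousMap.norm_coe_le_norm _ t).trans mFourier_norm.le
    rw [norm_mul, norm_mul, norm_mul]
    calc _ ≤ ‖hf.coeff k‖ * 1 * (1 * C) := by
          have := h1 k
          have := h1 (-n)
          have := hG t
          gcongr
      _ = _ := by ring
  have key := hasSum_integral_of_summable_integral_norm (μ := unitTorusMeasure)
    (F := fun k t => hf.coeff k * mFourier k t * (mFourier (-n) t * hg.toTorus t))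
    (fun k => (by fun_prop : Continuous _).integrable_of_hasCompactSupport
      (HasCompactSupport.of_compactSpace _))
    (Summable.of_nonneg_of_le (fun k => integral_nonneg fun _ => norm_nonneg _) (fun k => by
      refine (integral_mono_of_nonneg (Filter.Eventually.of_forall fun _ => norm_nonneg _)
        (integrable_const _) (Filter.Eventually.of_forall (hb k))).trans ?_
      simp) (hs.mul_right C))
  rw [coeff, mFourierCoeff_eq]
  have e1 : ∀ t, mFourier (-n) t * (hf.mul hg).toTorus t =
      ∑' k, hf.coeff k * mFourier k t * (mFourier (-n) t * hg.toTorus t) := fun t => by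
    rw [tsum_mul_right]
    have h2 : ∑' k, hf.coeff k * mFourier k t = hf.toTorus t := (hsum t).tsum_eq
    rw [h2]
    obtain ⟨x, rfl⟩ := unitTorusProj_surjective t
    rw [toTorus_proj, toTorus_proj, toTorus_proj]
    push_cast; ring
  simp only [e1]
  rw [← key.tsum_eq]
  refine tsum_congr fun k => ?_
  rw [show hg.coeff (n - k) = _ from mFourierCoeff_eq _ _, ← integral_const_mul]
  refine integral_congr_ae (Filter.Eventually.of_forall fun t => ?_)
  have : mFourier (-(n - k)) t = mFourier k t * mFourier (-n) t := by
    rw [← mFourier_add]; congr 2; abel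
  simp only [this]
  ring

theorem coeff_add (hf : IsAnalyticPeriodic f) (hg : IsAnalyticPeriodic g) (k : Fin 3 → ℤ) :
    (hf.add hg).coeff k = hf.coeff k + hg.coeff k := by
  rw [coeff, coeff, coeff, mFourierCoeff_eq, mFourierCoeff_eq, mFourierCoeff_eq, ← integral_add]
  · refine integral_congr_ae (Filter.Eventually.of_forall fun t => ?_)
    obtain ⟨x, rfl⟩ := unitTorusProj_surjective t
    simp only [toTorus_proj]
    push_cast; ring
  all_goals
    exact (by fun_prop : Continuous _).integrable_of_hasCompactSupport
      (HasCompactSupport.of_compactSpace _)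

theorem coeff_one (k : Fin 3 → ℤ) (h1 : IsAnalyticPeriodic fun _ => 1) :
    h1.coeff k = if k = 0 then 1 else 0 := by
  have hon := orthonormal_iff_ite.1 (orthonormal_mFourier (d := Fin 3)) k 0
  rw [ContinuousMap.inner_toLp] at hon
  rw [coeff, mFourierCoeff_eq]
  rw [← hon]
  refine integral_congr_ae (Filter.Eventually.of_forall fun t => ?_)
  obtain ⟨x, rfl⟩ := unitTorusProj_surjective t
  simp [toTorus_proj, ← mFourier_neg, mFourier_zero]

/-- The Fourier series of a periodic function, as an element of `FourierSeries R`. -/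
def series (hf : IsAnalyticPeriodic f) (R : {R : ℝ // 0 < R}) : FourierSeries R :=
  ∑' k, hf.coeff k • FourierSeries.monomial (k, 0)

theorem SummableAt.summable_series_norm {hf : IsAnalyticPeriodic f} (h : hf.SummableAt R) :
    Summable fun k => ‖hf.coeff k • (FourierSeries.monomial (k, 0) : FourierSeries R)‖ :=
  Summable.of_nonneg_of_le (fun k => norm_nonneg _) (fun k => by
    rw [norm_smul]
    exact mul_le_mul_of_nonneg_left (FourierSeries.norm_monomial_zero_le k) (norm_nonneg _)) h

theorem series_add {hf : IsAnalyticPeriodic f} {hg : IsAnalyticPeriodic g} (h : hf.SummableAt R)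
    (h' : hg.SummableAt R) : (hf.add hg).series R = hf.series R + hg.series R := by
  rw [series, series, series, ← h.summable_series_norm.of_norm.tsum_add
    h'.summable_series_norm.of_norm]
  exact tsum_congr fun k => by rw [coeff_add, add_smul]

theorem series_one (h1 : IsAnalyticPeriodic fun _ => 1) : h1.series R = 1 := by
  rw [series, tsum_eq_single 0 fun k hk => by rw [coeff_one, if_neg hk, zero_smul],
    coeff_one, if_pos rfl, one_smul]
  exact FourierSeries.monomial_zero

/-- Coefficients of a product are convolutions, and so are products in the algebra. This makes a
pointwise inverse, such as that of the minor, an inverse in the algebra. -/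
theorem series_mul {hf : IsAnalyticPeriodic f} {hg : IsAnalyticPeriodic g} (h : hf.SummableAt R)
    (h' : hg.SummableAt R) : (hf.mul hg).series R = hf.series R * hg.series R := by
  rw [series, series, series,
    tsum_mul_tsum_eq_tsum_tsum h.summable_series_norm h'.summable_series_norm]
  have hbd : ∃ C, ∀ k, ‖hg.coeff k‖ ≤ C := by
    obtain ⟨C, r, -, hC⟩ := hg.exists_bound
    exact ⟨C, hg.norm_coeff_le fun x => by simpa using hC x 0 0⟩
  obtain ⟨C, hC⟩ := hbd
  refine tsum_congr fun n => ?_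
  rw [coeff_mul hf hg (h.summable_norm R.2.le), ← Summable.tsum_smul_const]
  · refine tsum_congr fun k => ?_
    rw [smul_mul_smul_comm, FourierSeries.monomial_mul_monomial]
    congr 2
    simp
  · refine Summable.of_norm (Summable.of_nonneg_of_le (fun _ => norm_nonneg _) (fun k => ?_)
      ((h.summable_norm R.2.le).mul_right C))
    rw [norm_mul]
    exact mul_le_mul_of_nonneg_left (hC _) (norm_nonneg _)

theorem eval_series {hf : IsAnalyticPeriodic f} (h : hf.SummableAt R) {p : FourierPoint}
    (hp : p ∈ fourierDomain R) : FourierSeries.eval (hf.series R) p = f p.1 := by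
  rw [series, ← FourierSeries.evalHom_apply hp, Summable.map_tsum h.summable_series_norm.of_norm
    (FourierSeries.evalHom hp) (FourierSeries.continuous_eval p), ← hf.toTorus_proj p.1]
  refine Eq.trans (tsum_congr fun k => ?_) (hasSum_mFourier_series_apply_of_summable
    (f := hf.toTorus) (h.summable_norm R.2.le).of_norm (unitTorusProj p.1)).tsum_eq
  rw [FourierSeries.evalHom_apply, FourierSeries.eval_smul hp, FourierSeries.eval_monomial hp,
    mFourier_unitTorusProj, smul_eq_mul]
  simp [fourierMonomial, coeff]

theorem conj_series {hf : IsAnalyticPeriodic f} (h : hf.SummableAt R) :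
    FourierSeries.conj (hf.series R) = hf.series R := by
  rw [series, Summable.map_tsum h.summable_series_norm.of_norm FourierSeries.conj
    FourierSeries.continuous_conj, ← (Equiv.neg _).tsum_eq]
  refine tsum_congr fun k => ?_
  rw [Equiv.neg_apply, FourierSeries.conj_smul, coeff_neg, Complex.conj_conj,
    FourierSeries.conj_monomial]
  simp

end IsAnalyticPeriodic

end

noncomputable section

open UnitAddTorus MeasureTheory

/-! ### Holomorphic extension -/

/-- The strip `|Im z_j| < r` in `ℂ³`. -/
def complexStrip (r : ℝ) : Set (EuclideanSpace ℂ (Fin 3)) := {z | ∀ j, |(z j).im| < r}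

theorem isOpen_complexStrip (r : ℝ) : IsOpen (complexStrip r) := by
  simp only [complexStrip, Set.ofPred_forall]
  exact isOpen_iInter_of_finite fun j => isOpen_lt (by fun_prop) continuous_const

theorem convex_complexStrip (r : ℝ) : Convex ℝ (complexStrip r) := by
  intro z hz w hw a b ha hb hab j
  have h1 := hz j
  have h2 := hw j
  rw [abs_lt] at h1 h2 ⊢
  simp only [PiLp.add_apply, PiLp.smul_apply, Complex.add_im, Complex.real_smul, Complex.mul_im,
    Complex.ofReal_re, Complex.ofReal_im, zero_mul, add_zero]
  rcases ha.eq_or_lt with rfl | ha'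
  · obtain rfl : b = 1 := by linarith
    constructor <;> linarith
  · constructor <;> nlinarith

/-- The character `exp (2π i k·z)`. -/
def complexCharacter (k : Fin 3 → ℤ) (z : EuclideanSpace ℂ (Fin 3)) : ℂ :=
  Complex.exp (2 * Real.pi * Complex.I * ∑ j, (k j : ℂ) * z j)

/-- The real part of 2πi k·z is −2π k·Im z. -/
theorem norm_complexCharacter_le (k : Fin 3 → ℤ) {r : ℝ} {z : EuclideanSpace ℂ (Fin 3)}
    (hz : ∀ j, |(z j).im| ≤ r) : ‖complexCharacter k z‖ ≤ Real.exp (r * frequency k) := by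
  have hpi := Real.pi_pos
  rw [complexCharacter, Complex.norm_exp]
  refine Real.exp_le_exp.2 ?_
  have e : (2 * Real.pi * Complex.I * ∑ j, (k j : ℂ) * z j).re =
      -(2 * Real.pi * ∑ j, (k j : ℝ) * (z j).im) := by
    rw [show (2 * Real.pi * Complex.I * ∑ j, (k j : ℂ) * z j) =
      ((2 * Real.pi : ℝ) : ℂ) * (Complex.I * ∑ j, (k j : ℂ) * z j) by push_cast; ring,
      Complex.re_ofReal_mul, Complex.I_mul_re, Complex.im_sum]
    simp
  rw [e, frequency, ← mul_neg, ← Finset.sum_neg_distrib, mul_left_comm, Finset.mul_sum _ _ r]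
  refine mul_le_mul_of_nonneg_left (Finset.sum_le_sum fun j _ => ?_) (by positivity)
  calc -((k j : ℝ) * (z j).im) ≤ |(k j : ℝ) * (z j).im| := neg_le_abs _
    _ = |(z j).im| * |(k j : ℝ)| := by rw [abs_mul, mul_comm]
    _ ≤ _ := mul_le_mul_of_nonneg_right (hz j) (abs_nonneg _)

theorem hasFDerivAt_complexCharacter (k : Fin 3 → ℤ) (z : EuclideanSpace ℂ (Fin 3)) :
    HasFDerivAt (complexCharacter k) (complexCharacter k z • ((2 * Real.pi * Complex.I : ℂ) •
      ∑ j, (k j : ℂ) • (EuclideanSpace.proj j : EuclideanSpace ℂ (Fin 3) →L[ℂ] ℂ))) z := by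
  refine HasFDerivAt.cexp (HasFDerivAt.const_mul (HasFDerivAt.fun_sum fun j _ => ?_) _)
  exact (EuclideanSpace.proj j : EuclideanSpace ℂ (Fin 3) →L[ℂ] ℂ).hasFDerivAt.const_mul _

theorem norm_characterForm_le (k : Fin 3 → ℤ) : ‖(2 * Real.pi * Complex.I : ℂ) •
      ∑ j, (k j : ℂ) • (EuclideanSpace.proj j : EuclideanSpace ℂ (Fin 3) →L[ℂ] ℂ)‖ ≤
      frequency k := by
  have hpi := Real.pi_pos
  rw [norm_smul]
  have h1 : ‖(2 * Real.pi * Complex.I : ℂ)‖ = 2 * Real.pi := by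
    simp [abs_of_pos hpi]
  rw [h1, frequency]
  refine mul_le_mul_of_nonneg_left ((norm_sum_le _ _).trans (Finset.sum_le_sum fun j _ => ?_))
    (by positivity)
  rw [norm_smul]
  have h2 : ‖(EuclideanSpace.proj j : EuclideanSpace ℂ (Fin 3) →L[ℂ] ℂ)‖ ≤ 1 :=
    ContinuousLinearMap.opNorm_le_bound _ zero_le_one fun x => by
      rw [one_mul]; exact PiLp.norm_apply_le x j
  calc _ ≤ ‖(k j : ℂ)‖ * 1 := mul_le_mul_of_nonneg_left h2 (norm_nonneg _)
    _ = _ := by simp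

/-- The imaginary displacement of a real point. -/
def complexPoint (x y : Fin 3 → ℝ) : EuclideanSpace ℂ (Fin 3) :=
  WithLp.toLp 2 fun j => (x j : ℂ) + (y j : ℂ) * Complex.I

theorem complexPoint_apply (x y : Fin 3 → ℝ) (j : Fin 3) :
    complexPoint x y j = (x j : ℂ) + (y j : ℂ) * Complex.I := rfl

/-- The norm of the exponential in a Banach algebra. -/
theorem norm_exp_le {A : Type*} [NormedRing A] [NormedAlgebra ℂ A] [NormOneClass A]
    [CompleteSpace A] (a : A) : ‖NormedSpace.exp a‖ ≤ Real.exp ‖a‖ := by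
  rw [← (NormedSpace.exp_series_hasSum_exp' (𝕂 := ℂ) a).tsum_eq]
  have h := NormedSpace.exp_series_hasSum_exp' (𝕂 := ℝ) ‖a‖
  rw [← Real.exp_eq_exp_ℝ] at h
  refine tsum_of_norm_bounded h fun n => ?_
  rw [norm_smul, smul_eq_mul, norm_inv]
  refine mul_le_mul (by simp) (norm_pow_le a n) (norm_nonneg _) (by positivity)

namespace IsAnalyticPeriodic

variable {f : (Fin 3 → ℝ) → ℝ} {R : {R : ℝ // 0 < R}}

/-- The holomorphic extension of a periodic analytic function. -/
def extension (hf : IsAnalyticPeriodic f) (z : EuclideanSpace ℂ (Fin 3)) : ℂ :=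
  ∑' k, hf.coeff k * complexCharacter k z

theorem extension_real {hf : IsAnalyticPeriodic f} (h : hf.SummableAt R) (x : Fin 3 → ℝ) :
    hf.extension (complexPoint x 0) = f x := by
  rw [extension, ← hf.toTorus_proj x]
  refine Eq.trans (tsum_congr fun k => ?_) (hasSum_mFourier_series_apply_of_summable
    (f := hf.toTorus) (h.summable_norm R.2.le).of_norm (unitTorusProj x)).tsum_eq
  rw [mFourier_unitTorusProj, smul_eq_mul]
  simp [fourierMonomial, coeff, complexCharacter, complexPoint_apply]

theorem extension_periodic (hf : IsAnalyticPeriodic f) (z : EuclideanSpace ℂ (Fin 3))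
    {m : EuclideanSpace ℂ (Fin 3)} (hm : ∀ j, ∃ n : ℤ, m j = n) :
    hf.extension (z + m) = hf.extension z := by
  choose n hn using hm
  refine tsum_congr fun k => ?_
  congr 1
  rw [complexCharacter, complexCharacter, Complex.exp_eq_exp_iff_exists_int]
  refine ⟨∑ j, k j * n j, ?_⟩
  simp only [PiLp.add_apply, hn, mul_add, Finset.sum_add_distrib]
  push_cast
  ring

/-- Half of the rate 2R controls the characters on the strip of width R. The other half pays for the
derivative, by |2πk| ≤ exp(R|2πk|)/R. -/
theorem differentiableOn_extension {hf : IsAnalyticPeriodic f} (h : hf.SummableAt (2 * R)) :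
    DifferentiableOn ℂ hf.extension (complexStrip R) := by
  intro z hz
  have hR := R.2
  refine (hasFDerivAt_tsum_of_isPreconnected (𝕜 := ℂ) (x₀ := 0) (h.mul_right (R : ℝ)⁻¹)
    (isOpen_complexStrip R) (convex_complexStrip R).isPreconnected
    (fun k w _ => (hasFDerivAt_complexCharacter k w).const_mul (hf.coeff k))
    (fun (k : Fin 3 → ℤ) w hw => ?_) (fun j => by simpa using hR) ?_ hz).differentiableAt.differentiableWithinAt
  · rw [norm_smul, norm_smul, mul_assoc ‖hf.coeff k‖ (Real.exp _)]
    refine mul_le_mul_of_nonneg_left ?_ (norm_nonneg (hf.coeff k))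
    have h1 := norm_complexCharacter_le k fun j => (hw j).le
    have h2 := norm_characterForm_le k
    have h3 : frequency k ≤ Real.exp (R * frequency k) * (R : ℝ)⁻¹ := by
      rw [le_mul_inv_iff₀ hR]
      have := Real.add_one_le_exp (R * frequency k)
      linarith [mul_comm (R : ℝ) (frequency k)]
    calc _ ≤ Real.exp (R * frequency k) * (Real.exp (R * frequency k) * (R : ℝ)⁻¹) :=
          mul_le_mul h1 (h2.trans h3) (norm_nonneg _) (by positivity)
      _ = _ := by rw [← mul_assoc, ← Real.exp_add]; congr 2; ring
  · simpa [complexCharacter] using (h.summable_norm (by positivity)).of_norm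

/-- The exponent by which a character changes under an imaginary displacement. -/
def twistExponent (R : {R : ℝ // 0 < R}) (k : Fin 3 → ℤ) (σ : Fin 3 → ℝ) : FourierSeries R :=
  ∑ j, ((-(2 * Real.pi * k j * σ j) : ℝ) : ℂ) • FourierSeries.coord j

theorem norm_twistExponent_le (k : Fin 3 → ℤ) {σ : Fin 3 → ℝ} (hσ : ∀ j, |σ j| ≤ 1) :
    ‖twistExponent R k σ‖ ≤ R * frequency k := by
  have hpi := Real.pi_pos
  refine (norm_sum_le _ _).trans ?_
  rw [frequency, Finset.mul_sum, Finset.mul_sum]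
  refine Finset.sum_le_sum fun j _ => ?_
  rw [norm_smul, Complex.norm_real, norm_neg, norm_mul, norm_mul, norm_mul]
  have h1 := FourierSeries.norm_coord_le (R := R) j
  have h2 := hσ j
  simp only [Real.norm_eq_abs, abs_of_pos hpi, abs_two]
  calc 2 * Real.pi * |(k j : ℝ)| * |σ j| * ‖(FourierSeries.coord j : FourierSeries R)‖
      ≤ 2 * Real.pi * |(k j : ℝ)| * 1 * R := by gcongr
    _ = _ := by ring

/-- The function `(x, s) ↦ H (x + i σ s)`, where `H` is the holomorphic extension, as a series. -/
def twist (hf : IsAnalyticPeriodic f) (R : {R : ℝ // 0 < R}) (σ : Fin 3 → ℝ) : FourierSeries R :=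
  ∑' k, hf.coeff k • (FourierSeries.monomial (k, 0) * NormedSpace.exp (twistExponent R k σ))

/-- One factor exp(R|2πk|) comes from the monomial and one from the exponential of the displacement;
hence the rate 2R in the convergence conditions. -/
theorem norm_twist_term_le (hf : IsAnalyticPeriodic f) (k : Fin 3 → ℤ) {σ : Fin 3 → ℝ}
    (hσ : ∀ j, |σ j| ≤ 1) :
    ‖hf.coeff k • (FourierSeries.monomial (k, 0) * NormedSpace.exp (twistExponent R k σ))‖ ≤
      ‖hf.coeff k‖ * Real.exp (2 * R * frequency k) := by
  rw [norm_smul]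
  refine mul_le_mul_of_nonneg_left ((norm_mul_le _ _).trans ?_) (norm_nonneg _)
  calc _ ≤ Real.exp (R * frequency k) * Real.exp (R * frequency k) :=
        mul_le_mul (FourierSeries.norm_monomial_zero_le k)
          ((norm_exp_le _).trans (Real.exp_le_exp.2 (norm_twistExponent_le k hσ)))
          (norm_nonneg _) (by positivity)
    _ = _ := by rw [← Real.exp_add]; congr 1; ring

/-- Needed at σ = 0, the limit ε → 0 of the rescaled volume density. -/
theorem continuousOn_twist {hf : IsAnalyticPeriodic f} (h : hf.SummableAt (2 * R)) :
    ContinuousOn (hf.twist R) {σ | ∀ j, |σ j| ≤ 1} := by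
  let _ : NormedAlgebra ℚ (FourierSeries R) := NormedAlgebra.restrictScalars ℚ ℂ _
  refine continuousOn_tsum (fun k => ?_) h fun k σ hσ => hf.norm_twist_term_le k hσ
  refine Continuous.continuousOn ?_
  have h1 : Continuous (twistExponent R k) := by
    unfold twistExponent
    refine continuous_finsetSum _ fun j _ => ?_
    have h2 : Continuous fun σ : Fin 3 → ℝ => ((-(2 * Real.pi * k j * σ j) : ℝ) : ℂ) := by fun_prop
    exact h2.smul continuous_const
  have h3 : Continuous fun σ => FourierSeries.monomial (k, 0) *
      NormedSpace.exp (twistExponent R k σ) :=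
    continuous_const.mul (NormedSpace.exp_continuous.comp h1)
  exact h3.const_smul (hf.coeff k)

/-- The character at x + iσs is exp(2πi k·x) exp(−2π k·σs), and evaluation commutes with the
exponential of the algebra. -/
theorem eval_twist {hf : IsAnalyticPeriodic f} (h : hf.SummableAt (2 * R)) {σ : Fin 3 → ℝ}
    (hσ : ∀ j, |σ j| ≤ 1) {p : FourierPoint} (hp : p ∈ fourierDomain R) :
    FourierSeries.eval (hf.twist R σ) p =
      hf.extension (complexPoint p.1 fun j => σ j * p.2 j) := by
  let _ : NormedAlgebra ℚ (FourierSeries R) := NormedAlgebra.restrictScalars ℚ ℂ _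
  have hs : Summable fun k => hf.coeff k •
      (FourierSeries.monomial (k, 0) * NormedSpace.exp (twistExponent R k σ)) :=
    Summable.of_norm (Summable.of_nonneg_of_le (fun _ => norm_nonneg _)
      (fun k => hf.norm_twist_term_le k hσ) h)
  rw [twist, ← FourierSeries.evalHom_apply hp, Summable.map_tsum hs
    (FourierSeries.evalHom hp) (FourierSeries.continuous_eval p)]
  refine tsum_congr fun k => ?_
  rw [FourierSeries.evalHom_apply, FourierSeries.eval_smul hp, FourierSeries.eval_mul hp,
    FourierSeries.eval_monomial hp, ← FourierSeries.evalHom_apply hp (NormedSpace.exp _),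
    NormedSpace.map_exp (FourierSeries.evalHom hp) (FourierSeries.continuous_eval p),
    FourierSeries.evalHom_apply, ← Complex.exp_eq_exp_ℂ, twistExponent, FourierSeries.eval_sum hp]
  simp only [FourierSeries.eval_smul hp, FourierSeries.eval_coord hp]
  rw [fourierMonomial]
  simp only [Pi.zero_apply, pow_zero, Finset.prod_const_one, mul_one]
  rw [← Complex.exp_add, complexCharacter]
  congr 2
  simp only [complexPoint_apply, Fin.sum_univ_three]
  push_cast
  linear_combination -2 * Real.pi * (k 0 * σ 0 * p.2 0 + k 1 * σ 1 * p.2 1 + k 2 * σ 2 * p.2 2) * Complex.I_sq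

end IsAnalyticPeriodic

end

noncomputable section

open UniformSpace

/-! ### A fixed point theorem with a small parameter -/

/-- The map W ↦ G(V ε W) has Lipschitz constant at most K·ε·C while its argument stays in the
neighbourhood where G is K-Lipschitz, hence it contracts a fixed ball for small ε. The closed set S
carries a property preserved by the iteration; in the application this is reality of W. -/
theorem eventually_exists_fixedPoint {B E : Type*} [NormedAddCommGroup B] [CompleteSpace B]
    [NormedAddCommGroup E] {G : E → B} {v₀ : E} {K : NNReal} {t U : Set E} (ht : t ∈ nhds v₀)
    (hU : U ∈ nhds v₀) (hG : LipschitzOnWith K G t) {V : ℝ → B → E} {C : ℝ} (hC : 0 ≤ C)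
    (hV : ∀ ε, 0 < ε → ε ≤ 1 → ∀ W W', ‖V ε W - V ε W'‖ ≤ ε * C * ‖W - W'‖)
    (h0 : Filter.Tendsto (fun ε => V ε 0) (nhdsWithin 0 (Set.Ioi 0)) (nhds v₀))
    {S : Set B} (hS : IsClosed S) (hS0 : (0 : B) ∈ S)
    (hGS : ∀ ε, 0 < ε → ε ≤ 1 → ∀ W ∈ S, V ε W ∈ U → G (V ε W) ∈ S) :
    ∀ᶠ ε in nhdsWithin (0 : ℝ) (Set.Ioi 0), ∃ W ∈ S, V ε W ∈ U ∧ G (V ε W) = W := by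
  obtain ⟨δ, hδ, hball⟩ := Metric.mem_nhds_iff.1 (Filter.inter_mem ht hU)
  have hK : (0 : ℝ) ≤ K := K.2
  -- The iterates stay within distance 1 of G v₀, hence in the ball of radius ρ about 0.
  set ρ := ‖G v₀‖ + 1 with hρ
  have hρ0 : 0 < ρ := by positivity
  have hid : Filter.Tendsto (fun ε : ℝ => ε) (nhdsWithin 0 (Set.Ioi 0)) (nhds 0) :=
    Filter.tendsto_id.mono_left nhdsWithin_le_nhds
  have h1 : Filter.Tendsto (fun ε => ‖V ε 0 - v₀‖ + ε * C * ρ) (nhdsWithin 0 (Set.Ioi 0))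
      (nhds 0) := by
    have h2 := (h0.sub_const v₀).norm.add ((hid.mul_const C).mul_const ρ)
    simpa using h2
  have h3 : Filter.Tendsto (fun ε : ℝ => K * (‖V ε 0 - v₀‖ + ε * C * ρ))
      (nhdsWithin 0 (Set.Ioi 0)) (nhds 0) := by
    simpa using h1.const_mul (K : ℝ)
  have h4 : Filter.Tendsto (fun ε : ℝ => K * (ε * C)) (nhdsWithin 0 (Set.Ioi 0)) (nhds 0) := by
    simpa using (hid.mul_const C).const_mul (K : ℝ)
  filter_upwards [h1.eventually_lt_const hδ, h3.eventually_lt_const one_pos,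
    h4.eventually_lt_const (show (0 : ℝ) < 1 / 2 by norm_num),
    hid.eventually_lt_const one_pos, self_mem_nhdsWithin] with ε e1 e3 e4 e5 e6
  have e6 : 0 < ε := e6
  have hmem : ∀ W, ‖W‖ ≤ ρ → ‖V ε W - v₀‖ ≤ ‖V ε 0 - v₀‖ + ε * C * ρ := fun W hW => by
    have := hV ε e6 e5.le W 0
    rw [sub_zero] at this
    calc ‖V ε W - v₀‖ = ‖(V ε W - V ε 0) + (V ε 0 - v₀)‖ := by abel_nf
      _ ≤ ‖V ε W - V ε 0‖ + ‖V ε 0 - v₀‖ := norm_add_le _ _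
      _ ≤ ε * C * ρ + ‖V ε 0 - v₀‖ := by
        have : ε * C * ‖W‖ ≤ ε * C * ρ := by gcongr
        linarith
      _ = _ := add_comm _ _
  have hin : ∀ W, ‖W‖ ≤ ρ → V ε W ∈ t ∩ U := fun W hW => hball (by
    rw [Metric.mem_ball, dist_eq_norm]
    exact (hmem W hW).trans_lt e1)
  have hv₀ : v₀ ∈ t := mem_of_mem_nhds ht
  let A : Set B := S ∩ Metric.closedBall 0 ρ
  have hmaps : Set.MapsTo (fun W => G (V ε W)) A A := by
    rintro W ⟨hWS, hW⟩
    rw [mem_closedBall_zero_iff] at hW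
    refine ⟨hGS ε e6 e5.le W hWS (hin W hW).2, ?_⟩
    rw [mem_closedBall_zero_iff]
    have h5 := hG.dist_le_mul _ (hin W hW).1 _ hv₀
    rw [dist_eq_norm, dist_eq_norm] at h5
    have h6 : ‖G (V ε W)‖ ≤ ‖G (V ε W) - G v₀‖ + ‖G v₀‖ := by
      simpa using norm_add_le (G (V ε W) - G v₀) (G v₀)
    have h7 := mul_le_mul_of_nonneg_left (hmem W hW) hK
    linarith
  have hcontr : ContractingWith (1 / 2) (hmaps.restrict (fun W => G (V ε W)) A A) := by
    refine ⟨by rw [← NNReal.coe_lt_coe]; norm_num, LipschitzWith.of_dist_le_mul ?_⟩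
    rintro ⟨W, hW⟩ ⟨W', hW'⟩
    rw [Subtype.dist_eq, Subtype.dist_eq]
    change dist (G (V ε W)) (G (V ε W')) ≤ _
    have g1 := hin W (mem_closedBall_zero_iff.1 hW.2)
    have g2 := hin W' (mem_closedBall_zero_iff.1 hW'.2)
    have h5 := hG.dist_le_mul _ g1.1 _ g2.1
    rw [dist_eq_norm (V ε W)] at h5
    have h6 := mul_le_mul_of_nonneg_left (hV ε e6 e5.le W W') hK
    rw [dist_eq_norm W]
    have h7 : K * (ε * C) * ‖W - W'‖ ≤ 1 / 2 * ‖W - W'‖ := by gcongr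
    have h8 : ((1 / 2 : NNReal) : ℝ) = 1 / 2 := by norm_num
    rw [h8]
    linarith
  obtain ⟨W, hW, hfix, -⟩ := ContractingWith.exists_fixedPoint'
    (hS.inter Metric.isClosed_closedBall).isComplete hmaps hcontr (x := 0)
    ⟨hS0, by simp [hρ0.le]⟩ (edist_ne_top _ _)
  exact ⟨W, hW.1, (hin W (mem_closedBall_zero_iff.1 hW.2)).2, hfix⟩

/-! ### Further properties of the integration operators -/

namespace FourierPoly

open WeightedAlgebra

variable {R : {R : ℝ // 0 < R}}

theorem deriv_comm (d d' : Direction) (a : FourierPoly R) :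
    deriv d (deriv d' a) = deriv d' (deriv d a) := by
  refine LinearMap.congr_fun (linearMap_ext (f := deriv d ∘ₗ deriv d') (g := deriv d' ∘ₗ deriv d)
    fun i z => ?_) a
  rcases d with j | j <;> rcases d' with l | l <;>
    simp only [LinearMap.comp_apply, deriv_inl, deriv_inr]
  · congr 1; ring
  · congr 1; ring
  · congr 1; ring
  · by_cases h : j = l
    · rw [h]
    · rw [tsub_right_comm]
      congr 1
      simp [h, Ne.symm h]
      ring

/-- A derivative in s₂ after S is the identity, and all other derivatives commute with S. -/
theorem derivIntegral_comm (d d' : Direction) (a : FourierPoly R) :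
    derivIntegral d (derivIntegral d' a) = derivIntegral d' (derivIntegral d a) := by
  by_cases hd : d = .inr 2
  · subst hd; simp only [derivIntegral_apply, deriv_inr_two_integral]
  by_cases hd' : d' = .inr 2
  · subst hd'; simp only [derivIntegral_apply, deriv_inr_two_integral]
  simp only [derivIntegral_apply]
  rw [deriv_integral_comm d hd, deriv_integral_comm d' hd', deriv_integral_comm d' hd',
    deriv_comm d' d, deriv_integral_comm d' hd']

theorem evalPoly_integral_eq_zero {p : FourierPoint} (hp : p.2 2 = 0) (a : FourierPoly R) :
    evalPoly p (integral a) = 0 := by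
  refine LinearMap.congr_fun (linearMap_ext (f := (evalPoly p).toLinearMap ∘ₗ integral) (g := 0)
    fun i z => ?_) a
  change evalPoly p (integral (single i z)) = 0
  rw [integral_single, evalPoly_single, fourierMonomial, Fin.prod_univ_three]
  simp [hp]

end FourierPoly

namespace FourierSeries

variable {R : {R : ℝ // 0 < R}}

theorem derivIntegral_comm (d d' : Direction) (u : FourierSeries R) :
    derivIntegral d (derivIntegral d' u) = derivIntegral d' (derivIntegral d u) := by
  induction u using Completion.induction_on with
  | hp =>
    refine isClosed_eq ?_ ?_
    · exact (derivIntegral d).continuous.comp (derivIntegral d').continuous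
    · exact (derivIntegral d').continuous.comp (derivIntegral d).continuous
  | ih a => rw [derivIntegral_coe, derivIntegral_coe, derivIntegral_coe, derivIntegral_coe,
      FourierPoly.derivIntegral_comm]

/-- For d ≠ s₂ the operator is S ∂_d, and S integrates from s₂ = 0. These are the Cauchy data of the
correction. -/
theorem eval_derivIntegral_eq_zero {d : Direction} (hd : d ≠ .inr 2) {p : FourierPoint}
    (hp : p ∈ fourierDomain R) (h0 : p.2 2 = 0) (u : FourierSeries R) :
    eval (derivIntegral d u) p = 0 := by
  induction u using Completion.induction_on with
  | hp =>
    refine isClosed_eq ?_ continuous_const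
    exact (continuous_eval p).comp (derivIntegral d).continuous
  | ih a =>
    rw [derivIntegral_coe, eval_coe hp, FourierPoly.derivIntegral_apply,
      FourierPoly.deriv_integral_comm d hd, FourierPoly.evalPoly_integral_eq_zero h0]

theorem norm_derivIntegral_le (d : Direction) (u : FourierSeries R) :
    ‖derivIntegral d u‖ ≤ ‖u‖ := by
  induction u using Completion.induction_on with
  | hp => exact isClosed_le (derivIntegral d).continuous.norm continuous_norm
  | ih a =>
    rw [derivIntegral_coe, Completion.norm_coe, Completion.norm_coe]
    exact FourierPoly.norm_derivIntegral_le d a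

end FourierSeries

/-! ### Periodic metrics -/

/-- A real-analytic Riemannian metric on `ℝ³` invariant under `ℤ³`. -/
structure PeriodicMetric where
  g : Fin 3 → Fin 3 → (Fin 3 → ℝ) → ℝ
  analytic : ∀ i j, IsAnalyticPeriodic (g i j)
  symm : ∀ i j, g i j = g j i
  posDef : ∀ x, (Matrix.of fun i j => g i j x).PosDef

theorem partialDeriv_comm {f : (Fin 3 → ℝ) → ℝ} (hf : IsAnalyticPeriodic f) (i j : Fin 3) :
    partialDeriv i (partialDeriv j f) = partialDeriv j (partialDeriv i f) := by
  funext x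
  have hd : ∀ v, ∀ w, fderiv ℝ (fun x => fderiv ℝ f x v) x w = fderiv ℝ (fderiv ℝ f) x w v :=
    fun v w => by
    have h2 : ContDiff ℝ 1 (fderiv ℝ f) := hf.contDiff.fderiv_right (by simp)
    rw [fderiv_clm_apply (h2.differentiable one_ne_zero x) (differentiableAt_const v)]
    simp
  have hs := (hf.contDiff.contDiffAt (x := x)).isSymmSndFDerivAt (by simp)
  change fderiv ℝ (fun x => fderiv ℝ f x (Pi.single j 1)) x (Pi.single i 1) =
    fderiv ℝ (fun x => fderiv ℝ f x (Pi.single i 1)) x (Pi.single j 1)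
  rw [hd, hd]
  exact hs _ _

theorem IsAnalyticPeriodic.eventually_summableAt {f : (Fin 3 → ℝ) → ℝ} (hf : IsAnalyticPeriodic f) :
    ∀ᶠ r in nhdsWithin (0 : ℝ) (Set.Ioi 0), hf.SummableAt (2 * r) := by
  obtain ⟨r, hr, h⟩ := hf.exists_summable
  filter_upwards [Ioo_mem_nhdsGT (half_pos hr)] with s hs
  exact IsAnalyticPeriodic.SummableAt.mono h (by linarith [hs.2])

namespace PeriodicMetric

variable (𝔤 : PeriodicMetric)

/-- The determinant of the upper left block of size two. -/
def minor (x : Fin 3 → ℝ) : ℝ := 𝔤.g 0 0 x * 𝔤.g 1 1 x - 𝔤.g 0 1 x * 𝔤.g 1 0 x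

/-- The determinant of the metric. -/
def det (x : Fin 3 → ℝ) : ℝ := (Matrix.of fun i j => 𝔤.g i j x).det

/-- This minor is the coefficient of the unknown in the determinant; its positivity says that the
Cauchy problem is noncharacteristic. -/
theorem minor_pos (x : Fin 3 → ℝ) : 0 < 𝔤.minor x := by
  have h := ((𝔤.posDef x).submatrix (e := (![0, 1] : Fin 2 → Fin 3)) (by decide)).det_pos
  rw [Matrix.det_fin_two] at h
  simpa [minor] using h

theorem det_pos (x : Fin 3 → ℝ) : 0 < 𝔤.det x := (𝔤.posDef x).det_pos

theorem analytic_minor : IsAnalyticPeriodic 𝔤.minor :=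
  ((𝔤.analytic 0 0).mul (𝔤.analytic 1 1)).sub ((𝔤.analytic 0 1).mul (𝔤.analytic 1 0))

theorem analytic_minor_inv : IsAnalyticPeriodic fun x => (𝔤.minor x)⁻¹ :=
  𝔤.analytic_minor.inv fun x => (𝔤.minor_pos x).ne'

theorem analytic_det : IsAnalyticPeriodic 𝔤.det := by
  have h := 𝔤.analytic
  have e : 𝔤.det = fun x => 𝔤.g 0 0 x * 𝔤.g 1 1 x * 𝔤.g 2 2 x - 𝔤.g 0 0 x * 𝔤.g 1 2 x * 𝔤.g 2 1 x
      - 𝔤.g 0 1 x * 𝔤.g 1 0 x * 𝔤.g 2 2 x + 𝔤.g 0 1 x * 𝔤.g 1 2 x * 𝔤.g 2 0 x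
      + 𝔤.g 0 2 x * 𝔤.g 1 0 x * 𝔤.g 2 1 x - 𝔤.g 0 2 x * 𝔤.g 1 1 x * 𝔤.g 2 0 x := by
    funext x
    rw [det, Matrix.det_fin_three]
    rfl
  rw [e]
  have m : ∀ a b c d e f, IsAnalyticPeriodic fun x => 𝔤.g a b x * 𝔤.g c d x * 𝔤.g e f x :=
    fun a b c d e f => ((h a b).mul (h c d)).mul (h e f)
  exact ((((((m _ _ _ _ _ _).sub (m _ _ _ _ _ _)).sub (m _ _ _ _ _ _)).add (m _ _ _ _ _ _)).add
    (m _ _ _ _ _ _)).sub (m _ _ _ _ _ _))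

theorem analytic_volume : IsAnalyticPeriodic fun x => √(𝔤.det x) :=
  𝔤.analytic_det.sqrt 𝔤.det_pos

/-- The convergence conditions on all the Fourier series which occur. -/
structure Converges (R : {R : ℝ // 0 < R}) : Prop where
  metric : ∀ i j, (𝔤.analytic i j).SummableAt (2 * R)
  deriv : ∀ l i j, ((𝔤.analytic i j).partialDeriv l).SummableAt (2 * R)
  deriv_deriv : ∀ l m i j, (((𝔤.analytic i j).partialDeriv l).partialDeriv m).SummableAt (2 * R)
  minor_inv : 𝔤.analytic_minor_inv.SummableAt (2 * R)
  volume : 𝔤.analytic_volume.SummableAt (2 * R)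
  mul : ∀ i j k l, ((𝔤.analytic i j).mul (𝔤.analytic k l)).SummableAt (2 * R)
  minor : 𝔤.analytic_minor.SummableAt (2 * R)

theorem exists_converges : ∃ R, 𝔤.Converges R := by
  have h : ∀ᶠ r in nhdsWithin (0 : ℝ) (Set.Ioi 0), ∃ h : 0 < r, 𝔤.Converges ⟨r, h⟩ := by
    filter_upwards [self_mem_nhdsWithin,
      Filter.eventually_all.2 fun i => Filter.eventually_all.2 fun j =>
        (𝔤.analytic i j).eventually_summableAt,
      Filter.eventually_all.2 fun l => Filter.eventually_all.2 fun i => Filter.eventually_all.2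
        fun j => ((𝔤.analytic i j).partialDeriv l).eventually_summableAt,
      Filter.eventually_all.2 fun l => Filter.eventually_all.2 fun m => Filter.eventually_all.2
        fun i => Filter.eventually_all.2 fun j =>
        (((𝔤.analytic i j).partialDeriv l).partialDeriv m).eventually_summableAt,
      𝔤.analytic_minor_inv.eventually_summableAt, 𝔤.analytic_volume.eventually_summableAt,
      Filter.eventually_all.2 fun i => Filter.eventually_all.2 fun j => Filter.eventually_all.2
        fun k => Filter.eventually_all.2 fun l =>
        ((𝔤.analytic i j).mul (𝔤.analytic k l)).eventually_summableAt,
      𝔤.analytic_minor.eventually_summableAt] with r h0 h1 h2 h3 h4 h5 h6 h7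
    exact ⟨h0, h1, h2, h3, h4, h5, h6, h7⟩
  obtain ⟨r, hr, h⟩ := h.exists
  exact ⟨⟨r, hr⟩, h⟩

end PeriodicMetric

end

noncomputable section

/-! ### The Monge–Ampère system -/

/-- The weights of the variables in the anisotropic rescaling `y_j = ε^{p_j} s_j`. -/
def dirWeight : Direction → ℕ
  | .inl _ => 0
  | .inr j => if j = 2 then 2 else 1

/-- The reason for the weights 0, 1, 1, 2: the pair (y₂, y₂) alone has total weight 4, so after
multiplication by ε⁴ all other second derivatives of the correction keep at least one factor ε. -/
theorem dirWeight_add_le {d d' : Direction} (h : ¬(d = .inr 2 ∧ d' = .inr 2)) :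
    dirWeight d + dirWeight d' ≤ 3 := by
  have h1 : ∀ d, dirWeight d ≤ 2 ∧ (d ≠ .inr 2 → dirWeight d ≤ 1) := by
    rintro (j | j)
    · simp [dirWeight]
    · by_cases hj : j = 2 <;> simp [dirWeight, hj]
  by_cases hd : d = .inr 2
  · have := (h1 d').2 fun h2 => h ⟨hd, h2⟩
    have := (h1 d).1
    omega
  · have := (h1 d).2 hd
    have := (h1 d').1
    omega

/-- The scaling factors. -/
def fiberScale (ε : ℝ) (j : Fin 3) : ℝ := ε ^ dirWeight (.inr j)

theorem fiberScale_zero (j : Fin 3) : fiberScale 0 j = 0 := by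
  by_cases hj : j = 2 <;> simp [fiberScale, dirWeight, hj]

theorem abs_fiberScale_le {ε : ℝ} (h0 : 0 ≤ ε) (h1 : ε ≤ 1) (j : Fin 3) : |fiberScale ε j| ≤ 1 := by
  rw [fiberScale, abs_pow, abs_of_nonneg h0]
  exact pow_le_one₀ h0 h1

theorem continuous_fiberScale : Continuous fiberScale :=
  continuous_pi fun _ => continuous_pow _

/-- The complex Hessian matrix `4 ∂²/∂z_i∂z̄_j` expressed through the real second derivatives. -/
def leviForm {A : Type*} [AddCommGroup A] [Module ℂ A] (Q : Direction → Direction → A) :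
    Matrix (Fin 3) (Fin 3) A :=
  Matrix.of fun i j => Q (.inl i) (.inl j) + Q (.inr i) (.inr j) +
    Complex.I • (Q (.inl i) (.inr j) - Q (.inr i) (.inl j))

theorem det_eq_of_eq_off_two_two {A : Type*} [CommRing A] {M N : Matrix (Fin 3) (Fin 3) A} {w : A}
    (h : ∀ i j, N i j = M i j + if i = 2 ∧ j = 2 then w else 0) :
    N.det = M.det + w * (M 0 0 * M 1 1 - M 0 1 * M 1 0) := by
  rw [Matrix.det_fin_three, Matrix.det_fin_three]
  simp only [h]
  simp
  ring

/-- The solution for the last entry of a matrix of given determinant. -/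
def solveLastEntry {A : Type*} [CommRing A] (v : A × (Fin 3 → Fin 3 → A)) : A :=
  (v.1 - (Matrix.of v.2).det) * Ring.inverse (v.2 0 0 * v.2 1 1 - v.2 0 1 * v.2 1 0)

/-- A polynomial times the inverse of the minor, and inversion is smooth at units of a Banach
algebra. The fixed point theorem needs the resulting local Lipschitz bound. -/
theorem contDiffAt_solveLastEntry {A : Type*} [NormedCommRing A] [NormedAlgebra ℂ A]
    [CompleteSpace A] {v : A × (Fin 3 → Fin 3 → A)}
    (hv : IsUnit (v.2 0 0 * v.2 1 1 - v.2 0 1 * v.2 1 0)) : ContDiffAt ℂ 1 solveLastEntry v := by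
  have hc : ∀ i j, ContDiff ℂ 1 fun v : A × (Fin 3 → Fin 3 → A) => v.2 i j := fun i j =>
    contDiff_pi.1 (contDiff_pi.1 contDiff_snd i) j
  obtain ⟨u, hu⟩ := hv
  have h1 : ContDiffAt ℂ 1 (fun v : A × (Fin 3 → Fin 3 → A) =>
      Ring.inverse (v.2 0 0 * v.2 1 1 - v.2 0 1 * v.2 1 0)) v := by
    refine ContDiffAt.comp (g := Ring.inverse) v ?_
      (((hc 0 0).mul (hc 1 1)).sub ((hc 0 1).mul (hc 1 0))).contDiffAt
    change ContDiffAt ℂ 1 Ring.inverse (v.2 0 0 * v.2 1 1 - v.2 0 1 * v.2 1 0)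
    rw [← hu]
    exact contDiffAt_ringInverse ℂ u
  refine ContDiffAt.mul (contDiffAt_fst.sub ?_) h1
  simp only [Matrix.det_fin_three, Matrix.of_apply]
  have m : ∀ a b c d e f, ContDiff ℂ 1 fun v : A × (Fin 3 → Fin 3 → A) =>
      v.2 a b * v.2 c d * v.2 e f := fun a b c d e f => ((hc a b).mul (hc c d)).mul (hc e f)
  exact ((((((m _ _ _ _ _ _).sub (m _ _ _ _ _ _)).sub (m _ _ _ _ _ _)).add (m _ _ _ _ _ _)).add
    (m _ _ _ _ _ _)).sub (m _ _ _ _ _ _)).contDiffAt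

theorem IsAnalyticPeriodic.series_congr {f f' : (Fin 3 → ℝ) → ℝ} (hf : IsAnalyticPeriodic f)
    (hf' : IsAnalyticPeriodic f') (h : f = f') (R : {R : ℝ // 0 < R}) :
    hf.series R = hf'.series R := by
  subst h; rfl

/-! ### The rescaled Monge–Ampère equation as a fixed point problem. -/

namespace PeriodicMetric

variable (𝔤 : PeriodicMetric) {R : {R : ℝ // 0 < R}}

theorem _root_.IsAnalyticPeriodic.SummableAt.of_two_mul {f : (Fin 3 → ℝ) → ℝ}
    {hf : IsAnalyticPeriodic f} (h : hf.SummableAt (2 * R)) : hf.SummableAt R :=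
  h.mono (by linarith [R.2])

/-- The function `y_a` in rescaled coordinates. -/
def fiberCoord (R : {R : ℝ // 0 < R}) (ε : ℝ) (a : Fin 3) : FourierSeries R :=
  (fiberScale ε a : ℂ) • FourierSeries.coord a

/-- The second derivatives of `½ ∑ g_{ab} y_a y_b`, in rescaled coordinates. -/
def baseHess (R : {R : ℝ // 0 < R}) (ε : ℝ) : Direction → Direction → FourierSeries R
  | .inl i, .inl j => (1 / 2 : ℂ) • ∑ a, ∑ b,
      (((𝔤.analytic a b).partialDeriv j).partialDeriv i).series R *
        (fiberCoord R ε a * fiberCoord R ε b)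
  | .inl i, .inr j => ∑ a, ((𝔤.analytic a j).partialDeriv i).series R * fiberCoord R ε a
  | .inr j, .inl i => ∑ a, ((𝔤.analytic a j).partialDeriv i).series R * fiberCoord R ε a
  | .inr i, .inr j => (𝔤.analytic i j).series R

/-- The second derivatives of the rescaled potential with unknown `W`. -/
def fullHess (ε : ℝ) (W : FourierSeries R) (d d' : Direction) : FourierSeries R :=
  𝔤.baseHess R ε d d' + ((ε ^ (4 - (dirWeight d + dirWeight d')) : ℝ) : ℂ) •
    FourierSeries.derivIntegral d (FourierSeries.derivIntegral d' W)

/-- The coefficients of the lower order terms. -/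
def lowerCoeff (ε : ℝ) (d d' : Direction) : ℝ :=
  if d = .inr 2 ∧ d' = .inr 2 then 0 else ε ^ (4 - (dirWeight d + dirWeight d'))

theorem lowerCoeff_symm (ε : ℝ) (d d' : Direction) : lowerCoeff ε d d' = lowerCoeff ε d' d := by
  unfold lowerCoeff
  rw [add_comm (dirWeight d)]
  exact if_congr and_comm rfl rfl

theorem abs_lowerCoeff_le {ε : ℝ} (h0 : 0 < ε) (h1 : ε ≤ 1) (d d' : Direction) :
    |lowerCoeff ε d d'| ≤ ε := by
  unfold lowerCoeff
  split_ifs with h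
  · simpa using h0.le
  · rw [abs_of_pos (by positivity)]
    have := dirWeight_add_le h
    exact pow_le_of_le_one h0.le h1 (by omega)

/-- The second derivatives without the leading term `W`. -/
def lowerHess (ε : ℝ) (W : FourierSeries R) (d d' : Direction) : FourierSeries R :=
  𝔤.baseHess R ε d d' + (lowerCoeff ε d d' : ℂ) •
    FourierSeries.derivIntegral d (FourierSeries.derivIntegral d' W)

/-- The coefficient for (y₂, y₂) is ε⁰ and ∂₂S is the identity, so the leading term is W itself, and
it enters the complex Hessian only in the last diagonal entry. -/
theorem leviForm_fullHess (ε : ℝ) (W : FourierSeries R) (i j : Fin 3) :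
    leviForm (𝔤.fullHess ε W) i j =
      leviForm (𝔤.lowerHess ε W) i j + if i = 2 ∧ j = 2 then W else 0 := by
  by_cases h : i = 2 ∧ j = 2
  · obtain ⟨rfl, rfl⟩ := h
    simp [leviForm, fullHess, lowerHess, lowerCoeff, dirWeight, FourierSeries.derivIntegral_two]
    abel
  · have h' : ¬((Sum.inr i : Direction) = .inr 2 ∧ (Sum.inr j : Direction) = .inr 2) := by
      simpa using h
    simp only [leviForm, fullHess, lowerHess, lowerCoeff, Matrix.of_apply, if_neg h, if_neg h',
      reduceCtorEq, false_and, and_false, if_false, add_zero]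

/-- The squared modulus of the holomorphic extension of the volume density. -/
def volumeSeries (R : {R : ℝ // 0 < R}) (ε : ℝ) : FourierSeries R :=
  𝔤.analytic_volume.twist R (fiberScale ε) *
    FourierSeries.conj (𝔤.analytic_volume.twist R (fiberScale ε))

/-- The data of the equation for the last entry of the complex Hessian. -/
def system (ε : ℝ) (W : FourierSeries R) : FourierSeries R × (Fin 3 → Fin 3 → FourierSeries R) :=
  (𝔤.volumeSeries R ε, leviForm (𝔤.lowerHess ε W))

/-- Each entry of the complex Hessian combines four second derivatives, each with coefficient at
most ε and with operators of norm at most 1; hence the constant 4. -/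
theorem norm_system_sub_le {ε : ℝ} (h0 : 0 < ε) (h1 : ε ≤ 1) (W W' : FourierSeries R) :
    ‖𝔤.system ε W - 𝔤.system ε W'‖ ≤ ε * 4 * ‖W - W'‖ := by
  have hQ : ∀ d d', ‖𝔤.lowerHess ε W d d' - 𝔤.lowerHess ε W' d d'‖ ≤ ε * ‖W - W'‖ := fun d d' => by
    rw [lowerHess, lowerHess, add_sub_add_left_eq_sub, ← smul_sub, ← map_sub, ← map_sub, norm_smul,
      Complex.norm_real]
    exact mul_le_mul (abs_lowerCoeff_le h0 h1 d d') ((FourierSeries.norm_derivIntegral_le _ _).trans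
      (FourierSeries.norm_derivIntegral_le _ _)) (norm_nonneg _) h0.le
  have hpos : 0 ≤ ε * 4 * ‖W - W'‖ := by positivity
  refine (norm_prod_le_iff.2 ⟨?_, ?_⟩)
  · change ‖𝔤.volumeSeries R ε - 𝔤.volumeSeries R ε‖ ≤ _
    rwa [sub_self, norm_zero]
  refine (pi_norm_le_iff_of_nonneg hpos).2 fun i => (pi_norm_le_iff_of_nonneg hpos).2 fun j => ?_
  have e : (leviForm (𝔤.lowerHess ε W) - leviForm (𝔤.lowerHess ε W')) i j =
      (𝔤.lowerHess ε W (.inl i) (.inl j) - 𝔤.lowerHess ε W' (.inl i) (.inl j)) +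
      (𝔤.lowerHess ε W (.inr i) (.inr j) - 𝔤.lowerHess ε W' (.inr i) (.inr j)) +
      Complex.I • ((𝔤.lowerHess ε W (.inl i) (.inr j) - 𝔤.lowerHess ε W' (.inl i) (.inr j)) -
        (𝔤.lowerHess ε W (.inr i) (.inl j) - 𝔤.lowerHess ε W' (.inr i) (.inl j))) := by
    simp only [leviForm, Matrix.sub_apply, Matrix.of_apply, smul_sub]
    abel
  change ‖(leviForm (𝔤.lowerHess ε W) - leviForm (𝔤.lowerHess ε W')) i j‖ ≤ _
  rw [e]
  refine (norm_add_le _ _).trans ?_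
  rw [norm_smul, Complex.norm_I, one_mul]
  have t1 := norm_add_le (𝔤.lowerHess ε W (.inl i) (.inl j) - 𝔤.lowerHess ε W' (.inl i) (.inl j))
    (𝔤.lowerHess ε W (.inr i) (.inr j) - 𝔤.lowerHess ε W' (.inr i) (.inr j))
  have t2 := norm_sub_le (𝔤.lowerHess ε W (.inl i) (.inr j) - 𝔤.lowerHess ε W' (.inl i) (.inr j))
    (𝔤.lowerHess ε W (.inr i) (.inl j) - 𝔤.lowerHess ε W' (.inr i) (.inl j))
  linarith [hQ (.inl i) (.inl j), hQ (.inr i) (.inr j), hQ (.inl i) (.inr j), hQ (.inr i) (.inl j)]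

theorem continuous_fiberCoord (a : Fin 3) : Continuous fun ε => fiberCoord R ε a := by
  have h : Continuous fun ε : ℝ => (fiberScale ε a : ℂ) :=
    Complex.continuous_ofReal.comp ((continuous_apply a).comp continuous_fiberScale)
  exact h.smul continuous_const

theorem continuous_baseHess (d d' : Direction) : Continuous fun ε => 𝔤.baseHess R ε d d' := by
  have h := continuous_fiberCoord (R := R)
  rcases d with i | i <;> rcases d' with j | j
  · have h2 : Continuous fun ε => ∑ a, ∑ b,
        (((𝔤.analytic a b).partialDeriv j).partialDeriv i).series R *
        (fiberCoord R ε a * fiberCoord R ε b) :=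
      continuous_finsetSum _ fun a _ => continuous_finsetSum _ fun b _ =>
        continuous_const.mul ((h a).mul (h b))
    exact h2.const_smul (1 / 2 : ℂ)
  · exact continuous_finsetSum _ fun a _ => continuous_const.mul (h a)
  · exact continuous_finsetSum _ fun a _ => continuous_const.mul (h a)
  · exact continuous_const

theorem lowerHess_zero (ε : ℝ) : 𝔤.lowerHess ε (0 : FourierSeries R) = 𝔤.baseHess R ε := by
  funext d d'
  simp [lowerHess]

theorem tendsto_system (h : 𝔤.Converges R) :
    Filter.Tendsto (fun ε => 𝔤.system ε (0 : FourierSeries R)) (nhdsWithin 0 (Set.Ioi 0))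
      (nhds (𝔤.system 0 0)) := by
  refine Filter.Tendsto.prodMk_nhds ?_ ?_
  · have h1 : ContinuousWithinAt (fun ε => 𝔤.analytic_volume.twist R (fiberScale ε))
        (Set.Icc 0 1) 0 := by
      refine ContinuousOn.comp (IsAnalyticPeriodic.continuousOn_twist h.volume)
        continuous_fiberScale.continuousOn
        (fun ε hε j => abs_fiberScale_le hε.1 hε.2 j) 0 (by simp)
    have h2 : ContinuousWithinAt (fun ε => 𝔤.volumeSeries R ε) (Set.Icc 0 1) 0 :=
      h1.mul (FourierSeries.continuous_conj.continuousAt.comp_continuousWithinAt h1)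
    -- Continuity of the twist is available only for scales in [0, 1], which suffices for one-sided
    -- limits at 0.
    refine h2.tendsto.mono_left ?_
    rw [nhdsWithin_le_iff]
    exact Filter.mem_of_superset (Ioc_mem_nhdsGT one_pos) Set.Ioc_subset_Icc_self
  · refine Filter.Tendsto.mono_left (Continuous.tendsto ?_ 0) nhdsWithin_le_nhds
    simp only [lowerHess_zero]
    have h := fun d d' => 𝔤.continuous_baseHess (R := R) d d'
    refine continuous_pi fun i => continuous_pi fun j => ?_
    exact ((h _ _).add (h _ _)).add (((h _ _).sub (h _ _)).const_smul Complex.I)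

theorem baseHess_zero (d d' : Direction) : 𝔤.baseHess R 0 d d' =
    match d, d' with
    | .inr i, .inr j => (𝔤.analytic i j).series R
    | _, _ => 0 := by
  rcases d with i | i <;> rcases d' with j | j <;> simp [baseHess, fiberCoord, fiberScale_zero]

theorem leviForm_baseHess_zero (i j : Fin 3) :
    leviForm (𝔤.baseHess R 0) i j = (𝔤.analytic i j).series R := by
  simp [leviForm, baseHess_zero]

/-- At ε = 0 the data are the series of g_ij, and the series of the pointwise inverse of the minor
is an inverse in the algebra. -/
theorem isUnit_minor (h : 𝔤.Converges R) :
    IsUnit ((𝔤.system 0 (0 : FourierSeries R)).2 0 0 * (𝔤.system 0 (0 : FourierSeries R)).2 1 1 -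
      (𝔤.system 0 (0 : FourierSeries R)).2 0 1 * (𝔤.system 0 (0 : FourierSeries R)).2 1 0) := by
  have e : ∀ i j, (𝔤.system 0 (0 : FourierSeries R)).2 i j = (𝔤.analytic i j).series R :=
    fun i j => by
      change leviForm (𝔤.lowerHess 0 0) i j = _
      rw [lowerHess_zero, leviForm_baseHess_zero]
  have h1 := IsAnalyticPeriodic.series_add (R := R) (.of_two_mul h.minor) (.of_two_mul (h.mul 0 1 1 0))
  rw [IsAnalyticPeriodic.series_congr _ ((𝔤.analytic 0 0).mul (𝔤.analytic 1 1))
    (by funext x; simp [minor]) R, IsAnalyticPeriodic.series_mul (.of_two_mul (h.metric _ _))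
      (.of_two_mul (h.metric _ _)), IsAnalyticPeriodic.series_mul (.of_two_mul (h.metric _ _))
      (.of_two_mul (h.metric _ _))] at h1
  rw [e, e, e, e, h1, add_sub_cancel_right]
  refine IsUnit.of_mul_eq_one (𝔤.analytic_minor_inv.series R) ?_
  rw [← IsAnalyticPeriodic.series_mul (.of_two_mul h.minor) (.of_two_mul h.minor_inv),
    IsAnalyticPeriodic.series_congr _ (IsAnalyticPeriodic.const 1)
    (by funext x; exact mul_inv_cancel₀ (𝔤.minor_pos x).ne') R]
  exact IsAnalyticPeriodic.series_one _

theorem conj_fiberCoord (ε : ℝ) (a : Fin 3) :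
    FourierSeries.conj (fiberCoord R ε a) = fiberCoord R ε a := by
  rw [fiberCoord, FourierSeries.conj_smul, FourierSeries.conj_coord, Complex.conj_ofReal]

theorem conj_baseHess (h : 𝔤.Converges R) (ε : ℝ) (d d' : Direction) :
    FourierSeries.conj (𝔤.baseHess R ε d d') = 𝔤.baseHess R ε d d' := by
  rcases d with i | i <;> rcases d' with j | j
  · simp only [baseHess, FourierSeries.conj_smul, map_sum, map_mul, conj_fiberCoord]
    congr 1
    · simp [Complex.conj_ofNat]
    · exact Finset.sum_congr rfl fun a _ => Finset.sum_congr rfl fun b _ => by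
        rw [IsAnalyticPeriodic.conj_series (.of_two_mul (h.deriv_deriv _ _ _ _))]
  · simp only [baseHess, map_sum, map_mul, conj_fiberCoord]
    exact Finset.sum_congr rfl fun a _ => by
      rw [IsAnalyticPeriodic.conj_series (.of_two_mul (h.deriv _ _ _))]
  · simp only [baseHess, map_sum, map_mul, conj_fiberCoord]
    exact Finset.sum_congr rfl fun a _ => by
      rw [IsAnalyticPeriodic.conj_series (.of_two_mul (h.deriv _ _ _))]
  · exact IsAnalyticPeriodic.conj_series (.of_two_mul (h.metric _ _))

theorem conj_lowerHess (h : 𝔤.Converges R) (ε : ℝ) {W : FourierSeries R}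
    (hW : FourierSeries.conj W = W) (d d' : Direction) :
    FourierSeries.conj (𝔤.lowerHess ε W d d') = 𝔤.lowerHess ε W d d' := by
  rw [lowerHess, map_add, 𝔤.conj_baseHess h, FourierSeries.conj_smul, Complex.conj_ofReal,
    FourierSeries.conj_derivIntegral, FourierSeries.conj_derivIntegral, hW]

theorem baseHess_symm (ε : ℝ) (d d' : Direction) :
    𝔤.baseHess R ε d d' = 𝔤.baseHess R ε d' d := by
  rcases d with i | i <;> rcases d' with j | j
  · simp only [baseHess]
    congr 1
    exact Finset.sum_congr rfl fun a _ => Finset.sum_congr rfl fun b _ => by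
      rw [IsAnalyticPeriodic.series_congr _ (((𝔤.analytic a b).partialDeriv i).partialDeriv j)
        (partialDeriv_comm (𝔤.analytic a b) i j) R]
  · rfl
  · rfl
  · exact IsAnalyticPeriodic.series_congr _ _ (𝔤.symm i j) R

theorem lowerHess_symm (ε : ℝ) (W : FourierSeries R) (d d' : Direction) :
    𝔤.lowerHess ε W d d' = 𝔤.lowerHess ε W d' d := by
  rw [lowerHess, lowerHess, baseHess_symm, FourierSeries.derivIntegral_comm,
    lowerCoeff_symm]

theorem conj_leviForm_lowerHess (h : 𝔤.Converges R) (ε : ℝ) {W : FourierSeries R}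
    (hW : FourierSeries.conj W = W) (i j : Fin 3) :
    FourierSeries.conj (leviForm (𝔤.lowerHess ε W) i j) = leviForm (𝔤.lowerHess ε W) j i := by
  simp only [leviForm, Matrix.of_apply, map_add, map_sub, FourierSeries.conj_smul,
    𝔤.conj_lowerHess h ε hW, Complex.conj_I]
  rw [𝔤.lowerHess_symm ε W (.inl i) (.inl j), 𝔤.lowerHess_symm ε W (.inr i) (.inr j),
    𝔤.lowerHess_symm ε W (.inl i) (.inr j), 𝔤.lowerHess_symm ε W (.inr i) (.inl j), neg_smul,
    ← smul_neg, neg_sub]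

/-- For real W the complex Hessian is Hermitian: conjugation transposes it, which fixes the
determinant and the minor, and the inverse of the minor by uniqueness. So the iteration preserves
real functions. -/
theorem conj_solve_system (h : 𝔤.Converges R) (ε : ℝ) {W : FourierSeries R}
    (hW : FourierSeries.conj W = W)
    (hu : IsUnit ((𝔤.system ε W).2 0 0 * (𝔤.system ε W).2 1 1 -
      (𝔤.system ε W).2 0 1 * (𝔤.system ε W).2 1 0)) :
    FourierSeries.conj (solveLastEntry (𝔤.system ε W)) = solveLastEntry (𝔤.system ε W) := by
  have hc : ∀ i j, FourierSeries.conj ((𝔤.system ε W).2 i j) = (𝔤.system ε W).2 j i :=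
    𝔤.conj_leviForm_lowerHess h ε hW
  have h1 : FourierSeries.conj (𝔤.system ε W).1 = (𝔤.system ε W).1 := by
    change FourierSeries.conj (𝔤.volumeSeries R ε) = 𝔤.volumeSeries R ε
    rw [volumeSeries, map_mul, FourierSeries.conj_conj, mul_comm]
  have h2 : FourierSeries.conj (Matrix.of (𝔤.system ε W).2).det =
      (Matrix.of (𝔤.system ε W).2).det := by
    rw [RingHom.map_det, ← Matrix.det_transpose]
    congr 1
    ext i j
    simp [hc]
  have h3 := Ring.mul_inverse_cancel _ hu
  have h4 : ((𝔤.system ε W).2 0 0 * (𝔤.system ε W).2 1 1 -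
      (𝔤.system ε W).2 0 1 * (𝔤.system ε W).2 1 0) * FourierSeries.conj (Ring.inverse
        ((𝔤.system ε W).2 0 0 * (𝔤.system ε W).2 1 1 -
      (𝔤.system ε W).2 0 1 * (𝔤.system ε W).2 1 0)) = 1 := by
    have := congrArg FourierSeries.conj h3
    rw [map_mul, map_one, map_sub, map_mul, map_mul, hc, hc, hc, hc,
      mul_comm ((𝔤.system ε W).2 1 0)] at this
    exact this
  rw [solveLastEntry, map_mul, map_sub, h1, h2, hu.mul_left_cancel (h4.trans h3.symm)]

/-- Existence of a solution of the Monge–Ampère equation in rescaled coordinates. -/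
theorem exists_solution (h : 𝔤.Converges R) : ∃ ε : ℝ, 0 < ε ∧ ε ≤ 1 ∧ ∃ W : FourierSeries R,
    FourierSeries.conj W = W ∧ (leviForm (𝔤.fullHess ε W)).det = 𝔤.volumeSeries R ε := by
  have hu := 𝔤.isUnit_minor h
  obtain ⟨K, t, ht, hG⟩ := (contDiffAt_solveLastEntry hu).exists_lipschitzOnWith
  let δ : FourierSeries R × (Fin 3 → Fin 3 → FourierSeries R) → FourierSeries R :=
    fun v => v.2 0 0 * v.2 1 1 - v.2 0 1 * v.2 1 0
  have hδ : Continuous δ := by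
    have hc : ∀ i j, Continuous fun v : FourierSeries R × (Fin 3 → Fin 3 → FourierSeries R) =>
      v.2 i j := fun i j => by fun_prop
    exact ((hc 0 0).mul (hc 1 1)).sub ((hc 0 1).mul (hc 1 0))
  have hU : {v | IsUnit (δ v)} ∈ nhds (𝔤.system 0 (0 : FourierSeries R)) :=
    (Units.isOpen.preimage hδ).mem_nhds hu
  have hS : IsClosed {W : FourierSeries R | FourierSeries.conj W = W} :=
    isClosed_eq FourierSeries.continuous_conj continuous_id
  have key := eventually_exists_fixedPoint ht hU hG (V := 𝔤.system) (C := 4) (by norm_num)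
    (fun ε h0 h1 W W' => 𝔤.norm_system_sub_le h0 h1 W W') (𝔤.tendsto_system h) hS
    (by simp) (fun ε _ _ W hW hV => 𝔤.conj_solve_system h ε hW hV)
  obtain ⟨ε, ⟨W, hW, hV, hfix⟩, h0, h1⟩ := (key.and (Ioc_mem_nhdsGT one_pos)).exists
  have hV : IsUnit (leviForm (𝔤.lowerHess ε W) 0 0 * leviForm (𝔤.lowerHess ε W) 1 1 -
      leviForm (𝔤.lowerHess ε W) 0 1 * leviForm (𝔤.lowerHess ε W) 1 0) := hV
  refine ⟨ε, h0, h1, W, hW, ?_⟩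
  -- The determinant is affine in the last entry, so the fixed point equation times the minor is the
  -- Monge–Ampère equation.
  rw [det_eq_of_eq_off_two_two (𝔤.leviForm_fullHess ε W)]
  have h2 : (𝔤.volumeSeries R ε - (leviForm (𝔤.lowerHess ε W)).det) * Ring.inverse
      (leviForm (𝔤.lowerHess ε W) 0 0 * leviForm (𝔤.lowerHess ε W) 1 1 -
        leviForm (𝔤.lowerHess ε W) 0 1 * leviForm (𝔤.lowerHess ε W) 1 0) = W := hfix
  have h3 := congrArg (· * (leviForm (𝔤.lowerHess ε W) 0 0 * leviForm (𝔤.lowerHess ε W) 1 1 -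
        leviForm (𝔤.lowerHess ε W) 0 1 * leviForm (𝔤.lowerHess ε W) 1 0)) h2
  rw [mul_assoc, Ring.inverse_mul_cancel _ hV, mul_one] at h3
  rw [← h3]
  ring

end PeriodicMetric

end

noncomputable section

/-! ### Gradients of functions on `ℂ³` -/

/-- The real coordinates of `ℂ³`. -/
def realCoord : Direction → (EuclideanSpace ℂ (Fin 3) →L[ℝ] ℝ)
  | .inl j => Complex.reCLM.comp
      ((EuclideanSpace.proj j : EuclideanSpace ℂ (Fin 3) →L[ℂ] ℂ).restrictScalars ℝ)
  | .inr j => Complex.imCLM.comp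
      ((EuclideanSpace.proj j : EuclideanSpace ℂ (Fin 3) →L[ℂ] ℂ).restrictScalars ℝ)

theorem realCoord_inl (j : Fin 3) (z : EuclideanSpace ℂ (Fin 3)) :
    realCoord (.inl j) z = (z j).re := rfl

theorem realCoord_inr (j : Fin 3) (z : EuclideanSpace ℂ (Fin 3)) :
    realCoord (.inr j) z = (z j).im := rfl

/-- The function `F` has at `z` the partial derivatives `A d`. -/
def HasGrad (F : EuclideanSpace ℂ (Fin 3) → ℝ) (A : Direction → ℝ)
    (z : EuclideanSpace ℂ (Fin 3)) : Prop :=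
  HasFDerivAt F (∑ d, A d • realCoord d) z

namespace HasGrad

variable {F F' : EuclideanSpace ℂ (Fin 3) → ℝ} {A A' : Direction → ℝ}
  {z : EuclideanSpace ℂ (Fin 3)}

theorem congr_grad (h : HasGrad F A z) (hA : ∀ d, A d = A' d) : HasGrad F A' z := by
  rwa [← funext hA]

theorem add (h : HasGrad F A z) (h' : HasGrad F' A' z) :
    HasGrad (fun z => F z + F' z) (fun d => A d + A' d) z := by
  have := HasFDerivAt.add h h'
  simp only [HasGrad, add_smul, Finset.sum_add_distrib]
  exact this

theorem const_mul (h : HasGrad F A z) (c : ℝ) :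
    HasGrad (fun z => c * F z) (fun d => c * A d) z := by
  have := HasFDerivAt.const_mul h c
  simp only [HasGrad, mul_smul, ← Finset.smul_sum]
  exact this

theorem mul (h : HasGrad F A z) (h' : HasGrad F' A' z) :
    HasGrad (fun z => F z * F' z) (fun d => F z * A' d + F' z * A d) z := by
  have := HasFDerivAt.mul h h'
  simp only [HasGrad, add_smul, Finset.sum_add_distrib, mul_smul, ← Finset.smul_sum]
  exact this

theorem sum {ι : Type*} {s : Finset ι} {F : ι → EuclideanSpace ℂ (Fin 3) → ℝ}
    {A : ι → Direction → ℝ} (h : ∀ i ∈ s, HasGrad (F i) (A i) z) :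
    HasGrad (fun z => ∑ i ∈ s, F i z) (fun d => ∑ i ∈ s, A i d) z := by
  have := HasFDerivAt.fun_sum h
  simp only [HasGrad, Finset.sum_smul]
  rwa [Finset.sum_comm]

theorem coord (d : Direction) (z : EuclideanSpace ℂ (Fin 3)) :
    HasGrad (realCoord d) (Pi.single d 1) z := by
  have h : (∑ e, (Pi.single d 1 : Direction → ℝ) e • realCoord e) = realCoord d := by
    rw [Finset.sum_eq_single d (fun e _ he => by simp [he]) (by simp)]
    simp
  rw [HasGrad, h]
  exact (realCoord d).hasFDerivAt

end HasGrad

/-- The real part of a point of `ℂ³`. -/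
def realProj : EuclideanSpace ℂ (Fin 3) →L[ℝ] (Fin 3 → ℝ) :=
  ContinuousLinearMap.pi fun j => realCoord (.inl j)

theorem IsAnalyticPeriodic.hasGrad {f : (Fin 3 → ℝ) → ℝ} (hf : IsAnalyticPeriodic f)
    (z : EuclideanSpace ℂ (Fin 3)) : HasGrad (fun z => f (realProj z))
      (Sum.elim (fun i => _root_.partialDeriv i f (realProj z)) 0) z := by
  have h := ((hf.contDiff.differentiable (by simp)) (realProj z)).hasFDerivAt.comp z
    realProj.hasFDerivAt
  refine h.congr_fderiv (ContinuousLinearMap.ext fun v => ?_)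
  rw [ContinuousLinearMap.comp_apply, sum_apply, Fintype.sum_sum_type]
  have e : realProj v = ∑ i, (v i).re • (Pi.single i 1 : Fin 3 → ℝ) := by
    funext j
    simp [Finset.sum_apply, Pi.single_apply]
    rfl
  rw [e, map_sum]
  simp [_root_.partialDeriv, realCoord_inl, mul_comm]

/-- The rescaled real coordinates. -/
def toFourierPoint (ε : ℝ) : EuclideanSpace ℂ (Fin 3) →L[ℝ] FourierPoint :=
  realProj.prod (ContinuousLinearMap.pi fun j => (fiberScale ε j)⁻¹ • realCoord (.inr j))

theorem FourierSeries.hasGrad_eval_integral {R : {R : ℝ // 0 < R}} (u : FourierSeries R) (ε : ℝ)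
    {z : EuclideanSpace ℂ (Fin 3)} (hz : toFourierPoint ε z ∈ fourierDomain R) :
    HasGrad (fun z => (FourierSeries.eval (FourierSeries.integral u) (toFourierPoint ε z)).re)
      (fun d => (ε ^ dirWeight d)⁻¹ *
        (FourierSeries.eval (FourierSeries.derivIntegral d u) (toFourierPoint ε z)).re) z := by
  have h := Complex.reCLM.hasFDerivAt.comp z
    ((FourierSeries.hasFDerivAt_eval_integral u hz).comp z (toFourierPoint ε).hasFDerivAt)
  refine h.congr_fderiv (ContinuousLinearMap.ext fun v => ?_)
  rw [ContinuousLinearMap.comp_apply, ContinuousLinearMap.comp_apply, gradForm_apply, sum_apply,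
    Fintype.sum_sum_type]
  simp only [Complex.reCLM_apply, Complex.add_re, Complex.re_sum, Complex.re_ofReal_mul, smul_apply,
    smul_eq_mul]
  congr 1
  · refine Finset.sum_congr rfl fun j _ => ?_
    change (v j).re * _ = _ * (v j).re
    simp [dirWeight]
    ring
  · refine Finset.sum_congr rfl fun j _ => ?_
    change (fiberScale ε j)⁻¹ * (v j).im * _ = _ * (v j).im
    simp [fiberScale]
    ring

namespace PeriodicMetric

variable (𝔤 : PeriodicMetric) {R : {R : ℝ // 0 < R}}

/-- The first derivatives of the Kähler potential
`½ ∑ g_{ab} y_a y_b + ε⁴ Re (S² W)`, where `S` is the integration in the last variable. -/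
def potentialGrad (ε : ℝ) (W : FourierSeries R) (d : Direction) (z : EuclideanSpace ℂ (Fin 3)) : ℝ :=
  (match d with
    | .inl i => 1 / 2 * ∑ a, ∑ b, partialDeriv i (𝔤.g a b) (realProj z) *
        (realCoord (.inr a) z * realCoord (.inr b) z)
    | .inr j => ∑ a, 𝔤.g a j (realProj z) * realCoord (.inr a) z) +
    ε ^ (4 - dirWeight d) * (FourierSeries.eval (FourierSeries.integral
      (FourierSeries.derivIntegral d W)) (toFourierPoint ε z)).re

/-- The second derivatives of the potential. -/
def potentialHess (ε : ℝ) (W : FourierSeries R) (d d' : Direction)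
    (z : EuclideanSpace ℂ (Fin 3)) : ℝ :=
  (FourierSeries.eval (𝔤.fullHess ε W d d') (toFourierPoint ε z)).re

theorem dirWeight_le (d : Direction) : dirWeight d ≤ 2 := by
  rcases d with j | j
  · simp [dirWeight]
  · by_cases hj : j = 2 <;> simp [dirWeight, hj]

/-- The quadratic part is differentiated by the product rule, using the symmetry of g; the
correction by the chain rule for the rescaling. -/
theorem hasGrad_potentialGrad (h : 𝔤.Converges R) {ε : ℝ} (hε : ε ≠ 0) (W : FourierSeries R)
    {z : EuclideanSpace ℂ (Fin 3)} (hz : toFourierPoint ε z ∈ fourierDomain R) (d : Direction) :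
    HasGrad (𝔤.potentialGrad ε W d) (fun d' => 𝔤.potentialHess ε W d d' z) z := by
  have h2 := (FourierSeries.hasGrad_eval_integral (FourierSeries.derivIntegral d W) ε hz).const_mul
    (ε ^ (4 - dirWeight d))
  -- Each derivative in an original coordinate costs ε^(−weight). Two weights sum to at most 4, so
  -- the natural subtraction in the exponent is never truncated.
  have hc : ∀ d', ε ^ (4 - dirWeight d) * ((ε ^ dirWeight d')⁻¹ * (FourierSeries.eval
      (FourierSeries.derivIntegral d' (FourierSeries.derivIntegral d W))
        (toFourierPoint ε z)).re) = (FourierSeries.eval (((ε ^ (4 - (dirWeight d + dirWeight d')) : ℝ) : ℂ) •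
    FourierSeries.derivIntegral d (FourierSeries.derivIntegral d' W)) (toFourierPoint ε z)).re := by
    intro d'
    rw [FourierSeries.eval_smul hz, Complex.re_ofReal_mul, FourierSeries.derivIntegral_comm,
      ← mul_assoc, ← pow_sub₀ _ hε, Nat.sub_sub]
    have := dirWeight_le d
    have := dirWeight_le d'
    omega
  have hf : ∀ a, (FourierSeries.eval (fiberCoord R ε a) (toFourierPoint ε z)) =
      ((realCoord (.inr a) z : ℝ) : ℂ) := fun a => by
    rw [fiberCoord, FourierSeries.eval_smul hz, FourierSeries.eval_coord hz, ← Complex.ofReal_mul]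
    congr 1
    change fiberScale ε a * ((fiberScale ε a)⁻¹ * realCoord (.inr a) z) = _
    rw [mul_inv_cancel_left₀]
    exact pow_ne_zero _ hε
  rcases d with i | j
  · have h1 := (HasGrad.sum (s := Finset.univ) fun a _ => HasGrad.sum (s := Finset.univ) fun b _ =>
      (((𝔤.analytic a b).partialDeriv i).hasGrad z).mul
        ((HasGrad.coord (.inr a) z).mul (HasGrad.coord (.inr b) z)))
    refine ((h1.const_mul (1 / 2)).add h2).congr_grad fun d' => ?_
    rw [potentialHess, fullHess, FourierSeries.eval_add hz, Complex.add_re, hc]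
    congr 1
    rcases d' with l | l
    · simp only [Sum.elim_inl, ne_eq, reduceCtorEq, not_false_eq_true, Pi.single_eq_of_ne, mul_zero,
        add_zero, zero_add, baseHess, FourierSeries.eval_smul hz, FourierSeries.eval_sum hz,
        FourierSeries.eval_mul hz, hf]
      rw [show ((1 / 2 : ℂ)) = ((1 / 2 : ℝ) : ℂ) by push_cast; rfl, Complex.re_ofReal_mul]
      congr 1
      rw [Complex.re_sum]
      refine Finset.sum_congr rfl fun a _ => ?_
      rw [Complex.re_sum]
      refine Finset.sum_congr rfl fun b _ => ?_
      rw [IsAnalyticPeriodic.eval_series (h.deriv_deriv _ _ _ _).of_two_mul hz,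
        partialDeriv_comm (𝔤.analytic a b) l i, ← Complex.ofReal_mul, ← Complex.ofReal_mul,
        Complex.ofReal_re, mul_comm]
      rfl
    · simp only [Sum.elim_inr, Pi.zero_apply, mul_zero, add_zero, baseHess,
        FourierSeries.eval_sum hz, FourierSeries.eval_mul hz, hf]
      rw [Complex.re_sum]
      simp only [IsAnalyticPeriodic.eval_series (h.deriv _ _ _).of_two_mul hz, ← Complex.ofReal_mul,
        Complex.ofReal_re]
      change _ = ∑ x, partialDeriv i (𝔤.g x l) (realProj z) * _
      have s01 := 𝔤.symm 0 1
      have s02 := 𝔤.symm 0 2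
      have s12 := 𝔤.symm 1 2
      fin_cases l <;> simp [Fin.sum_univ_three, Pi.single_apply] <;> simp only [s01, s02, s12] <;> ring
  · have h1 := (HasGrad.sum (s := Finset.univ) fun a _ =>
      ((𝔤.analytic a j).hasGrad z).mul (HasGrad.coord (.inr a) z))
    refine (h1.add h2).congr_grad fun d' => ?_
    rw [potentialHess, fullHess, FourierSeries.eval_add hz, Complex.add_re, hc]
    congr 1
    rcases d' with l | l
    · simp only [Sum.elim_inl, ne_eq, reduceCtorEq, not_false_eq_true, Pi.single_eq_of_ne, mul_zero,
        zero_add, baseHess, FourierSeries.eval_sum hz, FourierSeries.eval_mul hz, hf]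
      rw [Complex.re_sum]
      refine Finset.sum_congr rfl fun a _ => ?_
      rw [IsAnalyticPeriodic.eval_series (h.deriv _ _ _).of_two_mul hz, ← Complex.ofReal_mul,
        Complex.ofReal_re, mul_comm]
      rfl
    · simp only [Sum.elim_inr, Pi.zero_apply, mul_zero, add_zero, baseHess]
      rw [IsAnalyticPeriodic.eval_series (h.metric _ _).of_two_mul hz, Complex.ofReal_re, 𝔤.symm j l]
      change _ = 𝔤.g l j (realProj z)
      fin_cases l <;> simp [Pi.single_apply]

end PeriodicMetric

end

noncomputable section

/-! ### The Kähler form of a real Hessian -/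

/-- The bilinear form with given coefficients. -/
def hessBilin (Q : Direction → Direction → ℝ) (u v : EuclideanSpace ℂ (Fin 3)) : ℝ :=
  ∑ d, ∑ d', Q d d' * (realCoord d u * realCoord d' v)

/-- The two-form `Q(iu, v) - Q(u, iv)`. -/
def kahlerBilin (Q : Direction → Direction → ℝ) (u v : EuclideanSpace ℂ (Fin 3)) : ℝ :=
  hessBilin Q (Complex.I • u) v - hessBilin Q u (Complex.I • v)

theorem hessBilin_eq (Q : Direction → Direction → ℝ) (u v : EuclideanSpace ℂ (Fin 3)) :
    hessBilin Q u v = ∑ i, ∑ j, (Q (.inl i) (.inl j) * ((u i).re * (v j).re) +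
      Q (.inl i) (.inr j) * ((u i).re * (v j).im) + (Q (.inr i) (.inl j) * ((u i).im * (v j).re) +
      Q (.inr i) (.inr j) * ((u i).im * (v j).im))) := by
  simp only [hessBilin, Fintype.sum_sum_type, Finset.sum_add_distrib, realCoord_inl, realCoord_inr]
  ring

/-- The complex Hessian of a real one. -/
abbrev complexHess (Q : Direction → Direction → ℝ) : Matrix (Fin 3) (Fin 3) ℂ :=
  leviForm fun d d' => (Q d d' : ℂ)

theorem kahlerBilin_eq_sum (Q : Direction → Direction → ℝ) (u v : EuclideanSpace ℂ (Fin 3)) :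
    kahlerBilin Q u v =
      ∑ i, ∑ j, (Complex.I * complexHess Q i j * u i * starRingEnd ℂ (v j)).re := by
  rw [kahlerBilin, hessBilin_eq, hessBilin_eq, ← Finset.sum_sub_distrib]
  refine Finset.sum_congr rfl fun i _ => ?_
  rw [← Finset.sum_sub_distrib]
  refine Finset.sum_congr rfl fun j _ => ?_
  simp [leviForm, Complex.mul_re, Complex.mul_im]
  ring

theorem complexHess_conj {Q : Direction → Direction → ℝ} (hQ : ∀ d d', Q d d' = Q d' d)
    (i j : Fin 3) : starRingEnd ℂ (complexHess Q i j) = complexHess Q j i := by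
  simp only [leviForm, Matrix.of_apply, map_add, map_sub, smul_eq_mul, map_mul, Complex.conj_I,
    Complex.conj_ofReal]
  rw [hQ (.inl i) (.inl j), hQ (.inr i) (.inr j), hQ (.inl i) (.inr j), hQ (.inr i) (.inl j)]
  ring

/-- The complex Hessian is Hermitian, so the real part splits into two conjugate sums. The result
exhibits the form as ∑ dz_i ∧ θ_i with θ_i = (i/2) ∑ h_ij dz̄_j, the shape needed for its cube. -/
theorem ofReal_kahlerBilin {Q : Direction → Direction → ℝ} (hQ : ∀ d d', Q d d' = Q d' d)
    (u v : EuclideanSpace ℂ (Fin 3)) : (kahlerBilin Q u v : ℂ) =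
      ∑ i, (u i * ∑ j, Complex.I / 2 * complexHess Q i j * starRingEnd ℂ (v j) -
        v i * ∑ j, Complex.I / 2 * complexHess Q i j * starRingEnd ℂ (u j)) := by
  rw [kahlerBilin_eq_sum]
  simp only [Complex.ofReal_sum, Complex.re_eq_add_conj, map_mul, complexHess_conj hQ,
    Complex.conj_I, Complex.conj_conj, Finset.sum_sub_distrib, add_div, Finset.sum_add_distrib]
  rw [sub_eq_add_neg]
  congr 1
  · refine Finset.sum_congr rfl fun i _ => ?_
    rw [Finset.mul_sum]
    exact Finset.sum_congr rfl fun j _ => by ring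
  · rw [Finset.sum_comm, ← Finset.sum_neg_distrib]
    refine Finset.sum_congr rfl fun i _ => ?_
    rw [Finset.mul_sum, ← Finset.sum_neg_distrib]
    exact Finset.sum_congr rfl fun j _ => by ring

theorem hessBilin_smul_I_smul_I (Q : Direction → Direction → ℝ) (u v : EuclideanSpace ℂ (Fin 3)) :
    hessBilin Q (Complex.I • Complex.I • u) v = -hessBilin Q u v := by
  rw [smul_smul, Complex.I_mul_I, neg_one_smul]
  simp only [hessBilin, map_neg, neg_mul, mul_neg, Finset.sum_neg_distrib]

theorem hessBilin_smul_I_smul_I_right (Q : Direction → Direction → ℝ)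
    (u v : EuclideanSpace ℂ (Fin 3)) :
    hessBilin Q u (Complex.I • Complex.I • v) = -hessBilin Q u v := by
  rw [smul_smul, Complex.I_mul_I, neg_one_smul]
  simp only [hessBilin, map_neg, mul_neg, Finset.sum_neg_distrib]

theorem kahlerBilin_smul_I (Q : Direction → Direction → ℝ) (u v : EuclideanSpace ℂ (Fin 3)) :
    kahlerBilin Q (Complex.I • u) (Complex.I • v) = kahlerBilin Q u v := by
  rw [kahlerBilin, kahlerBilin, hessBilin_smul_I_smul_I, hessBilin_smul_I_smul_I_right]
  ring

theorem kahlerBilin_smul_I_right (Q : Direction → Direction → ℝ)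
    (u v : EuclideanSpace ℂ (Fin 3)) : kahlerBilin Q u (Complex.I • v) =
      hessBilin Q (Complex.I • u) (Complex.I • v) + hessBilin Q u v := by
  rw [kahlerBilin, hessBilin_smul_I_smul_I_right, sub_neg_eq_add]

theorem hessBilin_real_smul (Q : Direction → Direction → ℝ) (t : ℝ)
    (u : EuclideanSpace ℂ (Fin 3)) : hessBilin Q (t • u) (t • u) = t ^ 2 * hessBilin Q u u := by
  simp only [hessBilin, map_smul, smul_eq_mul, Finset.mul_sum]
  exact Finset.sum_congr rfl fun d _ => Finset.sum_congr rfl fun d' _ => by ring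

/-- The metric of a real Hessian is homogeneous of degree two. -/
theorem kahlerBilin_real_smul (Q : Direction → Direction → ℝ) (t : ℝ)
    (u : EuclideanSpace ℂ (Fin 3)) : kahlerBilin Q (t • u) (Complex.I • t • u) =
      t ^ 2 * kahlerBilin Q u (Complex.I • u) := by
  rw [kahlerBilin_smul_I_right, kahlerBilin_smul_I_right, smul_comm Complex.I t,
    hessBilin_real_smul, hessBilin_real_smul]
  ring

/-- A null vector v of the complex Hessian would give κ(v, iv) = 0. -/
theorem complexHess_det_ne_zero {Q : Direction → Direction → ℝ}
    (hpos : ∀ u, u ≠ 0 → 0 < kahlerBilin Q u (Complex.I • u)) : (complexHess Q).det ≠ 0 := by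
  intro h
  obtain ⟨v, hv0, hv⟩ := Matrix.exists_vecMul_eq_zero_iff.2 h
  have h1 := hpos (WithLp.toLp 2 v) fun h0 => hv0 (by simpa using h0)
  rw [kahlerBilin_eq_sum, Finset.sum_comm] at h1
  refine h1.ne' (Finset.sum_eq_zero fun j _ => ?_)
  have h2 : ∑ i, v i * complexHess Q i j = 0 := congrFun hv j
  have h3 : ∑ i, (Complex.I * complexHess Q i j * v i *
      starRingEnd ℂ (Complex.I * v j)) = (∑ i, v i * complexHess Q i j) *
      (Complex.I * starRingEnd ℂ (Complex.I * v j)) := by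
    rw [Finset.sum_mul]
    exact Finset.sum_congr rfl fun i _ => by ring
  rw [h2, zero_mul] at h3
  rw [← Complex.re_sum]
  exact congrArg Complex.re h3

/-! ### Existence of the Kähler potential -/

theorem complexPoint_re_im (z : EuclideanSpace ℂ (Fin 3)) :
    complexPoint (fun j => (z j).re) (fun j => (z j).im) = z := by
  ext j
  exact Complex.re_add_im (z j)

/-- The Hessian of a Kähler potential which solves the Monge–Ampère equation on a strip with
Cauchy data given by the metric `𝔤`. -/
structure CalabiYauHessian (𝔤 : PeriodicMetric) where
  radius : ℝ
  radius_pos : 0 < radius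
  grad : Direction → EuclideanSpace ℂ (Fin 3) → ℝ
  hess : Direction → Direction → EuclideanSpace ℂ (Fin 3) → ℝ
  hasGrad : ∀ z ∈ complexStrip radius, ∀ d, HasGrad (grad d) (fun d' => hess d d' z) z
  contDiffOn : ∀ d d', ContDiffOn ℝ ∞ (hess d d') (complexStrip radius)
  symm : ∀ d d', hess d d' = hess d' d
  periodic : ∀ z ∈ complexStrip radius, ∀ m : EuclideanSpace ℂ (Fin 3), (∀ j, ∃ n : ℤ, m j = n) →
    ∀ d d', hess d d' (z + m) = hess d d' z
  positive : ∀ z ∈ complexStrip radius, ∀ u, u ≠ 0 →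
    0 < kahlerBilin (fun d d' => hess d d' z) u (Complex.I • u)
  density : EuclideanSpace ℂ (Fin 3) → ℂ
  differentiableOn : DifferentiableOn ℂ density (complexStrip radius)
  density_periodic : ∀ z, ∀ m : EuclideanSpace ℂ (Fin 3), (∀ j, ∃ n : ℤ, m j = n) →
    density (z + m) = density z
  det_eq : ∀ z ∈ complexStrip radius, (complexHess fun d d' => hess d d' z).det =
    density z * starRingEnd ℂ (density z)
  density_real : ∀ x, density (complexPoint x 0) = (√(𝔤.det x) : ℝ)
  hess_real : ∀ x i j, hess (.inr i) (.inr j) (complexPoint x 0) = 𝔤.g i j x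
  hess_real_left : ∀ x i d, hess (.inl i) d (complexPoint x 0) = 0

theorem fourierMonomial_add_int (x s : Fin 3 → ℝ) (n : Fin 3 → ℤ) (i : FourierIndex) :
    fourierMonomial (x + fun j => (n j : ℝ), s) i = fourierMonomial (x, s) i := by
  rw [fourierMonomial, fourierMonomial]
  congr 1
  rw [Complex.exp_eq_exp_iff_exists_int]
  refine ⟨∑ j, i.1 j * n j, ?_⟩
  simp only [Pi.add_apply, Complex.ofReal_add, mul_add, Finset.sum_add_distrib]
  push_cast
  ring

theorem FourierSeries.eval_add_int {R : {R : ℝ // 0 < R}} (u : FourierSeries R) {x s : Fin 3 → ℝ}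
    (h : (x, s) ∈ fourierDomain R) (n : Fin 3 → ℤ) :
    FourierSeries.eval u (x + fun j => (n j : ℝ), s) = FourierSeries.eval u (x, s) := by
  have h' : (x + fun j => (n j : ℝ), s) ∈ fourierDomain R := h
  induction u using UniformSpace.Completion.induction_on with
  | hp => exact isClosed_eq (FourierSeries.continuous_eval _) (FourierSeries.continuous_eval _)
  | ih a =>
    rw [FourierSeries.eval_coe h, FourierSeries.eval_coe h', WeightedAlgebra.sum_single a,
      Finsupp.sum, map_sum, map_sum]
    simp only [FourierPoly.evalPoly_single, fourierMonomial_add_int]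

/-! ### From the series solution to a Kähler potential on a strip. -/

namespace PeriodicMetric

variable (𝔤 : PeriodicMetric) {R : {R : ℝ // 0 < R}}

theorem fullHess_symm (ε : ℝ) (W : FourierSeries R) (d d' : Direction) :
    𝔤.fullHess ε W d d' = 𝔤.fullHess ε W d' d := by
  rw [fullHess, fullHess, baseHess_symm, FourierSeries.derivIntegral_comm, add_comm (dirWeight d)]

theorem conj_fullHess (h : 𝔤.Converges R) (ε : ℝ) {W : FourierSeries R}
    (hW : FourierSeries.conj W = W) (d d' : Direction) :
    FourierSeries.conj (𝔤.fullHess ε W d d') = 𝔤.fullHess ε W d d' := by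
  rw [fullHess, map_add, 𝔤.conj_baseHess h, FourierSeries.conj_smul, Complex.conj_ofReal,
    FourierSeries.conj_derivIntegral, FourierSeries.conj_derivIntegral, hW]

/-- ε² is the smallest of the scales, so this width suffices in all three directions. -/
theorem toFourierPoint_mem {ε : ℝ} (h0 : 0 < ε) (h1 : ε ≤ 1) {z : EuclideanSpace ℂ (Fin 3)}
    (hz : z ∈ complexStrip (ε ^ 2 * (R / 4))) : toFourierPoint ε z ∈ fourierDomain R := by
  intro j
  change |(fiberScale ε j)⁻¹ * (z j).im| < R / 4
  have hs : 0 < fiberScale ε j := pow_pos h0 _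
  have h2 : ε ^ 2 ≤ fiberScale ε j := pow_le_pow_of_le_one h0.le h1 (dirWeight_le _)
  rw [abs_mul, abs_of_pos (inv_pos.2 hs), inv_mul_lt_iff₀ hs]
  have := R.2
  exact (hz j).trans_le (by gcongr)

theorem ofReal_potentialHess (h : 𝔤.Converges R) {ε : ℝ} {W : FourierSeries R}
    (hW : FourierSeries.conj W = W) {z : EuclideanSpace ℂ (Fin 3)}
    (hz : toFourierPoint ε z ∈ fourierDomain R) (d d' : Direction) :
    (𝔤.potentialHess ε W d d' z : ℂ) =
      FourierSeries.eval (𝔤.fullHess ε W d d') (toFourierPoint ε z) := by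
  rw [potentialHess]
  have h1 := FourierSeries.eval_conj hz (𝔤.fullHess ε W d d')
  rw [𝔤.conj_fullHess h ε hW] at h1
  exact Complex.conj_eq_iff_re.1 h1.symm

theorem complexHess_potentialHess (h : 𝔤.Converges R) {ε : ℝ} {W : FourierSeries R}
    (hW : FourierSeries.conj W = W) {z : EuclideanSpace ℂ (Fin 3)}
    (hz : toFourierPoint ε z ∈ fourierDomain R) :
    complexHess (fun d d' => 𝔤.potentialHess ε W d d' z) =
      (FourierSeries.evalHom hz).mapMatrix (leviForm (𝔤.fullHess ε W)) := by
  ext i j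
  simp only [leviForm, Matrix.of_apply, RingHom.mapMatrix_apply, Matrix.map_apply, map_add,
    𝔤.ofReal_potentialHess h hW hz]
  rw [FourierSeries.evalHom_apply, FourierSeries.evalHom_apply, FourierSeries.evalHom_apply,
    FourierSeries.eval_smul hz, FourierSeries.eval_sub hz, smul_eq_mul]

theorem complexPoint_toFourierPoint {ε : ℝ} (h0 : 0 < ε) (z : EuclideanSpace ℂ (Fin 3)) :
    complexPoint (toFourierPoint ε z).1 (fun j => fiberScale ε j * (toFourierPoint ε z).2 j) = z := by
  refine Eq.trans ?_ (complexPoint_re_im z)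
  have : (fun j => fiberScale ε j * (toFourierPoint ε z).2 j) = fun j => (z j).im := by
    funext j
    change fiberScale ε j * ((fiberScale ε j)⁻¹ * (z j).im) = _
    exact mul_inv_cancel_left₀ (pow_pos h0 _).ne' _
  rw [this]
  rfl

theorem det_complexHess_potentialHess (h : 𝔤.Converges R) {ε : ℝ} (h0 : 0 < ε) (h1 : ε ≤ 1)
    {W : FourierSeries R} (hW : FourierSeries.conj W = W)
    (hdet : (leviForm (𝔤.fullHess ε W)).det = 𝔤.volumeSeries R ε) {z : EuclideanSpace ℂ (Fin 3)}
    (hz : toFourierPoint ε z ∈ fourierDomain R) :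
    (complexHess fun d d' => 𝔤.potentialHess ε W d d' z).det =
      𝔤.analytic_volume.extension z * starRingEnd ℂ (𝔤.analytic_volume.extension z) := by
  rw [𝔤.complexHess_potentialHess h hW hz, ← RingHom.map_det, hdet, volumeSeries, map_mul,
    FourierSeries.evalHom_apply, FourierSeries.evalHom_apply, FourierSeries.eval_conj hz,
    IsAnalyticPeriodic.eval_twist h.volume (abs_fiberScale_le h0.le h1) hz,
    complexPoint_toFourierPoint h0]

theorem eval_fullHess_real (h : 𝔤.Converges R) {ε : ℝ} (W : FourierSeries R) (x : Fin 3 → ℝ)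
    {d d' : Direction} (hd : ¬(d = .inr 2 ∧ d' = .inr 2)) :
    FourierSeries.eval (𝔤.fullHess ε W d d') (x, 0) =
      match d, d' with
      | .inr i, .inr j => (𝔤.g i j x : ℂ)
      | _, _ => 0 := by
  have hz : ((x, 0) : FourierPoint) ∈ fourierDomain R := fun j => by
    have := R.2
    simpa using this
  have hcor : FourierSeries.eval (FourierSeries.derivIntegral d
      (FourierSeries.derivIntegral d' W)) (x, 0) = 0 := by
    by_cases h2 : d = .inr 2
    · rw [FourierSeries.derivIntegral_comm]
      exact FourierSeries.eval_derivIntegral_eq_zero (fun h3 => hd ⟨h2, h3⟩) hz rfl _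
    · exact FourierSeries.eval_derivIntegral_eq_zero h2 hz rfl _
  rw [fullHess, FourierSeries.eval_add hz, FourierSeries.eval_smul hz, hcor, mul_zero, add_zero]
  have hf : ∀ a, FourierSeries.eval (fiberCoord R ε a) (x, 0) = 0 := fun a => by
    rw [fiberCoord, FourierSeries.eval_smul hz, FourierSeries.eval_coord hz]
    simp
  rcases d with i | i <;> rcases d' with j | j
  · simp [baseHess, FourierSeries.eval_smul hz, FourierSeries.eval_sum hz, FourierSeries.eval_mul hz,
      hf]
  · simp [baseHess, FourierSeries.eval_sum hz, FourierSeries.eval_mul hz, hf]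
  · simp [baseHess, FourierSeries.eval_sum hz, FourierSeries.eval_mul hz, hf]
  · exact IsAnalyticPeriodic.eval_series (h.metric i j).of_two_mul hz

theorem toFourierPoint_real (ε : ℝ) (x : Fin 3 → ℝ) :
    toFourierPoint ε (complexPoint x 0) = (x, 0) := by
  refine Prod.ext (funext fun j => ?_) (funext fun j => ?_)
  · change (complexPoint x 0 j).re = x j
    simp [complexPoint_apply]
  · change (fiberScale ε j)⁻¹ * (complexPoint x 0 j).im = 0
    simp [complexPoint_apply]

/-- All corrections except the one for (y₂, y₂) vanish on the torus because they are integrated from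
s₂ = 0. The remaining one is read off from the equation: the Hessian differs from g in one entry but
has the same determinant det g, and the minor is not zero. -/
theorem potentialHess_real (h : 𝔤.Converges R) {ε : ℝ} (h0 : 0 < ε) (h1 : ε ≤ 1)
    {W : FourierSeries R} (hW : FourierSeries.conj W = W)
    (hdet : (leviForm (𝔤.fullHess ε W)).det = 𝔤.volumeSeries R ε)
    (x : Fin 3 → ℝ) (d d' : Direction) : 𝔤.potentialHess ε W d d' (complexPoint x 0) =
      match d, d' with
      | .inr i, .inr j => 𝔤.g i j x
      | _, _ => 0 := by
  have hz : toFourierPoint ε (complexPoint x 0) ∈ fourierDomain R := fun j => by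
    rw [toFourierPoint_real]
    have := R.2
    simpa using this
  have hoff : ∀ d d', ¬(d = .inr 2 ∧ d' = .inr 2) →
      𝔤.potentialHess ε W d d' (complexPoint x 0) =
      match d, d' with
      | .inr i, .inr j => 𝔤.g i j x
      | _, _ => 0 := fun d d' hd => by
    rw [potentialHess, toFourierPoint_real, 𝔤.eval_fullHess_real h W x hd]
    rcases d with i | i <;> rcases d' with j | j <;> simp
  by_cases hd : d = .inr 2 ∧ d' = .inr 2
  · obtain ⟨rfl, rfl⟩ := hd
    set w : ℂ := ((𝔤.potentialHess ε W (.inr 2) (.inr 2) (complexPoint x 0) - 𝔤.g 2 2 x : ℝ) : ℂ)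
      with hw
    have hent : ∀ i j, complexHess (fun d d' => 𝔤.potentialHess ε W d d' (complexPoint x 0)) i j =
        (Matrix.of fun i j => (𝔤.g i j x : ℂ)) i j + if i = 2 ∧ j = 2 then w else 0 := by
      intro i j
      by_cases hij : i = 2 ∧ j = 2
      · obtain ⟨rfl, rfl⟩ := hij
        simp [leviForm, hoff, hw]
      · simp [leviForm, hoff, hij]
    have hD := det_eq_of_eq_off_two_two hent
    have hdet1 := 𝔤.det_complexHess_potentialHess h h0 h1 hW hdet hz
    rw [IsAnalyticPeriodic.extension_real h.volume.of_two_mul, Complex.conj_ofReal,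
      ← Complex.ofReal_mul, Real.mul_self_sqrt (𝔤.det_pos x).le] at hdet1
    have hdet2 : (Matrix.of fun i j => (𝔤.g i j x : ℂ)).det = (𝔤.det x : ℂ) := by
      rw [det, ← Complex.ofRealHom_eq_coe, RingHom.map_det]
      rfl
    rw [hdet1, hdet2, left_eq_add] at hD
    have hm : (Matrix.of fun i j => (𝔤.g i j x : ℂ)) 0 0 * (Matrix.of fun i j => (𝔤.g i j x : ℂ)) 1 1
        - (Matrix.of fun i j => (𝔤.g i j x : ℂ)) 0 1 * (Matrix.of fun i j => (𝔤.g i j x : ℂ)) 1 0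
        ≠ 0 := by
      have := (𝔤.minor_pos x).ne'
      rw [minor] at this
      simp only [Matrix.of_apply]
      exact_mod_cast this
    have hw0 := (mul_eq_zero.1 hD).resolve_right hm
    rw [hw, Complex.ofReal_eq_zero, sub_eq_zero] at hw0
    exact hw0
  · exact hoff d d' hd

theorem continuousOn_kahlerBilin {Q : Direction → Direction → EuclideanSpace ℂ (Fin 3) → ℝ}
    {s : Set (EuclideanSpace ℂ (Fin 3))} (hQ : ∀ d d', ContinuousOn (Q d d') s) :
    ContinuousOn (fun q : EuclideanSpace ℂ (Fin 3) × EuclideanSpace ℂ (Fin 3) =>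
      kahlerBilin (fun d d' => Q d d' q.1) q.2 (Complex.I • q.2)) (s ×ˢ Set.univ) := by
  have h1 : ∀ d d', ContinuousOn (fun q : EuclideanSpace ℂ (Fin 3) × EuclideanSpace ℂ (Fin 3) =>
      Q d d' q.1) (s ×ˢ Set.univ) := fun d d' =>
    (hQ d d').comp continuousOn_fst fun q hq => hq.1
  simp only [kahlerBilin_smul_I_right, hessBilin]
  refine ContinuousOn.add ?_ ?_ <;>
  · refine continuousOn_finsetSum _ fun d _ => continuousOn_finsetSum _ fun d' _ => (h1 d d').mul ?_
    fun_prop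

theorem continuous_complexPoint : Continuous fun q : (Fin 3 → ℝ) × (Fin 3 → ℝ) =>
    complexPoint q.1 q.2 := by
  unfold complexPoint
  refine (PiLp.continuous_toLp 2 _).comp ?_
  fun_prop

/-- On the torus κ(u, iu) = g(Re u, Re u) + g(Im u, Im u). -/
theorem kahlerBilin_real_pos {Q : Direction → Direction → ℝ} {x : Fin 3 → ℝ}
    (hQ : ∀ d d', Q d d' = match d, d' with
      | .inr i, .inr j => 𝔤.g i j x
      | _, _ => 0) {u : EuclideanSpace ℂ (Fin 3)} (hu : u ≠ 0) :
    0 < kahlerBilin Q u (Complex.I • u) := by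
  have hb : ∀ v, hessBilin Q v v = (fun j => (v j).im) ⬝ᵥ (Matrix.of fun i j => 𝔤.g i j x).mulVec
      (fun j => (v j).im) := fun v => by
    rw [hessBilin_eq]
    simp only [hQ, zero_mul, zero_add, dotProduct, Matrix.mulVec, Finset.mul_sum, Matrix.of_apply]
    exact Finset.sum_congr rfl fun i _ => Finset.sum_congr rfl fun j _ => by ring
  have hnn : ∀ w : Fin 3 → ℝ, 0 ≤ w ⬝ᵥ (Matrix.of fun i j => 𝔤.g i j x).mulVec w := fun w => by
    simpa using (𝔤.posDef x).posSemidef.dotProduct_mulVec_nonneg w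
  have hp : ∀ w : Fin 3 → ℝ, w ≠ 0 → 0 < w ⬝ᵥ (Matrix.of fun i j => 𝔤.g i j x).mulVec w :=
    fun w hw => by simpa using (𝔤.posDef x).dotProduct_mulVec_pos hw
  rw [kahlerBilin_smul_I_right, hb, hb]
  by_cases h : (fun j => (u j).im) = 0
  · refine add_pos_of_pos_of_nonneg (hp _ fun h' => hu ?_) (hnn _)
    ext j
    refine Complex.ext ?_ (congrFun h j)
    have := congrFun h' j
    simpa using this
  · exact add_pos_of_nonneg_of_pos (hnn _) (hp _ h)

/-- Positivity is open. By periodicity and homogeneity only x in the unit cube and u on the unit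
sphere matter, and the tube lemma over this compact set gives a uniform width. -/
theorem exists_positive {Q : Direction → Direction → EuclideanSpace ℂ (Fin 3) → ℝ} {r : ℝ}
    (hr : 0 < r) (hQ : ∀ d d', ContinuousOn (Q d d') (complexStrip r))
    (hper : ∀ z ∈ complexStrip r, ∀ m : EuclideanSpace ℂ (Fin 3), (∀ j, ∃ n : ℤ, m j = n) →
      ∀ d d', Q d d' (z + m) = Q d d' z)
    (hreal : ∀ x, ∀ u : EuclideanSpace ℂ (Fin 3), u ≠ 0 →
      0 < kahlerBilin (fun d d' => Q d d' (complexPoint x 0)) u (Complex.I • u)) :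
    ∃ ρ, 0 < ρ ∧ ρ ≤ r ∧ ∀ z ∈ complexStrip ρ, ∀ u, u ≠ 0 →
      0 < kahlerBilin (fun d d' => Q d d' z) u (Complex.I • u) := by
  have hopen := (continuousOn_kahlerBilin hQ).isOpen_inter_preimage
    ((isOpen_complexStrip r).prod isOpen_univ) (isOpen_Ioi (a := (0 : ℝ)))
  have hcont : Continuous fun q : ((Fin 3 → ℝ) × EuclideanSpace ℂ (Fin 3)) × (Fin 3 → ℝ) =>
      (complexPoint q.1.1 q.2, q.1.2) :=
    (continuous_complexPoint.comp (f := fun q : ((Fin 3 → ℝ) × EuclideanSpace ℂ (Fin 3)) ×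
      (Fin 3 → ℝ) => (q.1.1, q.2)) (by fun_prop)).prodMk (by fun_prop)
  obtain ⟨U, V, -, hV, hU, hV0, hUV⟩ := generalized_tube_lemma
    (s := Set.Icc (0 : Fin 3 → ℝ) 1 ×ˢ Metric.sphere (0 : EuclideanSpace ℂ (Fin 3)) 1)
    (isCompact_Icc.prod (isCompact_sphere _ _)) (t := {(0 : Fin 3 → ℝ)}) isCompact_singleton
    (hopen.preimage hcont) (by
      rintro ⟨⟨x, u⟩, y⟩ ⟨⟨-, hu⟩, rfl⟩
      refine ⟨⟨fun j => ?_, trivial⟩, hreal x u ?_⟩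
      · simpa [complexPoint_apply] using hr
      · rintro rfl
        simp at hu)
  obtain ⟨δ, hδ, hball⟩ := Metric.isOpen_iff.1 hV 0 (hV0 rfl)
  refine ⟨min δ r, lt_min hδ hr, min_le_right _ _, fun z hz u hu => ?_⟩
  obtain ⟨k, x, hx, hzx⟩ := IsAnalyticPeriodic.exists_mem_cube fun j => (z j).re
  have hy : (fun j => (z j).im) ∈ V := hball (by
    rw [mem_ball_zero_iff, pi_norm_lt_iff hδ]
    exact fun j => (hz j).trans_le (min_le_left _ _))
  have hu' : ‖u‖ ≠ 0 := norm_ne_zero_iff.2 hu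
  have hmem := hUV (Set.mk_mem_prod (hU (Set.mk_mem_prod hx
    (show ‖u‖⁻¹ • u ∈ Metric.sphere (0 : EuclideanSpace ℂ (Fin 3)) 1 by
      rw [mem_sphere_zero_iff_norm, norm_smul, norm_inv, norm_norm, inv_mul_cancel₀ hu']))) hy)
  have hz2 : z = complexPoint x (fun j => (z j).im) + WithLp.toLp 2 fun j => (k j : ℂ) := by
    conv_lhs => rw [← complexPoint_re_im z, hzx]
    ext j
    simp only [complexPoint_apply, PiLp.add_apply, Pi.add_apply]
    push_cast
    ring
  have hstrip : complexPoint x (fun j => (z j).im) ∈ complexStrip r := hmem.1.1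
  have hQz : ∀ d d', Q d d' z = Q d d' (complexPoint x fun j => (z j).im) := fun d d' => by
    conv_lhs => rw [hz2]
    exact hper _ hstrip _ (fun j => ⟨k j, rfl⟩) d d'
  simp only [hQz]
  have h3 : 0 < kahlerBilin (fun d d' => Q d d' (complexPoint x fun j => (z j).im)) (‖u‖⁻¹ • u)
    (Complex.I • ‖u‖⁻¹ • u) := hmem.2
  rw [kahlerBilin_real_smul] at h3
  exact (pos_iff_pos_of_mul_pos h3).1 (by positivity)

theorem exists_calabiYauHessian : Nonempty (CalabiYauHessian 𝔤) := by
  obtain ⟨R, h⟩ := 𝔤.exists_converges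
  obtain ⟨ε, h0, h1, W, hW, hdet⟩ := 𝔤.exists_solution h
  have hR := R.2
  set r : ℝ := ε ^ 2 * (R / 4) with hr
  have hr0 : 0 < r := by positivity
  have hrR : r ≤ R := by
    have : ε ^ 2 ≤ 1 := pow_le_one₀ h0.le h1
    nlinarith
  have hmem : ∀ z ∈ complexStrip r, toFourierPoint ε z ∈ fourierDomain R := fun z hz =>
    toFourierPoint_mem h0 h1 hz
  have hsmooth : ∀ d d', ContDiffOn ℝ ∞ (𝔤.potentialHess ε W d d') (complexStrip r) := fun d d' =>
    Complex.reCLM.contDiff.comp_contDiffOn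
      ((FourierSeries.contDiffOn_eval _).comp (toFourierPoint ε).contDiff.contDiffOn hmem)
  have hper : ∀ z ∈ complexStrip r, ∀ m : EuclideanSpace ℂ (Fin 3), (∀ j, ∃ n : ℤ, m j = n) →
      ∀ d d', 𝔤.potentialHess ε W d d' (z + m) = 𝔤.potentialHess ε W d d' z := by
    intro z hz m hm d d'
    choose n hn using hm
    have e : toFourierPoint ε (z + m) = ((toFourierPoint ε z).1 + fun j => (n j : ℝ),
        (toFourierPoint ε z).2) := by
      rw [map_add]
      refine Prod.ext (funext fun j => ?_) (funext fun j => ?_)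
      · change (toFourierPoint ε z).1 j + (m j).re = (toFourierPoint ε z).1 j + n j
        rw [hn]; simp
      · change (toFourierPoint ε z).2 j + (fiberScale ε j)⁻¹ * (m j).im = (toFourierPoint ε z).2 j
        rw [hn]; simp
    rw [potentialHess, e]
    exact congrArg Complex.re (FourierSeries.eval_add_int (x := (toFourierPoint ε z).1)
      (s := (toFourierPoint ε z).2) _ (hmem z hz) n)
  have hreal := fun x d d' => 𝔤.potentialHess_real h h0 h1 hW hdet x d d'
  obtain ⟨ρ, hρ, hρr, hpos⟩ := exists_positive hr0 (fun d d' => (hsmooth d d').continuousOn) hper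
    (fun x u hu => 𝔤.kahlerBilin_real_pos (hreal x) hu)
  have hsub : complexStrip ρ ⊆ complexStrip r := fun z hz j => (hz j).trans_le hρr
  have hsubR : complexStrip ρ ⊆ complexStrip R := fun z hz j => (hz j).trans_le (hρr.trans hrR)
  exact ⟨{
    radius := ρ
    radius_pos := hρ
    grad := 𝔤.potentialGrad ε W
    hess := 𝔤.potentialHess ε W
    hasGrad := fun z hz d => 𝔤.hasGrad_potentialGrad h h0.ne' W (hmem z (hsub hz)) d
    contDiffOn := fun d d' => (hsmooth d d').mono hsub
    symm := fun d d' => by unfold potentialHess; rw [fullHess_symm]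
    periodic := fun z hz => hper z (hsub hz)
    positive := hpos
    density := 𝔤.analytic_volume.extension
    differentiableOn := (IsAnalyticPeriodic.differentiableOn_extension h.volume).mono hsubR
    density_periodic := fun z m hm => 𝔤.analytic_volume.extension_periodic z hm
    det_eq := fun z hz => 𝔤.det_complexHess_potentialHess h h0 h1 hW hdet (hmem z (hsub hz))
    density_real := IsAnalyticPeriodic.extension_real h.volume.of_two_mul
    hess_real := fun x i j => hreal x (.inr i) (.inr j)
    hess_real_left := fun x i d => hreal x (.inl i) d }⟩

end PeriodicMetric

end

noncomputable section

/-! ### Exterior products of linear forms -/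

section DetForm

variable {V : Type*} [AddCommGroup V] [Module ℝ V]

/-- The exterior product of a family of linear forms. -/
def detForm {ι : Type*} [Fintype ι] [DecidableEq ι] (f : ι → V →ₗ[ℝ] ℂ) : V [⋀^ι]→ₗ[ℝ] ℂ :=
  MultilinearMap.alternatization ((MultilinearMap.mkPiAlgebra ℝ ι ℂ).compLinearMap f)

theorem detForm_apply {ι : Type*} [Fintype ι] [DecidableEq ι] (f : ι → V →ₗ[ℝ] ℂ) (v : ι → V) :
    detForm f v = (Matrix.of fun i j => f i (v j)).det := by
  rw [detForm, MultilinearMap.alternatization_apply, ← Matrix.det_transpose, Matrix.det_apply]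
  rfl

/-- The shuffle product of two alternatizations is the alternatization of the tensor product, which
explains why no factorials appear. -/
theorem wedge_detForm {p q : ℕ} (f : Fin p → V →ₗ[ℝ] ℂ) (g : Fin q → V →ₗ[ℝ] ℂ) :
    wedge (detForm f) (detForm g) = detForm (Fin.append f g) := by
  ext v
  rw [wedge, detForm, detForm, ← MultilinearMap.domCoprod_alternization,
    AlternatingMap.domDomCongr_apply, LinearMap.compAlternatingMap_apply,
    MultilinearMap.alternatization_apply, map_sum, detForm_apply, ← Matrix.det_transpose,
    ← Matrix.det_submatrix_equiv_self (finSumFinEquiv (m := p) (n := q)), Matrix.det_apply]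
  refine Finset.sum_congr rfl fun σ _ => ?_
  rw [LinearMap.map_smul_of_tower]
  congr 1
  simp [MultilinearMap.domCoprod, Fintype.prod_sum_type]

theorem alternatingMap_sum_apply {κ ι N : Type*} [AddCommGroup N] [Module ℝ N] (s : Finset ι)
    (α : ι → V [⋀^κ]→ₗ[ℝ] N) (v : κ → V) : (∑ i ∈ s, α i) v = ∑ i ∈ s, α i v :=
  map_sum (⟨⟨fun β => β v, rfl⟩, fun _ _ => rfl⟩ : (V [⋀^κ]→ₗ[ℝ] N) →+ N) α s

theorem wedge_sum_left {p q : ℕ} {ι : Type*} (s : Finset ι) (α : ι → V [⋀^Fin p]→ₗ[ℝ] ℂ)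
    (β : V [⋀^Fin q]→ₗ[ℝ] ℂ) : wedge (∑ i ∈ s, α i) β = ∑ i ∈ s, wedge (α i) β := by
  ext v
  simp only [wedge, ← AlternatingMap.domCoprod'_apply, TensorProduct.sum_tmul, map_sum,
    AlternatingMap.domDomCongr_apply, LinearMap.compAlternatingMap_apply, alternatingMap_sum_apply]

theorem wedge_sum_right {p q : ℕ} {ι : Type*} (s : Finset ι) (α : V [⋀^Fin p]→ₗ[ℝ] ℂ)
    (β : ι → V [⋀^Fin q]→ₗ[ℝ] ℂ) : wedge α (∑ i ∈ s, β i) = ∑ i ∈ s, wedge α (β i) := by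
  ext v
  simp only [wedge, ← AlternatingMap.domCoprod'_apply, TensorProduct.tmul_sum, map_sum,
    AlternatingMap.domDomCongr_apply, LinearMap.compAlternatingMap_apply, alternatingMap_sum_apply]

theorem wedgePow_three_detForm (f : Fin 3 → Fin 2 → V →ₗ[ℝ] ℂ) (v : Fin 6 → V) :
    wedgePow (∑ i, detForm (f i)) 3 v = ∑ i, ∑ j, ∑ k,
      (Matrix.of fun a b => (![f i 0, f i 1, f j 0, f j 1, f k 0, f k 1] : Fin 6 → V →ₗ[ℝ] ℂ) a
        (v b)).det := by
  have h0 : AlternatingMap.constOfIsEmpty ℝ V (Fin 0) (1 : ℂ) =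
      detForm (Fin.elim0 : Fin 0 → V →ₗ[ℝ] ℂ) := by
    ext v
    rw [detForm_apply, Matrix.det_isEmpty]
    rfl
  have h1 : wedgePow (∑ i, detForm (f i)) 1 = ∑ i, detForm (Fin.append Fin.elim0 (f i)) := by
    simp only [wedgePow]
    rw [h0, wedge_sum_right]
    exact Finset.sum_congr rfl fun i _ => wedge_detForm _ _
  have h2 : wedgePow (∑ i, detForm (f i)) 2 = ∑ i, ∑ j,
      detForm (Fin.append (Fin.append Fin.elim0 (f i)) (f j)) := by
    rw [wedgePow, h1, wedge_sum_left]
    refine Finset.sum_congr rfl fun i _ => ?_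
    rw [wedge_sum_right]
    exact Finset.sum_congr rfl fun j _ => wedge_detForm _ _
  have h3 : wedgePow (∑ i, detForm (f i)) 3 = ∑ i, ∑ j, ∑ k,
      detForm (Fin.append (Fin.append (Fin.append Fin.elim0 (f i)) (f j)) (f k)) := by
    rw [wedgePow, h2, wedge_sum_left]
    refine Finset.sum_congr rfl fun i _ => ?_
    rw [wedge_sum_left]
    refine Finset.sum_congr rfl fun j _ => ?_
    rw [wedge_sum_right]
    exact Finset.sum_congr rfl fun k _ => wedge_detForm _ _
  rw [h3]
  simp only [alternatingMap_sum_apply]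
  refine Finset.sum_congr rfl fun i _ => Finset.sum_congr rfl fun j _ => Finset.sum_congr rfl
    fun k _ => ?_
  have h4 : (Fin.append (Fin.append (Fin.append Fin.elim0 (f i)) (f j)) (f k) :
      Fin 6 → V →ₗ[ℝ] ℂ) = ![f i 0, f i 1, f j 0, f j 1, f k 0, f k 1] := by
    funext a
    fin_cases a <;> rfl
  rw [← h4]
  exact detForm_apply (Fin.append (Fin.append (Fin.append Fin.elim0 (f i)) (f j)) (f k)) v

end DetForm

theorem det_six_swap {A : Type*} [CommRing A] (r : Fin 6 → Fin 6 → A) (σ : Equiv.Perm (Fin 6)) :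
    (Matrix.of fun a b => r (σ a) b).det = Equiv.Perm.sign σ * (Matrix.of r).det :=
  Matrix.det_permute σ (Matrix.of r)

/-- The cube of a sum of three decomposable 2-forms: terms with a repeated index vanish, and the six
others agree because exchanging two pairs of rows is an even permutation. -/
theorem sum_det_six {A : Type*} [CommRing A] (r : Fin 3 → Fin 2 → Fin 6 → A) :
    ∑ i, ∑ j, ∑ k, (Matrix.of ![r i 0, r i 1, r j 0, r j 1, r k 0, r k 1]).det =
      6 * (Matrix.of ![r 0 0, r 0 1, r 1 0, r 1 1, r 2 0, r 2 1]).det := by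
  set F : Fin 3 → Fin 3 → Fin 3 → A := fun i j k =>
    (Matrix.of ![r i 0, r i 1, r j 0, r j 1, r k 0, r k 1]).det with hF
  have h1 : ∀ i j k, F j i k = F i j k := fun i j k => by
    have := det_six_swap ![r i 0, r i 1, r j 0, r j 1, r k 0, r k 1]
      (Equiv.swap 0 2 * Equiv.swap 1 3)
    rw [show Equiv.Perm.sign (Equiv.swap (0 : Fin 6) 2 * Equiv.swap 1 3) = 1 by decide] at this
    simp only [Units.val_one, Int.cast_one, one_mul] at this
    simp only [hF]
    rw [← this]
    congr 1
    ext a b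
    fin_cases a <;> rfl
  have h2 : ∀ i j k, F i k j = F i j k := fun i j k => by
    have := det_six_swap ![r i 0, r i 1, r j 0, r j 1, r k 0, r k 1]
      (Equiv.swap 2 4 * Equiv.swap 3 5)
    rw [show Equiv.Perm.sign (Equiv.swap (2 : Fin 6) 4 * Equiv.swap 3 5) = 1 by decide] at this
    simp only [Units.val_one, Int.cast_one, one_mul] at this
    simp only [hF]
    rw [← this]
    congr 1
    ext a b
    fin_cases a <;> rfl
  have h3 : ∀ i k, F i i k = 0 := fun i k =>
    Matrix.det_zero_of_row_eq (i := 0) (j := 2) (by decide) rfl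
  have h4 : ∀ i j, F i j j = 0 := fun i j =>
    Matrix.det_zero_of_row_eq (i := 2) (j := 4) (by decide) rfl
  have h5 : ∀ i j, F i j i = 0 := fun i j => by rw [h2, h3]
  change ∑ i, ∑ j, ∑ k, F i j k = 6 * F 0 1 2
  simp only [Fin.sum_univ_three, h3, h4, h5, add_zero, zero_add]
  rw [h2 0 1 2, h1 0 1 2, h2 1 0 2, h1 0 1 2, h1 0 2 1, h2 0 1 2, h2 2 0 1, h1 0 2 1, h2 0 1 2]
  ring

/-- Moving all dz in front of all dz̄ is an odd permutation of six rows. This is the minus sign in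
the volume relation. -/
theorem det_interleave {A : Type*} [CommRing A] (r : Fin 3 → Fin 2 → Fin 6 → A) :
    (Matrix.of ![r 0 0, r 0 1, r 1 0, r 1 1, r 2 0, r 2 1]).det =
      -(Matrix.of ![r 0 0, r 1 0, r 2 0, r 0 1, r 1 1, r 2 1]).det := by
  have h := det_six_swap ![r 0 0, r 1 0, r 2 0, r 0 1, r 1 1, r 2 1]
    (Equiv.swap 1 3 * Equiv.swap 3 4 * Equiv.swap 4 2)
  rw [show Equiv.Perm.sign (Equiv.swap (1 : Fin 6) 3 * Equiv.swap 3 4 * Equiv.swap 4 2) = -1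
    by decide] at h
  simp only [Units.val_neg, Units.val_one, Int.cast_neg, Int.cast_one, neg_mul, one_mul] at h
  rw [← h]
  congr 1
  ext a b
  fin_cases a <;> rfl

/-! ### The volume relation -/

section Volume

variable {V : Type*} [AddCommGroup V] [Module ℝ V]

/-- The linear combinations of linear forms with coefficients in the rows of a matrix. -/
def rowForms {p : ℕ} (S : Matrix (Fin p) (Fin p) ℂ) (f : Fin p → V →ₗ[ℝ] ℂ) (i : Fin p) :
    V →ₗ[ℝ] ℂ := ∑ j, S i j • f j

theorem rowForms_apply {p : ℕ} (S : Matrix (Fin p) (Fin p) ℂ) (f : Fin p → V →ₗ[ℝ] ℂ) (i : Fin p)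
    (v : V) : rowForms S f i v = ∑ j, S i j * f j v := by
  simp [rowForms]

theorem detForm_rowForms {p : ℕ} (S : Matrix (Fin p) (Fin p) ℂ) (f : Fin p → V →ₗ[ℝ] ℂ)
    (v : Fin p → V) : detForm (rowForms S f) v = S.det * detForm f v := by
  rw [detForm_apply, detForm_apply, ← Matrix.det_mul]
  congr 1
  ext i j
  simp [rowForms_apply, Matrix.mul_apply]

theorem detForm_append_rowForms {p : ℕ} (S T : Matrix (Fin p) (Fin p) ℂ)
    (f g : Fin p → V →ₗ[ℝ] ℂ) (v : Fin (p + p) → V) :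
    detForm (Fin.append (rowForms S f) (rowForms T g)) v =
      S.det * T.det * detForm (Fin.append f g) v := by
  rw [detForm_apply, detForm_apply,
    ← Matrix.det_submatrix_equiv_self (finSumFinEquiv (m := p) (n := p)),
    ← Matrix.det_submatrix_equiv_self (finSumFinEquiv (m := p) (n := p)) (Matrix.of _),
    ← Matrix.det_fromBlocks_zero₂₁ S 0 T, ← Matrix.det_mul]
  congr 1
  ext i j
  rcases i with i | i <;> simp only [Matrix.submatrix_apply, Matrix.of_apply, Matrix.mul_apply,
    Fintype.sum_sum_type, finSumFinEquiv_apply_left, finSumFinEquiv_apply_right, Fin.append_left,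
    Fin.append_right, rowForms_apply, Matrix.fromBlocks_apply₁₁, Matrix.fromBlocks_apply₁₂,
    Matrix.fromBlocks_apply₂₁, Matrix.fromBlocks_apply₂₂, Matrix.zero_apply, zero_mul,
    Finset.sum_const_zero, add_zero, zero_add]

theorem detForm_append_three (f g : Fin 3 → V →ₗ[ℝ] ℂ) (v : Fin (3 + 3) → V) :
    detForm (Fin.append f g) v = (Matrix.of ![fun b => f 0 (v b), fun b => f 1 (v b),
      fun b => f 2 (v b), fun b => g 0 (v b), fun b => g 1 (v b), fun b => g 2 (v b)]).det := by
  have h1 : (Fin.append f g : Fin 6 → V →ₗ[ℝ] ℂ) = ![f 0, f 1, f 2, g 0, g 1, g 2] := by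
    funext a
    fin_cases a <;> rfl
  have h2 : (Matrix.of ![fun b => f 0 (v b), fun b => f 1 (v b), fun b => f 2 (v b),
      fun b => g 0 (v b), fun b => g 1 (v b), fun b => g 2 (v b)] : Matrix (Fin 6) (Fin 6) ℂ) =
      Matrix.of fun a b => (![f 0, f 1, f 2, g 0, g 1, g 2] : Fin 6 → V →ₗ[ℝ] ℂ) a (v b) := by
    ext a b
    fin_cases a <;> rfl
  rw [h2, ← h1]
  exact detForm_apply (Fin.append f g) v

end Volume

/-- The form `dz_j`. -/
def holForm (j : Fin 3) : EuclideanSpace ℂ (Fin 3) →ₗ[ℝ] ℂ :=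
  ((EuclideanSpace.proj j : EuclideanSpace ℂ (Fin 3) →L[ℂ] ℂ).restrictScalars ℝ).toLinearMap

/-- The form `dz̄_j`. -/
def antiholForm (j : Fin 3) : EuclideanSpace ℂ (Fin 3) →ₗ[ℝ] ℂ :=
  Complex.conjLIE.toLinearEquiv.toLinearMap ∘ₗ holForm j

theorem holForm_apply (j : Fin 3) (v : EuclideanSpace ℂ (Fin 3)) : holForm j v = v j := rfl

theorem antiholForm_apply (j : Fin 3) (v : EuclideanSpace ℂ (Fin 3)) :
    antiholForm j v = starRingEnd ℂ (v j) := rfl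

theorem complexifyForm_eq_sum_detForm {Q : Direction → Direction → ℝ}
    (hQ : ∀ d d', Q d d' = Q d' d) {κ : EuclideanSpace ℂ (Fin 3) [⋀^Fin 2]→L[ℝ] ℝ}
    (hκ : ∀ u v, κ ![u, v] = kahlerBilin Q u v) :
    complexifyForm κ.toAlternatingMap = ∑ i, detForm ![rowForms 1 holForm i,
      rowForms ((Complex.I / 2) • complexHess Q) antiholForm i] := by
  ext v
  rw [alternatingMap_sum_apply]
  have h1 : complexifyForm κ.toAlternatingMap v = (kahlerBilin Q (v 0) (v 1) : ℂ) := by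
    rw [← hκ]
    change ((κ v : ℝ) : ℂ) = _
    congr 2
    ext i : 1
    fin_cases i <;> rfl
  rw [h1, ofReal_kahlerBilin hQ]
  refine Finset.sum_congr rfl fun i _ => ?_
  rw [detForm_apply, Matrix.det_fin_two]
  simp [rowForms_apply, Matrix.one_apply, holForm_apply, antiholForm_apply]

/-- With κ = ∑ dz_i ∧ θ_i, the cube is 3! times the product of the three terms. Reordering gives −1,
and θ₁∧θ₂∧θ₃ contributes (i/2)³ det h = (i/2)³ |H|². -/
theorem volumeRelation_of_det_eq {Q : Direction → Direction → ℝ} (hQ : ∀ d d', Q d d' = Q d' d)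
    {κ : EuclideanSpace ℂ (Fin 3) [⋀^Fin 2]→L[ℝ] ℝ} (hκ : ∀ u v, κ ![u, v] = kahlerBilin Q u v)
    {Ω : EuclideanSpace ℂ (Fin 3) [⋀^Fin 3]→L[ℂ] ℂ} {H : ℂ}
    (hΩ : ∀ v, Ω v = H * (Matrix.of fun i j => v j i).det)
    (hdet : (complexHess Q).det = H * starRingEnd ℂ H) :
    VolumeRelation (-(Nat.factorial 3 : ℂ) * (Complex.I / 2) ^ 3) κ Ω := by
  intro v
  have hS : ∀ a : ℂ, (Matrix.diagonal ![a, 1, 1]).det = a := fun a => by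
    simp [Matrix.det_diagonal, Fin.prod_univ_three]
  -- The factor H is carried by the first row alone, so that Ω is again an exterior product of
  -- linear forms.
  have hΩ1 : (Ω.restrictScalars ℝ).toAlternatingMap =
      detForm (rowForms (Matrix.diagonal ![H, 1, 1]) holForm) := by
    ext w
    rw [detForm_rowForms, hS, detForm_apply]
    exact hΩ w
  have hΩ2 : conjForm (Ω.restrictScalars ℝ).toAlternatingMap =
      detForm (rowForms (Matrix.diagonal ![starRingEnd ℂ H, 1, 1]) antiholForm) := by
    ext w
    rw [detForm_rowForms, hS, detForm_apply]
    change starRingEnd ℂ (Ω w) = _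
    rw [hΩ, map_mul, RingHom.map_det]
    rfl
  rw [hΩ2, hΩ1, wedge_detForm, detForm_append_rowForms, hS, hS, complexifyForm_eq_sum_detForm hQ hκ]
  set f : Fin 3 → Fin 2 → EuclideanSpace ℂ (Fin 3) →ₗ[ℝ] ℂ := fun i =>
    ![rowForms 1 holForm i, rowForms ((Complex.I / 2) • complexHess Q) antiholForm i] with hf
  set w : Fin 6 → EuclideanSpace ℂ (Fin 3) := v ∘ finCongr (two_mul 3) with hw
  have h0 := wedgePow_three_detForm f w
  rw [hw] at h0
  rw [h0, ← hw]
  have h1 : ∀ i j k, (Matrix.of fun a b => (![f i 0, f i 1, f j 0, f j 1, f k 0, f k 1] :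
      Fin 6 → EuclideanSpace ℂ (Fin 3) →ₗ[ℝ] ℂ) a (w b)) =
      Matrix.of ![fun b => f i 0 (w b), fun b => f i 1 (w b), fun b => f j 0 (w b),
        fun b => f j 1 (w b), fun b => f k 0 (w b), fun b => f k 1 (w b)] := fun i j k => by
    ext a b
    fin_cases a <;> rfl
  simp only [h1]
  rw [sum_det_six fun i a b => f i a (w b)]
  rw [det_interleave fun i a b => f i a (w b)]
  have h4 := detForm_append_three (rowForms 1 holForm)
    (rowForms ((Complex.I / 2) • complexHess Q) antiholForm) v
  rw [detForm_append_rowForms, Matrix.det_one, Matrix.det_smul, hdet] at h4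
  -- The reindexing of 2·3 as 3 + 3 does not move the indices.
  have hwv : w = v := funext fun b => congrArg v (Fin.ext rfl)
  have h5 : 1 * ((Complex.I / 2) ^ Fintype.card (Fin 3) * (H * starRingEnd ℂ H)) *
      detForm (Fin.append holForm antiholForm) v =
      (Matrix.of ![fun b => f 0 0 (w b), fun b => f 1 0 (w b), fun b => f 2 0 (w b),
      fun b => f 0 1 (w b), fun b => f 1 1 (w b), fun b => f 2 1 (w b)]).det := by
    rw [hwv]
    exact h4
  rw [← h5]
  simp [Nat.factorial]
  ring

end

noncomputable section

open Topology

/-! ### Quotients of strips in `ℂ³` by the real integer translations -/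

/-- The vectors of `ℂ³` with integer coordinates. -/
def realLattice : AddSubgroup (EuclideanSpace ℂ (Fin 3)) where
  carrier := {x | ∀ j, ∃ k : ℤ, x j = k}
  zero_mem' := fun _ => ⟨0, by simp⟩
  add_mem' := by
    intro a b ha hb i
    obtain ⟨k, hk⟩ := ha i
    obtain ⟨l, hl⟩ := hb i
    exact ⟨k + l, by simp [hk, hl]⟩
  neg_mem' := by
    intro a ha i
    obtain ⟨k, hk⟩ := ha i
    exact ⟨-k, by simp [hk]⟩

theorem realLattice_eq_zero {x : EuclideanSpace ℂ (Fin 3)} (hx : x ∈ realLattice)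
    (h : ‖x‖ < 1) : x = 0 := by
  ext i
  obtain ⟨k, hk⟩ := hx i
  have h1 : ‖x i‖ < 1 := lt_of_le_of_lt (PiLp.norm_apply_le x i) h
  rw [hk, Complex.norm_intCast] at h1
  have h2 : |k| < 1 := by exact_mod_cast h1
  simp [hk, Int.abs_lt_one_iff.1 h2]

theorem realLattice_isDiscrete :
    IsDiscrete (realLattice : Set (EuclideanSpace ℂ (Fin 3))) := by
  refine isDiscrete_iff_forall_mem_exists_isOpen.2 fun y hy =>
    ⟨Metric.ball y 1, Metric.isOpen_ball, ?_⟩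
  ext z
  constructor
  · rintro ⟨hz1, hz2⟩
    have h := realLattice_eq_zero (realLattice.sub_mem hz2 hy) (by simpa [dist_eq_norm] using hz1)
    exact sub_eq_zero.1 h
  · rintro rfl
    exact ⟨Metric.mem_ball_self one_pos, hy⟩

instance : DiscreteTopology realLattice :=
  isDiscrete_iff_discreteTopology.1 realLattice_isDiscrete

/-- The quotient `ℂ³ / ℤ³`. -/
abbrev ComplexCylinder : Type := EuclideanSpace ℂ (Fin 3) ⧸ realLattice

/-- The projection `ℂ³ → ℂ³ / ℤ³`. -/
def cylinderProj : EuclideanSpace ℂ (Fin 3) → ComplexCylinder :=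
  QuotientAddGroup.mk

theorem cylinderProj_eq_iff {x y : EuclideanSpace ℂ (Fin 3)} :
    cylinderProj x = cylinderProj y ↔ y - x ∈ realLattice :=
  QuotientAddGroup.eq.trans (by rw [sub_eq_neg_add])

theorem cylinderProj_add {x m : EuclideanSpace ℂ (Fin 3)} (hm : m ∈ realLattice) :
    cylinderProj (x + m) = cylinderProj x :=
  cylinderProj_eq_iff.2 (by simpa using realLattice.neg_mem hm)

theorem cylinderProj_isLocalHomeomorph : IsLocalHomeomorph cylinderProj :=
  (realLattice.isAddQuotientCoveringMap realLattice_isDiscrete).isCoveringMap.isLocalHomeomorph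

instance : ChartedSpace (EuclideanSpace ℂ (Fin 3)) ComplexCylinder :=
  cylinderProj_isLocalHomeomorph.chartedSpace Quotient.mk_surjective

theorem cylinder_atlas_symm {e : OpenPartialHomeomorph ComplexCylinder (EuclideanSpace ℂ (Fin 3))}
    (he : e ∈ atlas (EuclideanSpace ℂ (Fin 3)) ComplexCylinder) : ⇑e.symm = cylinderProj := by
  obtain ⟨q, rfl⟩ := he
  rw [OpenPartialHomeomorph.coe_trans_symm, IsLocalHomeomorph.localInverseAt_symm]
  rw [chartAt_self_eq]
  rfl

/-- Two lifts to `ℂ³` of a map to `ℂ³ / ℤ³` agree near every point where they are equal. -/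
theorem lift_eventuallyEq {X : Type*} [TopologicalSpace X] {f h : X → EuclideanSpace ℂ (Fin 3)}
    {p : X} (hf : ContinuousAt f p) (hh : ContinuousAt h p) (hp : f p = h p)
    (hfh : ∀ᶠ q in 𝓝 p, cylinderProj (f q) = cylinderProj (h q)) : f =ᶠ[𝓝 p] h := by
  have h1 : ∀ᶠ q in 𝓝 p, ‖h q - f q‖ < 1 :=
    (hh.sub hf).norm.eventually_lt_const (by simp [hp])
  filter_upwards [h1, hfh] with q hq hq'
  exact (sub_eq_zero.1 (realLattice_eq_zero (cylinderProj_eq_iff.1 hq') hq)).symm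

/-- The image in `ℂ³ / ℤ³` of a strip around `ℝ³`. -/
def stripOpens (r : ℝ) : TopologicalSpace.Opens ComplexCylinder :=
  ⟨cylinderProj '' complexStrip r,
    cylinderProj_isLocalHomeomorph.isOpenMap _ (isOpen_complexStrip r)⟩

/-- The quotient of a strip around `ℝ³` in `ℂ³` by the integer translations. -/
abbrev StripManifold (r : ℝ) : Type := stripOpens r

theorem mem_complexStrip_of_add {r : ℝ} {x m : EuclideanSpace ℂ (Fin 3)} (hm : m ∈ realLattice) :
    x + m ∈ complexStrip r ↔ x ∈ complexStrip r := by
  refine forall_congr' fun j => ?_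
  obtain ⟨k, hk⟩ := hm j
  simp [hk]

theorem cylinderProj_mem_stripOpens {r : ℝ} {z : EuclideanSpace ℂ (Fin 3)} :
    cylinderProj z ∈ stripOpens r ↔ z ∈ complexStrip r := by
  constructor
  · rintro ⟨w, hw, hwz⟩
    rw [← add_sub_cancel w z, mem_complexStrip_of_add (cylinderProj_eq_iff.1 hwz)]
    exact hw
  · exact fun hz => ⟨z, hz, rfl⟩

instance (r : ℝ) : T2Space (StripManifold r) :=
  haveI : IsClosed (realLattice : Set (EuclideanSpace ℂ (Fin 3))) :=
    AddSubgroup.isClosed_of_discrete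
  inferInstance

theorem stripManifold_connectedSpace {r : ℝ} (hr : 0 < r) : ConnectedSpace (StripManifold r) := by
  refine isConnected_iff_connectedSpace.1 (IsConnected.image ⟨⟨0, fun j => by simpa using hr⟩, ?_⟩ _
    cylinderProj_isLocalHomeomorph.continuous.continuousOn)
  exact (convex_complexStrip r).isPreconnected

/-- An open partial homeomorphism whose inverse is the projection. -/
def IsLiftChart {r : ℝ}
    (φ : OpenPartialHomeomorph (StripManifold r) (EuclideanSpace ℂ (Fin 3))) : Prop :=
  ∀ z ∈ φ.target, (φ.symm z : ComplexCylinder) = cylinderProj z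

theorem isLiftChart_of_mem_atlas {r : ℝ}
    {φ : OpenPartialHomeomorph (StripManifold r) (EuclideanSpace ℂ (Fin 3))}
    (hφ : φ ∈ atlas (EuclideanSpace ℂ (Fin 3)) (StripManifold r)) : IsLiftChart φ := by
  intro z hz
  have hne : Nonempty (StripManifold r) := ⟨φ.symm z⟩
  obtain ⟨x, rfl⟩ := TopologicalSpace.Opens.chart_eq hne hφ
  rw [← cylinder_atlas_symm (chart_mem_atlas _ (x : ComplexCylinder))]
  exact (OpenPartialHomeomorph.subtypeRestr_symm_eqOn _ hne hz).symm

namespace IsLiftChart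

variable {r : ℝ} {φ ψ : OpenPartialHomeomorph (StripManifold r) (EuclideanSpace ℂ (Fin 3))}

theorem cylinderProj_apply (hφ : IsLiftChart φ) {p : StripManifold r} (hp : p ∈ φ.source) :
    cylinderProj (φ p) = p := by
  rw [← hφ _ (φ.map_source hp), φ.left_inv hp]

theorem mem_complexStrip (hφ : IsLiftChart φ) {z : EuclideanSpace ℂ (Fin 3)} (hz : z ∈ φ.target) :
    z ∈ complexStrip r := by
  rw [← cylinderProj_mem_stripOpens, ← hφ z hz]
  exact (φ.symm z).2

/-- Two lifts of the same point differ by a lattice vector, which is locally constant by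
discreteness. Everything about charts of the quotient follows from transitions being translations.
-/
theorem transition_eventuallyEq (hφ : IsLiftChart φ) (hψ : IsLiftChart ψ)
    {z : EuclideanSpace ℂ (Fin 3)} (hz : z ∈ φ.target) (hz' : φ.symm z ∈ ψ.source) :
    (fun y => ψ (φ.symm y)) =ᶠ[𝓝 z] fun y => y + (ψ (φ.symm z) - z) := by
  have hc : ContinuousAt (fun y => ψ (φ.symm y)) z :=
    (ψ.continuousAt hz').comp (φ.symm.continuousAt hz)
  have h1 : ∀ {y}, y ∈ φ.target → φ.symm y ∈ ψ.source →
      cylinderProj (ψ (φ.symm y)) = cylinderProj y := fun hy hy' => by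
    rw [hψ.cylinderProj_apply hy', hφ _ hy]
  refine lift_eventuallyEq hc (by fun_prop) (by abel) ?_
  filter_upwards [φ.open_target.mem_nhds hz,
    (φ.symm.continuousAt hz).preimage_mem_nhds (ψ.open_source.mem_nhds hz')] with y hy hy'
  rw [h1 hy hy', cylinderProj_add]
  exact cylinderProj_eq_iff.1 (h1 hz hz').symm

theorem contDiffOn_transition {𝕜 : Type*} [NontriviallyNormedField 𝕜]
    [NormedSpace 𝕜 (EuclideanSpace ℂ (Fin 3))] (hφ : IsLiftChart φ) (hψ : IsLiftChart ψ) :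
    ContDiffOn 𝕜 ω (φ.symm.trans ψ) (φ.symm.trans ψ).source := by
  intro z hz
  rw [OpenPartialHomeomorph.trans_source] at hz
  exact ((contDiff_id.add contDiff_const).contDiffAt.congr_of_eventuallyEq
    (hφ.transition_eventuallyEq hψ hz.1 hz.2)).contDiffWithinAt

theorem mem_maximalAtlas {𝕜 : Type*} [NontriviallyNormedField 𝕜]
    [NormedSpace 𝕜 (EuclideanSpace ℂ (Fin 3))] (hφ : IsLiftChart φ) :
    φ ∈ IsManifold.maximalAtlas 𝓘(𝕜, EuclideanSpace ℂ (Fin 3)) ω (StripManifold r) := by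
  have key : ∀ {φ ψ : OpenPartialHomeomorph (StripManifold r) (EuclideanSpace ℂ (Fin 3))},
      IsLiftChart φ → IsLiftChart ψ →
      φ.symm.trans ψ ∈ contDiffGroupoid ω 𝓘(𝕜, EuclideanSpace ℂ (Fin 3)) := fun hφ hψ => by
    rw [contDiffGroupoid, mem_groupoid_of_pregroupoid]
    simpa [contDiffPregroupoid] using
      And.intro (hφ.contDiffOn_transition (𝕜 := 𝕜) hψ) (hψ.contDiffOn_transition (𝕜 := 𝕜) hφ)
  exact fun e he => ⟨key hφ (isLiftChart_of_mem_atlas he), key (isLiftChart_of_mem_atlas he) hφ⟩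

end IsLiftChart

instance {𝕜 : Type*} [NontriviallyNormedField 𝕜] [NormedSpace 𝕜 (EuclideanSpace ℂ (Fin 3))]
    (r : ℝ) : IsManifold 𝓘(𝕜, EuclideanSpace ℂ (Fin 3)) ω (StripManifold r) := by
  refine isManifold_of_contDiffOn _ _ _ fun e e' he he' => ?_
  simpa using (isLiftChart_of_mem_atlas he).contDiffOn_transition (𝕜 := 𝕜)
    (isLiftChart_of_mem_atlas he')

/-- The tangent spaces are identified through the preferred charts, from which any lift chart
differs by a translation. A form on the quotient therefore has the same coefficients in each such
chart. -/
theorem mfderiv_liftChart_symm {𝕜 : Type*} [NontriviallyNormedField 𝕜]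
    [NormedSpace 𝕜 (EuclideanSpace ℂ (Fin 3))] {r : ℝ}
    {φ : OpenPartialHomeomorph (StripManifold r) (EuclideanSpace ℂ (Fin 3))} (hφ : IsLiftChart φ)
    {z : EuclideanSpace ℂ (Fin 3)} (hz : z ∈ φ.target) :
    mfderiv 𝓘(𝕜, EuclideanSpace ℂ (Fin 3)) 𝓘(𝕜, EuclideanSpace ℂ (Fin 3)) φ.symm z =
      ContinuousLinearMap.id 𝕜 (EuclideanSpace ℂ (Fin 3)) := by
  have hd : HasFDerivAt (fun y => chartAt (EuclideanSpace ℂ (Fin 3)) (φ.symm z) (φ.symm y))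
      (ContinuousLinearMap.id 𝕜 (EuclideanSpace ℂ (Fin 3))) z :=
    ((hasFDerivAt_id z).add_const _).congr_of_eventuallyEq
      (hφ.transition_eventuallyEq (isLiftChart_of_mem_atlas (chart_mem_atlas _ _)) hz
        (mem_chart_source _ _))
  have hm : HasMFDerivAt 𝓘(𝕜, EuclideanSpace ℂ (Fin 3)) 𝓘(𝕜, EuclideanSpace ℂ (Fin 3))
      φ.symm z (ContinuousLinearMap.id 𝕜 (EuclideanSpace ℂ (Fin 3))) := by
    refine ⟨φ.symm.continuousAt hz, ?_⟩
    simp only [mfld_simps]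
    exact hd.hasFDerivWithinAt
  exact hm.mfderiv

/-- A point of `ℂ³` over a point of the strip manifold. -/
def stripLift {r : ℝ} (p : StripManifold r) : EuclideanSpace ℂ (Fin 3) := p.1.out

theorem cylinderProj_stripLift {r : ℝ} (p : StripManifold r) : cylinderProj (stripLift p) = p :=
  Quotient.out_eq p.1

theorem stripLift_mem {r : ℝ} (p : StripManifold r) : stripLift p ∈ complexStrip r := by
  rw [← cylinderProj_mem_stripOpens, cylinderProj_stripLift]
  exact p.2

/-- A function on the strip is periodic under integer translations. -/
def IsStripPeriodic {A : Type*} (r : ℝ) (f : EuclideanSpace ℂ (Fin 3) → A) : Prop :=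
  ∀ z ∈ complexStrip r, ∀ m ∈ realLattice, f (z + m) = f z

theorem IsStripPeriodic.apply_stripLift {A : Type*} {r : ℝ} {f : EuclideanSpace ℂ (Fin 3) → A}
    (hf : IsStripPeriodic r f) {p : StripManifold r} {z : EuclideanSpace ℂ (Fin 3)}
    (h : (p : ComplexCylinder) = cylinderProj z) : f (stripLift p) = f z := by
  rw [← cylinderProj_stripLift p, eq_comm, cylinderProj_eq_iff] at h
  have hz : z ∈ complexStrip r := by
    rw [← mem_complexStrip_of_add h, add_sub_cancel]
    exact stripLift_mem p
  rw [← hf z hz _ h, add_sub_cancel]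

/-- The differential form on the strip manifold given by a periodic form on the strip. -/
def stripForm {𝕜 F : Type*} [NontriviallyNormedField 𝕜]
    [NormedSpace 𝕜 (EuclideanSpace ℂ (Fin 3))] [NormedAddCommGroup F] [NormedSpace 𝕜 F] {k : ℕ}
    (r : ℝ) (α : EuclideanSpace ℂ (Fin 3) → EuclideanSpace ℂ (Fin 3) [⋀^Fin k]→L[𝕜] F) :
    DiffForm 𝕜 (EuclideanSpace ℂ (Fin 3)) F (StripManifold r) k :=
  fun p => α (stripLift p)

theorem stripForm_inChart {𝕜 F : Type*} [NontriviallyNormedField 𝕜]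
    [NormedSpace 𝕜 (EuclideanSpace ℂ (Fin 3))] [NormedAddCommGroup F] [NormedSpace 𝕜 F] {k : ℕ}
    {r : ℝ} {α : EuclideanSpace ℂ (Fin 3) → EuclideanSpace ℂ (Fin 3) [⋀^Fin k]→L[𝕜] F}
    (hα : IsStripPeriodic r α)
    {φ : OpenPartialHomeomorph (StripManifold r) (EuclideanSpace ℂ (Fin 3))} (hφ : IsLiftChart φ) :
    Set.EqOn (DiffForm.inChart (stripForm r α) φ) α φ.target := by
  intro z hz
  rw [DiffForm.inChart, mfderiv_liftChart_symm hφ hz, stripForm, hα.apply_stripLift (hφ z hz)]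
  rfl

theorem stripForm_isOfClass {F : Type*} [NormedAddCommGroup F] [NormedSpace ℝ F] {k : ℕ}
    {r : ℝ} {α : EuclideanSpace ℂ (Fin 3) → EuclideanSpace ℂ (Fin 3) [⋀^Fin k]→L[ℝ] F}
    (hα : IsStripPeriodic r α) {m : ℕ∞ω} (hm : ContDiffOn ℝ m α (complexStrip r)) :
    DiffForm.IsOfClass m (stripForm r α) := fun _ hφ =>
  (hm.mono fun _ hz => (isLiftChart_of_mem_atlas hφ).mem_complexStrip hz).congr
    (stripForm_inChart hα (isLiftChart_of_mem_atlas hφ))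

theorem stripForm_isClosedForm {F : Type*} [NormedAddCommGroup F] [NormedSpace ℝ F] {k : ℕ}
    {r : ℝ} {α : EuclideanSpace ℂ (Fin 3) → EuclideanSpace ℂ (Fin 3) [⋀^Fin k]→L[ℝ] F}
    (hα : IsStripPeriodic r α) (hd : ∀ z ∈ complexStrip r, extDeriv α z = 0) :
    DiffForm.IsClosedForm (stripForm r α) := fun φ hφ z hz => by
  have hφ' := isLiftChart_of_mem_atlas hφ
  rw [Filter.EventuallyEq.extDeriv_eq ((stripForm_inChart hα hφ').eventuallyEq_of_mem
    (φ.open_target.mem_nhds hz)), hd z (hφ'.mem_complexStrip hz)]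

theorem stripForm_isHolomorphic {k : ℕ} {r : ℝ}
    {α : EuclideanSpace ℂ (Fin 3) → EuclideanSpace ℂ (Fin 3) [⋀^Fin k]→L[ℂ] ℂ}
    (hα : IsStripPeriodic r α) (hd : DifferentiableOn ℂ α (complexStrip r)) :
    DiffForm.IsHolomorphic (stripForm r α) := fun _ hφ =>
  (hd.mono fun _ hz => (isLiftChart_of_mem_atlas hφ).mem_complexStrip hz).congr
    (stripForm_inChart hα (isLiftChart_of_mem_atlas hφ))

end

noncomputable section

open Topology

/-! ### The Calabi–Yau structure of a solution of the Cauchy problem -/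

/-- The complex volume form `dz₁ ∧ dz₂ ∧ dz₃`. -/
def complexVolume : EuclideanSpace ℂ (Fin 3) [⋀^Fin 3]→L[ℂ] ℂ :=
  { (Matrix.detRowAlternating (R := ℂ) (n := Fin 3)).compLinearMap
      (WithLp.linearEquiv 2 ℂ (Fin 3 → ℂ)).toLinearMap with
    cont := by
      change Continuous fun v : Fin 3 → EuclideanSpace ℂ (Fin 3) =>
        (Matrix.of fun i j => v i j).det
      fun_prop }

theorem complexVolume_apply (v : Fin 3 → EuclideanSpace ℂ (Fin 3)) :
    complexVolume v = (Matrix.of fun i j => v j i).det := by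
  rw [← Matrix.det_transpose]
  rfl

/-- The 1-form `v ↦ -dx_d (i v)`. -/
def twistedCoord (d : Direction) : EuclideanSpace ℂ (Fin 3) [⋀^Fin 1]→L[ℝ] ℝ :=
  ContinuousAlternatingMap.ofSubsingletonLIE (0 : Fin 1)
    (-(realCoord d).comp (Complex.I • ContinuousLinearMap.id ℝ (EuclideanSpace ℂ (Fin 3))))

theorem twistedCoord_apply (d : Direction) (v : Fin 1 → EuclideanSpace ℂ (Fin 3)) :
    twistedCoord d v = -realCoord d (Complex.I • v 0) := rfl

theorem alternatizeUncurryFin_two {V F : Type*} [NormedAddCommGroup V] [NormedSpace ℝ V]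
    [NormedAddCommGroup F] [NormedSpace ℝ F] (f : V →L[ℝ] V [⋀^Fin 1]→L[ℝ] F) (u v : V) :
    ContinuousAlternatingMap.alternatizeUncurryFin f ![u, v] = f u ![v] - f v ![u] := by
  have h0 : (0 : Fin 2).removeNth ![u, v] = ![v] := by
    ext i
    fin_cases i
    rfl
  have h1 : (1 : Fin 2).removeNth ![u, v] = ![u] := by
    ext i
    fin_cases i
    rfl
  rw [ContinuousAlternatingMap.alternatizeUncurryFin_apply, Fin.sum_univ_two, h0, h1]
  simp [sub_eq_add_neg]

theorem hessBilin_comm {Q : Direction → Direction → ℝ} (hQ : ∀ d d', Q d d' = Q d' d)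
    (u v : EuclideanSpace ℂ (Fin 3)) : hessBilin Q u v = hessBilin Q v u := by
  rw [hessBilin, Finset.sum_comm, hessBilin]
  refine Finset.sum_congr rfl fun d _ => Finset.sum_congr rfl fun d' _ => ?_
  rw [hQ]
  ring

namespace CalabiYauHessian

variable {𝔤 : PeriodicMetric} (S : CalabiYauHessian 𝔤)

/-- A primitive of the Kähler form. -/
def kahlerPrimitive (z : EuclideanSpace ℂ (Fin 3)) : EuclideanSpace ℂ (Fin 3) [⋀^Fin 1]→L[ℝ] ℝ :=
  ∑ d, S.grad d z • twistedCoord d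

/-- The Kähler form on the strip. -/
def kahlerForm (z : EuclideanSpace ℂ (Fin 3)) : EuclideanSpace ℂ (Fin 3) [⋀^Fin 2]→L[ℝ] ℝ :=
  extDeriv S.kahlerPrimitive z

/-- The holomorphic volume form on the strip. -/
def holomorphicForm (z : EuclideanSpace ℂ (Fin 3)) : EuclideanSpace ℂ (Fin 3) [⋀^Fin 3]→L[ℂ] ℂ :=
  S.density z • complexVolume

theorem hasFDerivAt_kahlerPrimitive {z : EuclideanSpace ℂ (Fin 3)}
    (hz : z ∈ complexStrip S.radius) :
    HasFDerivAt S.kahlerPrimitive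
      (∑ d, (∑ d', S.hess d d' z • realCoord d').smulRight (twistedCoord d)) z :=
  HasFDerivAt.fun_sum fun d _ => (S.hasGrad z hz d).smul_const (twistedCoord d)

theorem contDiffOn_kahlerPrimitive :
    ContDiffOn ℝ ∞ S.kahlerPrimitive (complexStrip S.radius) := by
  refine ContDiffOn.sum fun d _ => ContDiffOn.fun_smul ?_ contDiffOn_const
  rw [contDiffOn_infty_iff_fderiv_of_isOpen (isOpen_complexStrip _)]
  refine ⟨fun z hz => (S.hasGrad z hz d).differentiableAt.differentiableWithinAt, ?_⟩
  refine ContDiffOn.congr (f := fun z => ∑ d', S.hess d d' z • realCoord d') ?_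
    fun z hz => (S.hasGrad z hz d).fderiv
  exact ContDiffOn.sum fun d' _ => (S.contDiffOn d d').smul contDiffOn_const

theorem contDiffOn_kahlerForm : ContDiffOn ℝ ∞ S.kahlerForm (complexStrip S.radius) :=
  (ContinuousAlternatingMap.alternatizeUncurryFinCLM ℝ (EuclideanSpace ℂ (Fin 3)) ℝ
    (n := 1)).contDiff.comp_contDiffOn
      (S.contDiffOn_kahlerPrimitive.fderiv_of_isOpen (isOpen_complexStrip _) le_rfl)

theorem extDeriv_kahlerForm {z : EuclideanSpace ℂ (Fin 3)} (hz : z ∈ complexStrip S.radius) :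
    extDeriv S.kahlerForm z = 0 :=
  extDeriv_extDeriv_apply
    (S.contDiffOn_kahlerPrimitive.contDiffAt ((isOpen_complexStrip _).mem_nhds hz)) (by
      simpa using ENat.LEInfty.out)

/-- With Q the Hessian, the derivative of the primitive along u, evaluated on v, is −Q(u, iv).
Antisymmetrizing and using the symmetry of Q gives Q(iu, v) − Q(u, iv). -/
theorem kahlerForm_apply {z : EuclideanSpace ℂ (Fin 3)} (hz : z ∈ complexStrip S.radius)
    (u v : EuclideanSpace ℂ (Fin 3)) :
    S.kahlerForm z ![u, v] = kahlerBilin (fun d d' => S.hess d d' z) u v := by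
  have h (w : EuclideanSpace ℂ (Fin 3)) (t : Fin 1 → EuclideanSpace ℂ (Fin 3)) :
      (∑ d, (∑ d', S.hess d d' z • realCoord d').smulRight (twistedCoord d)) w t =
        -hessBilin (fun d d' => S.hess d d' z) w (Complex.I • t 0) := by
    simp only [hessBilin, sum_apply, smul_apply, ContinuousLinearMap.smulRight_apply,
      ContinuousAlternatingMap.sum_apply, ContinuousAlternatingMap.smul_apply, twistedCoord_apply,
      smul_eq_mul]
    rw [Finset.sum_comm, ← Finset.sum_neg_distrib]
    refine Finset.sum_congr rfl fun d _ => ?_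
    rw [Finset.sum_mul, ← Finset.sum_neg_distrib]
    refine Finset.sum_congr rfl fun d' _ => ?_
    rw [S.symm d d']
    ring
  rw [kahlerForm, extDeriv, (S.hasFDerivAt_kahlerPrimitive hz).fderiv, alternatizeUncurryFin_two,
    h, h, kahlerBilin, hessBilin_comm (fun d d' => congrFun (S.symm d d') z) v]
  simp only [Matrix.cons_val_zero]
  ring

theorem isStripPeriodic_kahlerForm : IsStripPeriodic S.radius S.kahlerForm := by
  intro z hz m hm
  ext v
  have hv : v = ![v 0, v 1] := by
    ext1 i
    fin_cases i <;> rfl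
  rw [hv, S.kahlerForm_apply hz, S.kahlerForm_apply ((mem_complexStrip_of_add hm).2 hz)]
  simp only [S.periodic z hz m hm]

theorem isStripPeriodic_holomorphicForm : IsStripPeriodic S.radius S.holomorphicForm := by
  intro z _ m hm
  rw [holomorphicForm, S.density_periodic z m hm, holomorphicForm]

theorem isKahlerForm : IsKahlerForm (stripForm S.radius S.kahlerForm) where
  smooth := stripForm_isOfClass S.isStripPeriodic_kahlerForm S.contDiffOn_kahlerForm
  closed := stripForm_isClosedForm S.isStripPeriodic_kahlerForm fun _ => S.extDeriv_kahlerForm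
  type_one_one p u v := by
    have h := S.kahlerForm_apply (stripLift_mem p)
    exact (h _ _).trans ((kahlerBilin_smul_I _ u v).trans (h u v).symm)
  positive p u hu :=
    (S.positive _ (stripLift_mem p) u hu).trans_eq (S.kahlerForm_apply (stripLift_mem p) _ _).symm

/-- A zero of H would make the determinant of the positive complex Hessian vanish. -/
theorem density_ne_zero {z : EuclideanSpace ℂ (Fin 3)} (hz : z ∈ complexStrip S.radius) :
    S.density z ≠ 0 := fun h => by
  have h1 := S.det_eq z hz
  rw [h, zero_mul] at h1
  exact complexHess_det_ne_zero (S.positive z hz) h1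

theorem holomorphicForm_apply (z : EuclideanSpace ℂ (Fin 3))
    (v : Fin 3 → EuclideanSpace ℂ (Fin 3)) :
    S.holomorphicForm z v = S.density z * (Matrix.of fun i j => v j i).det := by
  rw [← complexVolume_apply]
  rfl

theorem holomorphicForm_ne_zero {z : EuclideanSpace ℂ (Fin 3)} (hz : z ∈ complexStrip S.radius) :
    S.holomorphicForm z ≠ 0 := fun h => by
  have h1 := S.holomorphicForm_apply z fun i => EuclideanSpace.single i 1
  have h2 : (Matrix.of fun i j : Fin 3 => (EuclideanSpace.single j (1 : ℂ) :
      EuclideanSpace ℂ (Fin 3)) i) = 1 := by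
    ext i j
    simp [Matrix.one_apply]
  rw [h, h2, Matrix.det_one, mul_one] at h1
  exact S.density_ne_zero hz h1.symm

/-- The Calabi–Yau structure on the quotient of the strip. -/
def calabiYauStructure : CalabiYauStructure 3 (StripManifold S.radius) where
  Ω := stripForm S.radius S.holomorphicForm
  κ := stripForm S.radius S.kahlerForm
  holomorphic := stripForm_isHolomorphic S.isStripPeriodic_holomorphicForm
    (S.differentiableOn.smul_const _)
  nowhere_zero p := S.holomorphicForm_ne_zero (stripLift_mem p)
  kahler := S.isKahlerForm
  c := -(Nat.factorial 3 : ℂ) * (Complex.I / 2) ^ 3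
  volume_eq p := volumeRelation_of_det_eq
    (fun d d' => congrFun (S.symm d d') _) (S.kahlerForm_apply (stripLift_mem p))
    (S.holomorphicForm_apply _) (S.det_eq _ (stripLift_mem p))

end CalabiYauHessian

end

noncomputable section

open Topology

/-! ### Coordinates on the torus -/

theorem torusProj_chart {n : ℕ} {e : OpenPartialHomeomorph (Torus n) (EuclideanSpace ℝ (Fin n))}
    (he : e ∈ atlas (EuclideanSpace ℝ (Fin n)) (Torus n)) {p : Torus n} (hp : p ∈ e.source) :
    torusProj n (e p) = p := by
  rw [← torus_atlas_symm he, e.left_inv hp]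

theorem torus_chart_torusProj {n : ℕ}
    {e : OpenPartialHomeomorph (Torus n) (EuclideanSpace ℝ (Fin n))}
    (he : e ∈ atlas (EuclideanSpace ℝ (Fin n)) (Torus n)) {x : EuclideanSpace ℝ (Fin n)}
    (hx : torusProj n x ∈ e.source) :
    (fun y => e (torusProj n y)) =ᶠ[𝓝 x] fun y => y + (e (torusProj n x) - x) := by
  have hcont : Continuous (torusProj n) := (torusProj_isLocalHomeomorph n).continuous
  exact torus_translation (f := fun y => e (torusProj n y)) (e.open_source.preimage hcont)
    (e.continuousOn.comp hcont.continuousOn fun y hy => hy)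
    (fun y hy => torusProj_chart he hy) hx

theorem contMDiff_torusProj {n : ℕ} : ContMDiff 𝓘(ℝ, EuclideanSpace ℝ (Fin n))
    𝓘(ℝ, EuclideanSpace ℝ (Fin n)) ω (torusProj n) := by
  intro x
  rw [contMDiffAt_iff_target]
  refine ⟨(torusProj_isLocalHomeomorph n).continuous.continuousAt, ?_⟩
  rw [contMDiffAt_iff_contDiffAt]
  simp only [mfld_simps]
  exact (contDiff_id.add contDiff_const).contDiffAt.congr_of_eventuallyEq
    (torus_chart_torusProj (chart_mem_atlas _ _) (mem_chart_source _ _))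

/-- In a trivialization the frame is a constant vector, since the charts differ by translations. -/
theorem contMDiff_torusFrame {n : ℕ} (i : Fin n) :
    ContMDiff 𝓘(ℝ, EuclideanSpace ℝ (Fin n))
      (𝓘(ℝ, EuclideanSpace ℝ (Fin n)).prod 𝓘(ℝ, EuclideanSpace ℝ (Fin n))) ω
      (fun p : Torus n => (⟨p, torusFrame i p⟩ :
        TangentBundle 𝓘(ℝ, EuclideanSpace ℝ (Fin n)) (Torus n))) := by
  intro p₀
  rw [Bundle.contMDiffAt_section]
  refine (contMDiffAt_const (c := EuclideanSpace.single i (1 : ℝ))).congr_of_eventuallyEq ?_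
  filter_upwards [(chartAt (EuclideanSpace ℝ (Fin n)) p₀).open_source.mem_nhds
    (mem_chart_source _ p₀)] with p hp
  rw [TangentBundle.trivializationAt_apply]
  have h := torus_chart_torusProj (chart_mem_atlas _ p₀)
    (x := chartAt (EuclideanSpace ℝ (Fin n)) p p)
    (by rwa [torusProj_chart (chart_mem_atlas _ p) (mem_chart_source _ p)])
  have hd := ((hasFDerivAt_id (𝕜 := ℝ) (chartAt (EuclideanSpace ℝ (Fin n)) p p)).add_const
    _).congr_of_eventuallyEq h
  simp only [mfld_simps, torus_atlas_symm (chart_mem_atlas _ p)]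
  rw [fderivWithin_univ]
  exact congrArg (fun f : EuclideanSpace ℝ (Fin n) →L[ℝ] EuclideanSpace ℝ (Fin n) =>
    f (EuclideanSpace.single i (1 : ℝ))) hd.fderiv

theorem AnalyticTorusMetric.contMDiff_inner_torusFrame {n : ℕ} (g : AnalyticTorusMetric n)
    (i j : Fin n) : ContMDiff 𝓘(ℝ, EuclideanSpace ℝ (Fin n)) 𝓘(ℝ, ℝ) ω
      fun p : Torus n => g.inner p (torusFrame i p) (torusFrame j p) := by
  intro p
  have h := ContMDiffAt.clm_bundle_apply₂ (F₁ := EuclideanSpace ℝ (Fin n))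
    (F₂ := EuclideanSpace ℝ (Fin n)) (F₃ := ℝ) (E₃ := Bundle.Trivial (Torus n) ℝ)
    (g.contMDiff p) (contMDiff_torusFrame i p) (contMDiff_torusFrame j p)
  rw [Bundle.contMDiffAt_totalSpace] at h
  exact h.2

/-- The coefficients of a metric on the torus. -/
def AnalyticTorusMetric.coeff (g : AnalyticTorusMetric 3) (i j : Fin 3) (x : Fin 3 → ℝ) : ℝ :=
  g.inner (torusProj 3 (WithLp.toLp 2 x)) (torusFrame i _) (torusFrame j _)

theorem torusVector_eq_sum {n : ℕ} {p : Torus n}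
    (u : TangentSpace 𝓘(ℝ, EuclideanSpace ℝ (Fin n)) p) :
    u = ∑ i, (show EuclideanSpace ℝ (Fin n) from u) i • torusFrame i p := by
  have h := (EuclideanSpace.basisFun (Fin n) ℝ).sum_repr (show EuclideanSpace ℝ (Fin n) from u)
  simp only [EuclideanSpace.basisFun_apply] at h
  exact h.symm

theorem AnalyticTorusMetric.inner_eq_sum (g : AnalyticTorusMetric 3) (x : Fin 3 → ℝ)
    (u v : EuclideanSpace ℝ (Fin 3)) :
    g.inner (torusProj 3 (WithLp.toLp 2 x)) u v = ∑ i, ∑ j, u i * (v j * g.coeff i j x) := by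
  conv_lhs => rw [torusVector_eq_sum (p := torusProj 3 (WithLp.toLp 2 x)) u,
    torusVector_eq_sum (p := torusProj 3 (WithLp.toLp 2 x)) v]
  simp only [map_sum, map_smul, sum_apply, smul_apply, smul_eq_mul, Finset.mul_sum]
  rw [Finset.sum_comm]
  refine Finset.sum_congr rfl fun i _ => Finset.sum_congr rfl fun j _ => ?_
  simp only [AnalyticTorusMetric.coeff]
  ring

/-- The periodic matrix of coefficients of a metric on the torus. -/
def AnalyticTorusMetric.toPeriodicMetric (g : AnalyticTorusMetric 3) : PeriodicMetric where
  g := g.coeff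
  analytic i j :=
    { analytic := by
        rw [← contDiff_omega_iff_analyticOnNhd]
        exact ((g.contMDiff_inner_torusFrame i j).comp contMDiff_torusProj).contDiff.comp
          (PiLp.continuousLinearEquiv 2 ℝ (fun _ : Fin 3 => ℝ)).symm.contDiff
      periodic := fun k x => by
        have h : torusProj 3 (WithLp.toLp 2 (x + fun j => (k j : ℝ))) =
            torusProj 3 (WithLp.toLp 2 x) := by
          refine QuotientAddGroup.eq.2 fun j => ⟨-k j, ?_⟩
          simp
        rw [coeff, h]
        rfl }
  symm i j := funext fun x => g.symm _ _ _
  posDef x := by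
    refine Matrix.PosDef.of_dotProduct_mulVec_pos ?_ fun u hu => ?_
    · ext i j
      exact g.symm _ _ _
    · have h := g.pos (torusProj 3 (WithLp.toLp 2 x)) (WithLp.toLp 2 u : EuclideanSpace ℝ (Fin 3))
        (fun h => hu (congrArg WithLp.ofLp h))
      rw [g.inner_eq_sum] at h
      refine h.trans_eq ?_
      simp only [dotProduct, Matrix.mulVec, Matrix.of_apply, Finset.mul_sum, star_trivial]
      refine Finset.sum_congr rfl fun i _ => Finset.sum_congr rfl fun j _ => ?_
      ring

end

noncomputable section

open Topology

/-! ### The real torus in the strip manifold -/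

/-- The decomposition of `ℂ³` into real and imaginary parts. -/
def realSplitting : (EuclideanSpace ℝ (Fin 3) × EuclideanSpace ℝ (Fin 3)) ≃L[ℝ]
    EuclideanSpace ℂ (Fin 3) :=
  LinearEquiv.toContinuousLinearEquiv
    { toFun := fun p => complexPoint p.1 p.2
      map_add' := fun p q => by
        ext j
        simp only [complexPoint_apply, PiLp.add_apply, Prod.fst_add, Prod.snd_add]
        push_cast
        ring
      map_smul' := fun c p => by
        ext j
        simp only [complexPoint_apply, PiLp.smul_apply, Prod.smul_fst, Prod.smul_snd, smul_eq_mul,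
          RingHom.id_apply, Complex.real_smul]
        push_cast
        ring
      invFun := fun z => (WithLp.toLp 2 fun j => (z j).re, WithLp.toLp 2 fun j => (z j).im)
      left_inv := fun p => by
        ext j <;> simp [complexPoint_apply]
      right_inv := fun z => by
        ext j
        simp [complexPoint_apply, Complex.re_add_im] }

/-- The inclusion of `ℝ³` in `ℂ³`. -/
def realInclusion : EuclideanSpace ℝ (Fin 3) →L[ℝ] EuclideanSpace ℂ (Fin 3) :=
  realSplitting.toContinuousLinearMap.comp (ContinuousLinearMap.inl ℝ _ _)

theorem realInclusion_eq (x : EuclideanSpace ℝ (Fin 3)) :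
    realInclusion x = complexPoint x 0 := rfl

theorem realInclusion_apply (x : EuclideanSpace ℝ (Fin 3)) (j : Fin 3) :
    realInclusion x j = x j := by
  rw [realInclusion_eq]
  simp [complexPoint_apply]

theorem realInclusion_mem_realLattice {x : EuclideanSpace ℝ (Fin 3)} :
    realInclusion x ∈ realLattice ↔ x ∈ integerLattice 3 := by
  refine forall_congr' fun j => exists_congr fun k => ?_
  rw [realInclusion_apply]
  exact ⟨fun h => Complex.ofReal_injective (h.trans (Complex.ofReal_intCast k).symm),
    fun h => by simp [h]⟩

theorem realInclusion_mem_complexStrip {r : ℝ} (hr : 0 < r) (x : EuclideanSpace ℝ (Fin 3)) :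
    realInclusion x ∈ complexStrip r := fun j => by
  rw [realInclusion_apply]
  simpa using hr

/-- The inclusion `ℝ³ / ℤ³ → ℂ³ / ℤ³`. -/
def torusToCylinder : Torus 3 →+ ComplexCylinder :=
  QuotientAddGroup.map (integerLattice 3) realLattice realInclusion.toLinearMap.toAddMonoidHom
    fun _ hx => realInclusion_mem_realLattice.2 hx

theorem torusToCylinder_torusProj (x : EuclideanSpace ℝ (Fin 3)) :
    torusToCylinder (torusProj 3 x) = cylinderProj (realInclusion x) := rfl

theorem torusProj_surjective (n : ℕ) : Function.Surjective (torusProj n) :=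
  Quotient.mk_surjective

/-- The inclusion of the torus in the strip manifold. -/
def torusToStrip {r : ℝ} (hr : 0 < r) (p : Torus 3) : StripManifold r :=
  ⟨torusToCylinder p, by
    obtain ⟨x, rfl⟩ := torusProj_surjective 3 p
    rw [torusToCylinder_torusProj, cylinderProj_mem_stripOpens]
    exact realInclusion_mem_complexStrip hr x⟩

theorem coe_torusToStrip_torusProj {r : ℝ} (hr : 0 < r) (x : EuclideanSpace ℝ (Fin 3)) :
    (torusToStrip hr (torusProj 3 x) : ComplexCylinder) = cylinderProj (realInclusion x) := rfl

theorem continuous_torusToStrip {r : ℝ} (hr : 0 < r) : Continuous (torusToStrip hr) := by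
  refine Continuous.subtype_mk ?_ _
  refine continuous_quot_lift _ ?_
  exact cylinderProj_isLocalHomeomorph.continuous.comp realInclusion.continuous

theorem torusToStrip_injective {r : ℝ} (hr : 0 < r) : Function.Injective (torusToStrip hr) := by
  intro p q h
  obtain ⟨x, rfl⟩ := torusProj_surjective 3 p
  obtain ⟨y, rfl⟩ := torusProj_surjective 3 q
  have h1 : cylinderProj (realInclusion x) = cylinderProj (realInclusion y) :=
    congrArg Subtype.val h
  rw [cylinderProj_eq_iff, ← map_sub, realInclusion_mem_realLattice, sub_eq_neg_add] at h1
  exact QuotientAddGroup.eq.2 h1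

theorem torus_compactSpace : CompactSpace (Torus 3) := by
  have hK : IsCompact (WithLp.toLp 2 '' Set.pi Set.univ fun _ : Fin 3 => Set.Icc (0 : ℝ) 1) :=
    (isCompact_univ_pi fun _ => isCompact_Icc).image (PiLp.continuous_toLp 2 _)
  refine ⟨?_⟩
  convert hK.image (torusProj_isLocalHomeomorph 3).continuous
  refine (Set.eq_univ_of_forall fun p => ?_).symm
  obtain ⟨x, rfl⟩ := torusProj_surjective 3 p
  refine ⟨WithLp.toLp 2 fun j => Int.fract (x j), ⟨_, fun j _ =>
    ⟨Int.fract_nonneg _, (Int.fract_lt_one _).le⟩, rfl⟩, ?_⟩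
  refine QuotientAddGroup.eq.2 fun j => ⟨⌊x j⌋, ?_⟩
  simp [← Int.self_sub_fract, sub_eq_neg_add]

/-- A continuous injection of a compact space into a Hausdorff one. -/
theorem isEmbedding_torusToStrip {r : ℝ} (hr : 0 < r) : IsEmbedding (torusToStrip hr) :=
  haveI := torus_compactSpace
  ((continuous_torusToStrip hr).isClosedEmbedding (torusToStrip_injective hr)).isEmbedding

theorem liftChart_torusToStrip {r : ℝ} (hr : 0 < r)
    {ψ : OpenPartialHomeomorph (StripManifold r) (EuclideanSpace ℂ (Fin 3))} (hψ : IsLiftChart ψ)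
    {x : EuclideanSpace ℝ (Fin 3)} (hx : torusToStrip hr (torusProj 3 x) ∈ ψ.source) :
    (fun y => ψ (torusToStrip hr (torusProj 3 y))) =ᶠ[𝓝 x]
      fun y => realInclusion y + (ψ (torusToStrip hr (torusProj 3 x)) - realInclusion x) := by
  have hc : Continuous fun y => torusToStrip hr (torusProj 3 y) :=
    (continuous_torusToStrip hr).comp (torusProj_isLocalHomeomorph 3).continuous
  have h1 {y} (hy : torusToStrip hr (torusProj 3 y) ∈ ψ.source) :
      cylinderProj (ψ (torusToStrip hr (torusProj 3 y))) = cylinderProj (realInclusion y) := by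
    rw [hψ.cylinderProj_apply hy, coe_torusToStrip_torusProj]
  refine lift_eventuallyEq (ContinuousAt.comp (ψ.continuousAt hx) hc.continuousAt)
    (by fun_prop) (by abel) ?_
  filter_upwards [hc.continuousAt.preimage_mem_nhds (ψ.open_source.mem_nhds hx)] with y hy
  rw [h1 hy, cylinderProj_add]
  exact cylinderProj_eq_iff.1 (h1 hx).symm

theorem hasMFDerivAt_torusToStrip {r : ℝ} (hr : 0 < r) (p : Torus 3) :
    HasMFDerivAt 𝓘(ℝ, EuclideanSpace ℝ (Fin 3)) 𝓘(ℝ, EuclideanSpace ℂ (Fin 3))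
      (torusToStrip hr) p realInclusion := by
  refine ⟨(continuous_torusToStrip hr).continuousAt, ?_⟩
  simp only [mfld_simps, torus_atlas_symm (chart_mem_atlas _ p)]
  have hp := torusProj_chart (chart_mem_atlas _ p) (mem_chart_source _ p)
  have h := liftChart_torusToStrip hr (isLiftChart_of_mem_atlas
    (chart_mem_atlas _ (torusToStrip hr p)))
    (x := chartAt (EuclideanSpace ℝ (Fin 3)) p p) (by rw [hp]; exact mem_chart_source _ _)
  exact ((realInclusion.hasFDerivAt.add_const _).congr_of_eventuallyEq h).hasFDerivWithinAt

theorem torusDifferential_torusToStrip {r : ℝ} (hr : 0 < r) (p : Torus 3) :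
    torusDifferential (torusToStrip hr) p = realInclusion :=
  (hasMFDerivAt_torusToStrip hr p).mfderiv

/-- A lift chart translated by an integer vector. -/
theorem IsLiftChart.translate {r : ℝ}
    {ψ : OpenPartialHomeomorph (StripManifold r) (EuclideanSpace ℂ (Fin 3))} (hψ : IsLiftChart ψ)
    {m : EuclideanSpace ℂ (Fin 3)} (hm : m ∈ realLattice) :
    IsLiftChart (ψ.transHomeomorph (Homeomorph.addRight m)) := by
  intro z hz
  have hz' : z + -m ∈ ψ.target := hz
  exact (hψ _ hz').trans (cylinderProj_add (realLattice.neg_mem hm))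

theorem isImmersion_torusToStrip {r : ℝ} (hr : 0 < r) :
    Manifold.IsImmersion 𝓘(ℝ, EuclideanSpace ℝ (Fin 3)) 𝓘(ℝ, EuclideanSpace ℂ (Fin 3)) ω
      (torusToStrip hr) := by
  refine Manifold.IsImmersionOfComplement.isImmersion (F := EuclideanSpace ℝ (Fin 3)) fun p => ?_
  set φ := chartAt (EuclideanSpace ℝ (Fin 3)) p with hφ
  set ψ := chartAt (EuclideanSpace ℂ (Fin 3)) (torusToStrip hr p) with hψ
  have hψl : IsLiftChart ψ := isLiftChart_of_mem_atlas (chart_mem_atlas _ _)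
  have hp : torusProj 3 (φ p) = p := torusProj_chart (chart_mem_atlas _ p) (mem_chart_source _ p)
  have hps : torusToStrip hr p ∈ ψ.source := mem_chart_source _ _
  -- The two charts may choose lifts that differ by a lattice vector; translating the target chart
  -- by m makes the map read exactly as the real inclusion.
  set m := realInclusion (φ p) - ψ (torusToStrip hr p) with hm
  have hml : m ∈ realLattice := by
    rw [← cylinderProj_eq_iff, hψl.cylinderProj_apply hps, ← coe_torusToStrip_torusProj hr, hp]
  have h := liftChart_torusToStrip hr hψl (x := φ p) (by rwa [hp])
  obtain ⟨U, hU, hUo, hpU⟩ := eventually_nhds_iff.1 h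
  -- The local formula holds only on the neighbourhood U, so the source chart is restricted to it.
  set φ' := φ.restr (φ.source ∩ φ ⁻¹' U) with hφ'
  have hVo : IsOpen (φ.source ∩ φ ⁻¹' U) := φ.isOpen_inter_preimage hUo
  refine Manifold.IsImmersionAtOfComplement.mk_of_continuousAt
    (continuous_torusToStrip hr).continuousAt realSplitting φ'
    (ψ.transHomeomorph (Homeomorph.addRight m)) ?_ ?_ ?_ (hψl.translate hml).mem_maximalAtlas ?_
  · rw [hφ', OpenPartialHomeomorph.restr_source' _ _ hVo]
    exact ⟨mem_chart_source _ p, mem_chart_source _ p, hpU⟩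
  · exact hps
  · exact restr_mem_maximalAtlas _ (IsManifold.chart_mem_maximalAtlas p) hVo
  · intro y hy
    have hy1 : y ∈ φ'.target := by simpa using hy
    have hy2 := φ'.map_target hy1
    rw [hφ', OpenPartialHomeomorph.restr_source' _ _ hVo] at hy2
    have hy3 : φ.symm y ∈ φ.source ∩ φ ⁻¹' U := hy2.2
    have hyt : y ∈ φ.target := by
      rw [hφ', OpenPartialHomeomorph.restr_target] at hy1
      exact hy1.1
    have hyU : y ∈ U := by
      have := hy3.2
      rwa [Set.mem_preimage, φ.right_inv hyt] at this
    have h2 := hU y hyU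
    have hsymm : φ.symm y = torusProj 3 y := congrFun (torus_atlas_symm (chart_mem_atlas _ p)) y
    change ψ (torusToStrip hr (φ.symm y)) + m = realInclusion y
    rw [hsymm]
    refine (congrArg (· + m) h2).trans ?_
    simp only [hp, hm]
    abel

/-! ### The special Lagrangian embedding -/

namespace CalabiYauHessian

variable {𝔤 : PeriodicMetric} (S : CalabiYauHessian 𝔤)

theorem kahlerForm_torusToStrip (x : EuclideanSpace ℝ (Fin 3)) :
    S.calabiYauStructure.κ (torusToStrip S.radius_pos (torusProj 3 x)) =
      S.kahlerForm (realInclusion x) :=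
  S.isStripPeriodic_kahlerForm.apply_stripLift (coe_torusToStrip_torusProj S.radius_pos x)

theorem holomorphicForm_torusToStrip (x : EuclideanSpace ℝ (Fin 3)) :
    S.calabiYauStructure.Ω (torusToStrip S.radius_pos (torusProj 3 x)) =
      S.holomorphicForm (realInclusion x) :=
  S.isStripPeriodic_holomorphicForm.apply_stripLift (coe_torusToStrip_torusProj S.radius_pos x)

theorem kahlerForm_real (x u v : EuclideanSpace ℝ (Fin 3)) :
    S.kahlerForm (realInclusion x) ![realInclusion u, realInclusion v] = 0 := by
  rw [S.kahlerForm_apply (realInclusion_mem_complexStrip S.radius_pos x), kahlerBilin,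
    hessBilin_eq, hessBilin_eq]
  have h (i d) : S.hess (.inl i) d (realInclusion x) = 0 := S.hess_real_left x i d
  have h' (i d) : S.hess d (.inl i) (realInclusion x) = 0 := by rw [S.symm, h]
  simp [h, h', realInclusion_apply]

/-- For real u and v, κ(u, iv) = Q(iu, iv) + Q(u, v). The second term involves only derivatives in x
and vanishes; the first is the yy-block g. -/
theorem kahlerForm_real_smul_I (x u v : EuclideanSpace ℝ (Fin 3)) :
    S.kahlerForm (realInclusion x) ![realInclusion u, Complex.I • realInclusion v] =
      ∑ i, ∑ j, u i * (v j * 𝔤.g i j x) := by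
  rw [S.kahlerForm_apply (realInclusion_mem_complexStrip S.radius_pos x),
    kahlerBilin_smul_I_right, hessBilin_eq, hessBilin_eq, ← Finset.sum_add_distrib]
  refine Finset.sum_congr rfl fun i _ => ?_
  rw [← Finset.sum_add_distrib]
  refine Finset.sum_congr rfl fun j _ => ?_
  have h (i d) : S.hess (.inl i) d (realInclusion x) = 0 := S.hess_real_left x i d
  have h' (i d) : S.hess d (.inl i) (realInclusion x) = 0 := by rw [S.symm, h]
  have h'' : S.hess (.inr i) (.inr j) (realInclusion x) = 𝔤.g i j x := S.hess_real x i j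
  simp [h, h', h'', realInclusion_apply]
  ring

theorem holomorphicForm_real (x : EuclideanSpace ℝ (Fin 3))
    (u : Fin 3 → EuclideanSpace ℝ (Fin 3)) :
    S.holomorphicForm (realInclusion x) (fun i => realInclusion (u i)) =
      ((√(𝔤.det x) * (Matrix.of fun i j => u j i).det : ℝ) : ℂ) := by
  have h : S.density (realInclusion x) = (√(𝔤.det x) : ℝ) := S.density_real x
  rw [S.holomorphicForm_apply, h, Complex.ofReal_mul]
  congr 1
  rw [← Complex.coe_algebraMap, RingHom.map_det]
  congr 1
  ext i j
  exact realInclusion_apply _ _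

end CalabiYauHessian

theorem AnalyticTorusMetric.isSpecialLagrangianIsometricEmbedding (g : AnalyticTorusMetric 3)
    (S : CalabiYauHessian g.toPeriodicMetric) :
    IsSpecialLagrangianIsometricEmbedding g S.calabiYauStructure (torusToStrip S.radius_pos) where
  embedding := ⟨isImmersion_torusToStrip S.radius_pos, isEmbedding_torusToStrip S.radius_pos⟩
  isometric p u v := by
    obtain ⟨x, rfl⟩ := torusProj_surjective 3 p
    rw [torusDifferential_torusToStrip, CalabiYauStructure.metric, S.kahlerForm_torusToStrip]
    exact (S.kahlerForm_real_smul_I x u v).trans (g.inner_eq_sum x u v).symm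
  re_eq_volume p u := by
    obtain ⟨x, rfl⟩ := torusProj_surjective 3 p
    rw [torusDifferential_torusToStrip, S.holomorphicForm_torusToStrip]
    exact (congrArg Complex.re (S.holomorphicForm_real x u)).trans (Complex.ofReal_re _)
  im_eq_zero p u := by
    obtain ⟨x, rfl⟩ := torusProj_surjective 3 p
    rw [torusDifferential_torusToStrip, S.holomorphicForm_torusToStrip]
    exact (congrArg Complex.im (S.holomorphicForm_real x u)).trans (Complex.ofReal_im _)
  lagrangian p u v := by
    obtain ⟨x, rfl⟩ := torusProj_surjective 3 p
    rw [torusDifferential_torusToStrip, S.kahlerForm_torusToStrip]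
    exact S.kahlerForm_real x u v

theorem mainTheorem2 (g : AnalyticTorusMetric 3) :
    ∃ (N : Type) (_ : TopologicalSpace N) (_ : T2Space N) (_ : SecondCountableTopology N)
      (_ : ConnectedSpace N) (_ : ChartedSpace (EuclideanSpace ℂ (Fin 3)) N)
      (_ : IsManifold 𝓘(ℂ, EuclideanSpace ℂ (Fin 3)) ω N)
      (X : CalabiYauStructure 3 N) (ι : Torus 3 → N),
      X.c = -(Nat.factorial 3 : ℂ) * (Complex.I / 2) ^ 3 ∧
      IsSpecialLagrangianIsometricEmbedding g X ι := by
  obtain ⟨S⟩ := g.toPeriodicMetric.exists_calabiYauHessian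
  exact ⟨StripManifold S.radius, inferInstance, inferInstance, inferInstance,
    stripManifold_connectedSpace S.radius_pos, inferInstance, inferInstance, S.calabiYauStructure,
    torusToStrip S.radius_pos, rfl, g.isSpecialLagrangianIsometricEmbedding S⟩

end
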